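/- Let $\mathfrak a\subset \mathrm{gl}(N,\mathbb C)$ be an abelian subalgebra, regarded as a complex manifold, and let $E$ be the Euler vector field on $\mathfrak a$ (the generator of $a\mapsto e^{\tau}a$). Let $W\subset\mathfrak a$ be a simply connected open set, and let $b$ be a holomorphic $\mathrm{gl}(N,\mathbb C)$-valued function and $\beta$ a holomorphic $\mathrm{gl}(N,\mathbb C)$-valued 1-form on $W$ such that $$\mathrm d b+[\beta,b]=0,\qquad [\beta,a]=[b,\mathrm d a],\qquad b=i_E\beta,\qquad \mathcal L_E\beta=0. \tag{1}$$ Let $f:W\times\mathbb C\to \mathrm{GL}(N,\mathbb C)$, $(a,z)\mapsto f(a,z)$, be holomorphic with $\mathrm d f+\beta f+z\,\mathrm d a\,f=0$, where $\mathrm d$ is the exterior derivative in $a$. Let $M$ be the set of pairs $(s,t)\in\mathfrak a\times\mathfrak a$ such that $t+e^{i\theta}s\in W$ for all real $\theta$, let $M_t=\{s:(s,t)\in M\}$, and let $M_0$ be the connected component of $M$ that contains $\{(0,t):t\in W\}$. For $(s,t)\in M$, a Birkhoff factorization at $(s,t)$ is an identity $$f(z^{-1}s+t,z)=f_-(s,t,z)^{-1}f_+(s,t,z)\qquad(|z|=1),$$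 where $f_+$ (respectively $f_-$) is $\mathrm{GL}(N,\mathbb C)$-valued and continuous on $|z|\le 1$ (respectively $|z|\ge1$), holomorphic in $z$ on $|z|<1$ (respectively $|z|>1$), and $f_-\to\exp(s)$ as $z\to\infty$. Then, wherever Birkhoff factorizations exist: 1. $f_+(s,t,0)$ is independent of $s$: if $(s,t)\in M_0$, if $s'$ lies in the same connected component of $M_t$ as $s$, and if there are factorizations at $(s,t)$ and at $(s',t)$, then $f_+(s,t,0)=f_+(s',t,0)$. 2. If $t\in W$, if $s$ lies in the connected component of $0$ in $M_t$, and if there is a factorization at $(s,t)$, then $f_+(s,t,0)=f(t,0)$. 3. The factorization continues $b$ beyond $W$: let $V\subset\mathfrak a$ be open and $\sigma:V\to\mathfrak a$ continuous with $(\sigma(t),t)\in M_0$ for all $t\in V$, let there be a factorization at $(\sigma(t),t)$ for every $t\in V$, and put $k(t)=f_+(\sigma(t),t,0)$. Then $k$ is holomorphic on $V$, and $\hat\beta=-(\mathrm d k)k^{-1}$, $\hat b=i_E\hat\beta$ are holomorphic and satisfy (1) on $V$; moreover $\hat\beta=\beta$ and $\hat b=b$ at every $t\in V\cap W$ for which $\sigma(t)$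 lies in the connected component of $0$ in $M_t$. If $W$ is convex, then $M$ and all the $M_t$ are connected, so that $M_0=M$ and the restrictions to components are empty. -/

import Mathlib

open scoped Matrix.Norms.Operator

noncomputable section

namespace Isomonodromy

/-- The algebra `gl(N, ℂ)` of complex `N × N` matrices. -/
abbrev Gl (N : ℕ) : Type := Matrix (Fin N) (Fin N) ℂ

/-- A subspace `𝔞` of `gl(N, ℂ)` is an abelian subalgebra (for the commutator bracket) when any two
of its elements commute. -/
def IsAbelianSubalgebra {N : ℕ} (𝔞 : Submodule ℂ (Gl N)) : Prop :=
  ∀ x ∈ 𝔞, ∀ y ∈ 𝔞, ⁅x, y⁆ = 0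

variable {N : ℕ} {𝔞 : Submodule ℂ (Gl N)}

/-- The contraction `i_X β` of a matrix-valued 1-form `β` on `𝔞` with a vector field `X`. -/
def contraction (X : 𝔞 → 𝔞) (β : 𝔞 → (𝔞 →L[ℂ] Gl N)) : 𝔞 → Gl N :=
  fun a => β a (X a)

/-- The Lie derivative of a matrix-valued 1-form `β` on `𝔞` along a vector field `X`:
`(ℒ_X β)(c) = (D_X β)(c) + β (D_c X)` for constant `c`. -/
def lieDerivative (X : 𝔞 → 𝔞) (β : 𝔞 → (𝔞 →L[ℂ] Gl N)) : 𝔞 → (𝔞 →L[ℂ] Gl N) :=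
  fun a => fderiv ℂ β a (X a) + (β a).comp (fderiv ℂ X a)

/-- The Euler vector field on `𝔞`, the generator of the flow `a ↦ exp(τ) a`. -/
def euler (𝔞 : Submodule ℂ (Gl N)) : 𝔞 → 𝔞 := fun a => a

/-- `(b, β)` is a solution of the deformation problem on `W`: `b` and the 1-form `β` are
holomorphic on `W`, `d b + [β, b] = 0`, `[β, a] = [b, d a]`, `b = i_E β` and `ℒ_E β = 0`. -/
structure IsDeformationSolution (W : Set 𝔞) (b : 𝔞 → Gl N) (β : 𝔞 → (𝔞 →L[ℂ] Gl N)) : Prop where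
  holomorphic_b : DifferentiableOn ℂ b W
  holomorphic_form : DifferentiableOn ℂ β W
  deformation : ∀ a ∈ W, ∀ c : 𝔞, fderiv ℂ b a c + ⁅β a c, b a⁆ = 0
  bracket : ∀ a ∈ W, ∀ c : 𝔞, ⁅β a c, (a : Gl N)⁆ = ⁅b a, (c : Gl N)⁆
  higgs : ∀ a ∈ W, b a = contraction (euler 𝔞) β a
  invariant : ∀ a ∈ W, lieDerivative (euler 𝔞) β a = 0

/-- `f` is a fundamental (`GL(N, ℂ)`-valued) solution on `W × ℂ`, holomorphic in `(a, z)`, of the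
linear system `d f + β f + z (d a) f = 0`, where `d` is the exterior derivative in `a`. -/
structure IsFundamentalSolution (W : Set 𝔞) (β : 𝔞 → (𝔞 →L[ℂ] Gl N)) (f : 𝔞 → ℂ → Gl N) :
    Prop where
  holomorphic : DifferentiableOn ℂ (fun p : 𝔞 × ℂ => f p.1 p.2) (W ×ˢ Set.univ)
  isUnit : ∀ a ∈ W, ∀ z : ℂ, IsUnit (f a z)
  linear : ∀ a ∈ W, ∀ z : ℂ, ∀ c : 𝔞,
    fderiv ℂ (fun a' => f a' z) a c + β a c * f a z + z • ((c : Gl N) * f a z) = 0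

/-- The pairs `(s, t)` such that `t + exp(iθ) s ∈ W` for all real `θ`. -/
def circlePairs (W : Set 𝔞) : Set (𝔞 × 𝔞) :=
  {p | ∀ θ : ℝ, p.2 + Complex.exp (θ * Complex.I) • p.1 ∈ W}

/-- For a given `t`, the `s` such that `t + exp(iθ) s ∈ W` for all real `θ`. -/
def circleSlice (W : Set 𝔞) (t : 𝔞) : Set 𝔞 :=
  {s | (s, t) ∈ circlePairs W}

/-- The pairs `(s, t)` that can be joined to some `(0, t₀)`, `t₀ ∈ W`, within `circlePairs W`. -/
def mainPairs (W : Set 𝔞) : Set (𝔞 × 𝔞) :=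
  ⋃ t₀ ∈ W, connectedComponentIn (circlePairs W) (0, t₀)

/-- `f (z⁻¹ s + t, z) = f₋(z)⁻¹ f₊(z)` on the unit circle is the Birkhoff factorization at `(s, t)`:
`f₊` and `f₋` are `GL(N, ℂ)`-valued and continuous up to the unit circle and holomorphic
respectively inside and outside it, and `f₋ = exp(s)` at `z = ∞`. -/
structure IsBirkhoffFactorization (f : 𝔞 → ℂ → Gl N) (s t : 𝔞) (fm fp : ℂ → Gl N) : Prop where
  holomorphic_inside : DiffContOnCl ℂ fp (Metric.ball 0 1)
  isUnit_inside : ∀ z : ℂ, ‖z‖ ≤ 1 → IsUnit (fp z)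
  holomorphic_outside : DiffContOnCl ℂ fm (Metric.closedBall 0 1)ᶜ
  isUnit_outside : ∀ z : ℂ, 1 ≤ ‖z‖ → IsUnit (fm z)
  at_infinity : Filter.Tendsto fm (Filter.cocompact ℂ) (nhds (NormedSpace.exp (s : Gl N)))
  factorization : ∀ z : ℂ, ‖z‖ = 1 → f (z⁻¹ • s + t) z = (fm z)⁻¹ * fp z

/-- The 1-form `-(d k) k⁻¹`, that is, the `β` with `d k + β k = 0`. -/
def formOf (k : 𝔞 → Gl N) : 𝔞 → (𝔞 →L[ℂ] Gl N) :=
  fun a => -(((ContinuousLinearMap.mul ℂ (Gl N)).flip (k a)⁻¹).comp (fderiv ℂ k a))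

end Isomonodromy

end

/-!
The value of `f₊` at `z = 0` is read off from a Toeplitz operator. To the loop
`z ↦ f (z⁻¹ s + t, z)` belongs the operator `loopToeplitz f (s, t)` on absolutely summable
sequences, thought of as Laurent series in negative powers: multiply on the right by the loop and
keep the negative powers. A Birkhoff factorization forces this operator to be injective
(`toeplitz_injective`, by Liouville's theorem), and the first coefficient of a solution `m` of
`loopToeplitz f (s, t) m = (1, 0, 0, …)` is `f₊(s, t, 0)⁻¹ exp(s)` (`head_mul_inverse_eq`).

The loop is holomorphic and invertible near the circle, so the Toeplitz operator of the inverse loop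
is a parametrix. At `(0, t)` with `t ∈ W` the loop extends to an entire invertible function, and the
operator is Fredholm of index zero; since `mainPairs W` is connected, the same is true on all of it
(`IsFundamentalSolution.isFredholmZero`). Hence an injective Toeplitz operator is invertible, and
locally the pairs at which the operator is not invertible form the zero locus of a holomorphic
function (`exists_holomorphic_isUnit_iff`). The complement of such a locus in a connected open set
is connected (`IsHypersurfaceCompl.isPreconnected`), so the set `regularPairs W f` of pairs with
invertible operator is connected, and so is its subset `factorPairs W f` on which the candidate
`recip f` for `f₊(s, t, 0)⁻¹` is invertible. It contains all pairs that admit a factorization.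

On these sets `recip f` is holomorphic. For `s` near `0` the factorization is explicit, with
`f₊ = f(t, ·)` (`IsFundamentalSolution.exists_factorization`): that `f₋` tends to `exp(s)` is seen
by comparing `f` with the exponential along a segment of length `O(z⁻¹)`. By the identity theorem,
what holds near the points `(0, t)` holds everywhere: `recip f` has derivative zero in the direction
of `s`, and the form `-(d k) k⁻¹` built from `k = f₊(·, ·, 0)` satisfies in `t` the equations of a
deformation solution. The constancy in `s` is used along components of slices, after removal of a
hypersurface once more, and in a neighbourhood of the graph of `σ`.
-/

noncomputable section

open Set Filter Topology Metric

/-! ### Holomorphic functions of several variables -/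

section SeveralVariables

variable {X E : Type*} [NormedAddCommGroup X] [NormedSpace ℂ X]
  [NormedAddCommGroup E] [NormedSpace ℂ E]

omit [NormedSpace ℂ X] in
theorem exists_ball_prod_subset_of_sphere {O : Set (X × ℂ)} (hO : IsOpen O) {x₀ : X} {R : ℝ}
    (h : ∀ z ∈ sphere (0 : ℂ) R, (x₀, z) ∈ O) :
    ∃ ε > 0, ∀ x ∈ ball x₀ ε, ∀ z ∈ sphere (0 : ℂ) R, (x, z) ∈ O := by
  obtain ⟨u, v, hu, -, hxu, hv, huv⟩ := generalized_tube_lemma (isCompact_singleton (x := x₀))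
    (isCompact_sphere (0 : ℂ) R) hO (by rintro ⟨x, z⟩ ⟨hx, hz⟩; rw [mem_singleton_iff] at hx
                                        subst hx; exact h z hz)
  obtain ⟨ε, hε, hb⟩ := Metric.isOpen_iff.1 hu x₀ (hxu rfl)
  exact ⟨ε, hε, fun x hx z hz => huv ⟨hb hx, hv hz⟩⟩

omit [NormedSpace ℂ X] in
theorem exists_norm_lt_of_sphere {Z : Type*} [NormedAddCommGroup Z] {O : Set (X × ℂ)}
    {Ψ : X × ℂ → Z} (hΨ : ContinuousOn Ψ O) {x₀ : X} {R : ℝ}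
    (h : ∀ z ∈ sphere (0 : ℂ) R, (x₀, z) ∈ O) :
    ∃ C, ∀ z ∈ sphere (0 : ℂ) R, ‖Ψ (x₀, z)‖ < C := by
  have hc : ContinuousOn (fun z : ℂ => ‖Ψ (x₀, z)‖) (sphere 0 R) :=
    (hΨ.comp (by fun_prop) h).norm
  obtain ⟨C, hC⟩ := (isCompact_sphere (0 : ℂ) R).bddAbove_image hc
  exact ⟨C + 1, fun z hz => lt_of_le_of_lt (hC (mem_image_of_mem _ hz)) (lt_add_one C)⟩

omit [NormedSpace ℂ X] in
theorem continuousAt_circleIntegral {O : Set (X × ℂ)} (hO : IsOpen O) {Φ : X → ℂ → E}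
    (hΦ : ContinuousOn (fun p : X × ℂ => Φ p.1 p.2) O) {x₀ : X} {R : ℝ} (hR : 0 ≤ R)
    (h : ∀ z ∈ sphere (0 : ℂ) R, (x₀, z) ∈ O) :
    ContinuousAt (fun x => ∮ z in C(0, R), Φ x z) x₀ := by
  obtain ⟨C, hC⟩ := exists_norm_lt_of_sphere hΦ h
  obtain ⟨ε, hε, hb⟩ := exists_ball_prod_subset_of_sphere
    (hΦ.norm.isOpen_inter_preimage hO (isOpen_Iio (a := C))) (fun z hz => ⟨h z hz, hC z hz⟩)
  have hcirc : ∀ θ, circleMap 0 R θ ∈ sphere (0 : ℂ) R := fun θ => circleMap_mem_sphere 0 hR θ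
  have hcont : ∀ x ∈ ball x₀ ε, Continuous fun θ : ℝ =>
      deriv (circleMap 0 R) θ • Φ x (circleMap 0 R θ) := by
    intro x hx
    have h1 : Continuous fun θ : ℝ => Φ x (circleMap 0 R θ) :=
      hΦ.comp_continuous (f := fun θ : ℝ => (x, circleMap 0 R θ)) (by fun_prop)
        fun θ => (hb x hx _ (hcirc θ)).1
    simp only [deriv_circleMap]
    exact Continuous.smul (by fun_prop) h1
  simp only [circleIntegral]
  refine intervalIntegral.continuousAt_of_dominated_interval (bound := fun _ => R * C) ?_ ?_
    (by simp) ?_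
  · filter_upwards [ball_mem_nhds x₀ hε] with x hx
    exact (hcont x hx).aestronglyMeasurable
  · filter_upwards [ball_mem_nhds x₀ hε] with x hx
    refine Eventually.of_forall fun θ _ => ?_
    rw [norm_smul]
    have : ‖deriv (circleMap 0 R) θ‖ = R := by simp [deriv_circleMap, abs_of_nonneg hR]
    rw [this]
    exact mul_le_mul_of_nonneg_left (hb x hx _ (hcirc θ)).2.le hR
  · refine Eventually.of_forall fun θ _ => ?_
    have : ContinuousAt (fun x => Φ x (circleMap 0 R θ)) x₀ :=
      ContinuousAt.comp (g := fun p : X × ℂ => Φ p.1 p.2) (f := fun x => (x, circleMap 0 R θ))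
        (hΦ.continuousAt (hO.mem_nhds (h _ (hcirc θ)))) (by fun_prop)
    exact this.const_smul _

theorem differentiableAt_circleIntegral {O : Set (X × ℂ)} (hO : IsOpen O) {Φ : X → ℂ → E}
    (hΦ : DifferentiableOn ℂ (fun p : X × ℂ => Φ p.1 p.2) O)
    (hΦ' : ContinuousOn (fderiv ℂ (fun p : X × ℂ => Φ p.1 p.2)) O) {x₀ : X} {R : ℝ} (hR : 0 ≤ R)
    (h : ∀ z ∈ sphere (0 : ℂ) R, (x₀, z) ∈ O) :
    DifferentiableAt ℂ (fun x => ∮ z in C(0, R), Φ x z) x₀ := by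
  set D := fderiv ℂ (fun p : X × ℂ => Φ p.1 p.2) with hD
  obtain ⟨C, hC⟩ := exists_norm_lt_of_sphere hΦ' h
  obtain ⟨ε, hε, hb⟩ := exists_ball_prod_subset_of_sphere
    (hΦ'.norm.isOpen_inter_preimage hO (isOpen_Iio (a := C))) (fun z hz => ⟨h z hz, hC z hz⟩)
  have hcirc : ∀ θ, circleMap 0 R θ ∈ sphere (0 : ℂ) R := fun θ => circleMap_mem_sphere 0 hR θ
  have hcont : ∀ x ∈ ball x₀ ε, Continuous fun θ : ℝ =>
      deriv (circleMap 0 R) θ • Φ x (circleMap 0 R θ) := by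
    intro x hx
    have h1 : Continuous fun θ : ℝ => Φ x (circleMap 0 R θ) :=
      hΦ.continuousOn.comp_continuous (f := fun θ : ℝ => (x, circleMap 0 R θ)) (by fun_prop)
        fun θ => (hb x hx _ (hcirc θ)).1
    simp only [deriv_circleMap]
    exact Continuous.smul (by fun_prop) h1
  simp only [circleIntegral]
  have key := intervalIntegral.hasFDerivAt_integral_of_dominated_of_fderiv_le (𝕜 := ℂ)
    (μ := MeasureTheory.volume) (a := 0) (b := 2 * Real.pi)
    (F := fun x θ => deriv (circleMap 0 R) θ • Φ x (circleMap 0 R θ))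
    (F' := fun x θ => deriv (circleMap 0 R) θ •
      (D (x, circleMap 0 R θ)).comp (ContinuousLinearMap.inl ℂ X ℂ))
    (x₀ := x₀) (bound := fun _ => R * C) (ball_mem_nhds x₀ hε) ?_ ?_ ?_ ?_ (by simp) ?_
  · exact key.differentiableAt
  · filter_upwards [ball_mem_nhds x₀ hε] with x hx
    exact (hcont x hx).aestronglyMeasurable
  · exact (hcont x₀ (mem_ball_self hε)).intervalIntegrable _ _
  · have h1 : Continuous fun θ : ℝ => D (x₀, circleMap 0 R θ) :=
      hΦ'.comp_continuous (f := fun θ : ℝ => (x₀, circleMap 0 R θ)) (by fun_prop)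
        fun θ => h _ (hcirc θ)
    have h2 : Continuous fun θ : ℝ => deriv (circleMap 0 R) θ •
        (D (x₀, circleMap 0 R θ)).comp (ContinuousLinearMap.inl ℂ X ℂ) := by
      simp only [deriv_circleMap]
      exact Continuous.smul (f := fun θ => circleMap 0 R θ * Complex.I) (by fun_prop)
        (h1.clm_comp continuous_const)
    exact h2.aestronglyMeasurable
  · refine Eventually.of_forall fun θ _ x hx => ?_
    rw [norm_smul]
    have : ‖deriv (circleMap 0 R) θ‖ = R := by simp [deriv_circleMap, abs_of_nonneg hR]
    rw [this]
    refine mul_le_mul_of_nonneg_left ?_ hR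
    have hCx : ‖D (x, circleMap 0 R θ)‖ < C := (hb x hx _ (hcirc θ)).2
    refine (ContinuousLinearMap.opNorm_comp_le _ _).trans ?_
    calc _ ≤ ‖D (x, circleMap 0 R θ)‖ * 1 :=
          mul_le_mul_of_nonneg_left (ContinuousLinearMap.norm_inl_le_one _ _ _) (norm_nonneg _)
      _ ≤ C := by linarith
  · refine Eventually.of_forall fun θ _ x hx => ?_
    have h1 : HasFDerivAt (fun p : X × ℂ => Φ p.1 p.2) (D (x, circleMap 0 R θ))
        (x, circleMap 0 R θ) :=
      (hΦ.differentiableAt (hO.mem_nhds (hb x hx _ (hcirc θ)).1)).hasFDerivAt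
    have h2 : HasFDerivAt (fun x : X => (x, circleMap 0 R θ)) (ContinuousLinearMap.inl ℂ X ℂ) x :=
      hasFDerivAt_prodMk_left x _
    have h3 : HasFDerivAt (fun x : X => Φ x (circleMap 0 R θ))
        ((D (x, circleMap 0 R θ)).comp (ContinuousLinearMap.inl ℂ X ℂ)) x :=
      HasFDerivAt.comp (g := fun p : X × ℂ => Φ p.1 p.2) x h1 h2
    exact h3.const_smul (deriv (circleMap 0 R) θ)

variable [CompleteSpace E]

/-- Cauchy's formula on the complex line through `x` in the direction `v`. -/
theorem fderiv_apply_eq_circleIntegral {U : Set X} (hU : IsOpen U) {f : X → E}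
    (hf : DifferentiableOn ℂ f U) {x v : X} {R : ℝ} (hR : 0 < R)
    (h : ∀ ζ ∈ closedBall (0 : ℂ) R, x + ζ • v ∈ U) :
    fderiv ℂ f x v =
      (2 * Real.pi * Complex.I : ℂ)⁻¹ • ∮ ζ in C(0, R), (1 / ζ ^ 2) • f (x + ζ • v) := by
  have hline : ∀ ζ : ℂ, HasDerivAt (fun ζ : ℂ => x + ζ • v) v ζ := fun ζ => by
    simpa using ((hasDerivAt_id ζ).smul_const v).const_add x
  have hd : DifferentiableOn ℂ (fun ζ : ℂ => f (x + ζ • v)) (closedBall 0 R) := fun ζ hζ =>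
    ((hf.differentiableAt (hU.mem_nhds (h ζ hζ))).comp ζ
      (hline ζ).differentiableAt).differentiableWithinAt
  have h0 := hd.deriv_eq_smul_circleIntegral hR
  simp only [sub_zero] at h0
  rw [h0, smul_smul, inv_mul_cancel₀ Complex.two_pi_I_ne_zero, one_smul]
  have hx : x + (0 : ℂ) • v ∈ U := h 0 (by simp [hR.le])
  have h1 : HasFDerivAt f (fderiv ℂ f x) (x + (0 : ℂ) • v) := by
    simp only [zero_smul, add_zero] at hx ⊢
    exact (hf.differentiableAt (hU.mem_nhds hx)).hasFDerivAt
  exact ((h1.comp_hasDerivAt 0 (hline 0)).deriv).symm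

theorem exists_closedBall_smul_subset {U : Set X} (hU : IsOpen U) {x : X} (hx : x ∈ U) (v : X) :
    ∃ R > 0, ∃ ε > 0, ∀ y ∈ ball x ε, ∀ ζ ∈ closedBall (0 : ℂ) R, y + ζ • v ∈ U := by
  have : ∀ᶠ p : X × ℂ in 𝓝 (x, 0), p.1 + p.2 • v ∈ U := by
    have hc : ContinuousAt (fun p : X × ℂ => p.1 + p.2 • v) (x, 0) := by fun_prop
    exact hc (hU.mem_nhds (by simpa using hx))
  rw [nhds_prod_eq] at this
  obtain ⟨p, hp, q, hq, hpq⟩ := eventually_prod_iff.1 this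
  obtain ⟨ε, hε, h1⟩ := Metric.eventually_nhds_iff_ball.1 hp
  obtain ⟨R, hR, h2⟩ := Metric.nhds_basis_closedBall.eventually_iff.1 hq
  exact ⟨R, hR, ε, hε, fun y hy ζ hζ => hpq (h1 y hy) (h2 hζ)⟩

variable [FiniteDimensional ℂ X]

/-- Complex differentiability on an open set of a finite-dimensional space implies continuous
differentiability: by Cauchy's formula on complex lines, the derivative in a fixed direction is an
integral of a continuous function of the base point. -/
theorem DifferentiableOn.continuousOn_fderiv_of_finiteDimensional {U : Set X} (hU : IsOpen U)
    {f : X → E} (hf : DifferentiableOn ℂ f U) : ContinuousOn (fderiv ℂ f) U := by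
  refine continuousOn_clm_apply.2 fun v => fun x hx => ContinuousAt.continuousWithinAt ?_
  obtain ⟨R, hR, ε, hε, h⟩ := exists_closedBall_smul_subset hU hx v
  set O : Set (X × ℂ) := {p | p.2 ≠ 0 ∧ p.1 + p.2 • v ∈ U} with hO
  have hOo : IsOpen O := (isOpen_ne.preimage continuous_snd).inter
    (hU.preimage (by fun_prop))
  have hcont : ContinuousAt
      (fun y => ∮ ζ in C(0, R), (1 / ζ ^ 2 : ℂ) • f (y + ζ • v)) x := by
    refine continuousAt_circleIntegral hOo ?_ hR.le ?_
    · refine ContinuousOn.smul ?_ (hf.continuousOn.comp (by fun_prop) fun p hp => hp.2)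
      exact ContinuousOn.div continuousOn_const (by fun_prop) fun p hp => pow_ne_zero 2 hp.1
    · intro z hz
      exact ⟨ne_zero_of_mem_sphere hR.ne' ⟨z, hz⟩,
        h x (mem_ball_self hε) z (sphere_subset_closedBall hz)⟩
  refine (hcont.const_smul (2 * Real.pi * Complex.I : ℂ)⁻¹).congr ?_
  filter_upwards [ball_mem_nhds x hε] with y hy
  exact (fderiv_apply_eq_circleIntegral hU hf hR (h y hy)).symm

omit [CompleteSpace E] in
theorem differentiableAt_of_forall_apply {Y Z : Type*} [NormedAddCommGroup Y] [NormedSpace ℂ Y]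
    [FiniteDimensional ℂ Y] [NormedAddCommGroup Z] [NormedSpace ℂ Z] {G : Z → (Y →L[ℂ] E)} {z : Z}
    (h : ∀ y, DifferentiableAt ℂ (fun w => G w y) z) : DifferentiableAt ℂ G z := by
  let d := Module.finrank ℂ Y
  have hd : d = Module.finrank ℂ (Fin d → ℂ) := (Module.finrank_fin_fun ℂ).symm
  let e₁ := ContinuousLinearEquiv.ofFinrankEq hd
  let e₂ := (e₁.arrowCongr (1 : E ≃L[ℂ] E)).trans (ContinuousLinearEquiv.piRing (Fin d))
  rw [← Function.id_comp G, ← e₂.symm_comp_self]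
  refine e₂.symm.differentiableAt.comp z ?_
  exact differentiableAt_pi.2 fun i => h _

/-- The derivative of a holomorphic function is holomorphic, by differentiation under the integral
sign in Cauchy's formula on complex lines. -/
theorem DifferentiableOn.fderiv_of_finiteDimensional {U : Set X} (hU : IsOpen U)
    {f : X → E} (hf : DifferentiableOn ℂ f U) : DifferentiableOn ℂ (fderiv ℂ f) U := by
  refine fun x hx => (differentiableAt_of_forall_apply fun v => ?_).differentiableWithinAt
  obtain ⟨R, hR, ε, hε, h⟩ := exists_closedBall_smul_subset hU hx v
  set O : Set (X × ℂ) := {p | p.2 ≠ 0 ∧ p.1 + p.2 • v ∈ U} with hO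
  have hOo : IsOpen O := (isOpen_ne.preimage continuous_snd).inter
    (hU.preimage (by fun_prop))
  have hdO : DifferentiableOn ℂ (fun p : X × ℂ => (1 / p.2 ^ 2 : ℂ) • f (p.1 + p.2 • v)) O := by
    refine DifferentiableOn.smul ?_ (hf.comp (by fun_prop) fun p hp => hp.2)
    intro p hp
    refine DifferentiableAt.differentiableWithinAt ?_
    fun_prop (disch := exact pow_ne_zero 2 hp.1)
  have hdiff : DifferentiableAt ℂ
      (fun y => ∮ ζ in C(0, R), (1 / ζ ^ 2 : ℂ) • f (y + ζ • v)) x := by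
    refine differentiableAt_circleIntegral hOo hdO
      (hdO.continuousOn_fderiv_of_finiteDimensional hOo) hR.le ?_
    intro z hz
    exact ⟨ne_zero_of_mem_sphere hR.ne' ⟨z, hz⟩,
      h x (mem_ball_self hε) z (sphere_subset_closedBall hz)⟩
  refine (hdiff.const_smul (2 * Real.pi * Complex.I : ℂ)⁻¹).congr_of_eventuallyEq ?_
  filter_upwards [ball_mem_nhds x hε] with y hy
  exact fderiv_apply_eq_circleIntegral hU hf hR (h y hy)

end SeveralVariables

section Identity

variable {X E : Type*} [NormedAddCommGroup X] [NormedSpace ℂ X]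
  [NormedAddCommGroup E] [NormedSpace ℂ E] [CompleteSpace E]

/-- The identity theorem on a ball, from the one on the complex lines through `x`. -/
theorem DifferentiableOn.eqOn_zero_ball {f : X → E} {c : X} {r : ℝ}
    (hf : DifferentiableOn ℂ f (ball c r)) {x : X} (hx : x ∈ ball c r) (h0 : f =ᶠ[𝓝 x] 0) :
    EqOn f 0 (ball c r) := by
  intro y hy
  set l : ℂ → X := fun ζ => x + ζ • (y - x) with hl
  have hlc : Continuous l := by fun_prop
  set D : Set ℂ := l ⁻¹' ball c r with hD
  have hDo : IsOpen D := isOpen_ball.preimage hlc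
  let _ : NormedSpace ℝ X := NormedSpace.restrictScalars ℝ ℂ X
  have hDc : IsPreconnected D := by
    refine Convex.isPreconnected ?_
    intro a ha b hb p q hp hq hpq
    have hcb := convex_ball (E := X) c r ha hb hp hq hpq
    have : l (p • a + q • b) = p • l a + q • l b := by
      have hpq' : (p : ℂ) + q = 1 := by exact_mod_cast hpq
      simp only [hl, Complex.real_smul]
      have e1 : ∀ (r : ℝ) (w : X), r • w = (r : ℂ) • w := fun r w => rfl
      rw [e1, e1, smul_add, smul_add, add_smul, mul_smul, mul_smul]
      nth_rewrite 1 [← one_smul ℂ x]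
      rw [← hpq', add_smul]
      abel
    change l (p • a + q • b) ∈ ball c r
    rw [this]; exact hcb
  have hg : AnalyticOnNhd ℂ (f ∘ l) D :=
    (DifferentiableOn.comp (t := ball c r) hf
      (by fun_prop : Differentiable ℂ l).differentiableOn fun ζ hζ => hζ).analyticOnNhd hDo
  have h0D : (0 : ℂ) ∈ D := by simp [hD, hl, hx]
  have h1D : (1 : ℂ) ∈ D := by simp [hD, hl, hy]
  have hev : f ∘ l =ᶠ[𝓝 0] 0 := by
    have : Tendsto l (𝓝 0) (𝓝 x) := by simpa [hl] using hlc.tendsto 0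
    exact this.eventually h0
  have := hg.eqOn_zero_of_preconnected_of_eventuallyEq_zero hDc h0D hev h1D
  simpa [hl] using this

/-- The identity theorem in several variables. -/
theorem DifferentiableOn.eqOn_zero_of_isPreconnected {f : X → E} {U : Set X} (hU : IsOpen U)
    (hc : IsPreconnected U) (hf : DifferentiableOn ℂ f U) {x : X} (hx : x ∈ U)
    (h0 : f =ᶠ[𝓝 x] 0) : EqOn f 0 U := by
  have key : U ⊆ {y | f =ᶠ[𝓝 y] 0} := by
    refine hc.subset_of_closure_inter_subset isOpen_setOfPred_eventually_nhds ⟨x, hx, h0⟩ ?_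
    rintro y ⟨hy, hyU⟩
    obtain ⟨r, hr, hb⟩ := Metric.isOpen_iff.1 hU y hyU
    obtain ⟨w, hw, hwd⟩ := Metric.mem_closure_iff.1 hy r hr
    have := (hf.mono hb).eqOn_zero_ball (x := w) (by rwa [mem_ball, dist_comm]) hw
    exact this.eventuallyEq_of_mem (ball_mem_nhds y hr)
  exact fun y hy => (key hy).self_of_nhds

omit [CompleteSpace E] in
/-- Cauchy's estimate, on complex lines through `x`; circles of radius `r / 2` stay in the ball. -/
theorem norm_fderiv_le_of_forall_mem_ball {f : X → E} {x : X} {r C : ℝ} (hr : 0 < r)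
    (hf : DifferentiableOn ℂ f (ball x r)) (hC : ∀ y ∈ ball x r, ‖f y‖ ≤ C) :
    ‖fderiv ℂ f x‖ ≤ C / (r / 2) := by
  have hC0 : 0 ≤ C := (norm_nonneg _).trans (hC x (mem_ball_self hr))
  refine ContinuousLinearMap.opNorm_le_bound _ (by positivity) fun v => ?_
  rcases eq_or_ne v 0 with rfl | hv
  · simp
  have hv' : 0 < ‖v‖ := norm_pos_iff.2 hv
  set R := r / 2 / ‖v‖ with hR
  have hRp : 0 < R := by positivity
  have hmem : ∀ ζ ∈ closedBall (0 : ℂ) R, x + ζ • v ∈ ball x r := by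
    intro ζ hζ
    rw [mem_closedBall_zero_iff] at hζ
    rw [mem_ball_iff_norm, add_sub_cancel_left, norm_smul]
    calc ‖ζ‖ * ‖v‖ ≤ R * ‖v‖ := by gcongr
      _ = r / 2 := by rw [hR]; field_simp
      _ < r := by linarith
  have hline : ∀ ζ : ℂ, HasDerivAt (fun ζ : ℂ => x + ζ • v) v ζ := fun ζ => by
    simpa using ((hasDerivAt_id ζ).smul_const v).const_add x
  have hd : DifferentiableOn ℂ (fun ζ : ℂ => f (x + ζ • v)) (closedBall 0 R) := fun ζ hζ =>
    ((hf.differentiableAt (isOpen_ball.mem_nhds (hmem ζ hζ))).comp ζ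
      (hline ζ).differentiableAt).differentiableWithinAt
  have h1 : HasFDerivAt f (fderiv ℂ f x) (x + (0 : ℂ) • v) := by
    simp only [zero_smul, add_zero]
    exact (hf.differentiableAt (ball_mem_nhds x hr)).hasFDerivAt
  have h2 := (h1.comp_hasDerivAt 0 (hline 0)).deriv
  have h3 := Complex.norm_deriv_le_of_forall_mem_sphere_norm_le (c := 0) (C := C) hRp
    (hd.mono closure_ball_subset_closedBall).diffContOnCl
    (fun ζ hζ => hC _ (hmem ζ (sphere_subset_closedBall hζ)))
  rw [← h2]
  calc _ ≤ C / R := h3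
    _ = C / (r / 2) * ‖v‖ := by rw [hR]; field_simp

theorem differentiableAt_tsum_of_norm_le {ι : Type*} {g : ι → X → E} {u : ι → ℝ}
    (hu : Summable u) {x : X} {r : ℝ} (hr : 0 < r)
    (hg : ∀ i, DifferentiableOn ℂ (g i) (ball x r)) (hb : ∀ i, ∀ y ∈ ball x r, ‖g i y‖ ≤ u i) :
    DifferentiableAt ℂ (fun y => ∑' i, g i y) x := by
  let _ : NormedSpace ℝ X := NormedSpace.restrictScalars ℝ ℂ X
  have hr2 : 0 < r / 2 := by positivity
  have hsub : ∀ y ∈ ball x (r / 2), ball y (r / 2) ⊆ ball x r := fun y hy =>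
    ball_subset_ball' (by rw [mem_ball] at hy; linarith)
  refine (hasFDerivAt_tsum_of_isPreconnected (u := fun i => u i / (r / 2 / 2))
    (f' := fun i y => fderiv ℂ (g i) y) (x₀ := x) (hu.div_const _)
    (isOpen_ball (x := x) (ε := r / 2)) (convex_ball x (r / 2)).isPreconnected ?_ ?_
    (mem_ball_self hr2) ?_ (mem_ball_self hr2)).differentiableAt
  · intro i y hy
    exact ((hg i).differentiableAt (isOpen_ball.mem_nhds
      (hsub y hy (mem_ball_self hr2)))).hasFDerivAt
  · intro i y hy
    exact norm_fderiv_le_of_forall_mem_ball hr2 ((hg i).mono (hsub y hy))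
      fun w hw => hb i w (hsub y hy hw)
  · exact Summable.of_norm_bounded hu fun i => hb i x (mem_ball_self hr)

end Identity

/-! ### Complements of hypersurfaces -/

section AnalyticComplement

variable {X : Type*} [NormedAddCommGroup X] [NormedSpace ℂ X]

/-- `Ω` is the complement in `M` of a set that is locally the zero locus of one holomorphic function
(which is allowed to vanish identically). -/
def IsHypersurfaceCompl (M Ω : Set X) : Prop :=
  ∀ x ∈ M, ∃ (Δ : X → ℂ) (r : ℝ), 0 < r ∧ ball x r ⊆ M ∧ DifferentiableOn ℂ Δ (ball x r) ∧
    ∀ y ∈ ball x r, y ∈ Ω ↔ Δ y ≠ 0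

/-- The complement of a hypersurface in a ball cannot be separated by disjoint open sets: the
function that is `Δ ^ 2` on `u` and `0` elsewhere is holomorphic on the ball, so by the identity
theorem it vanishes identically if it vanishes near a point of `v`. -/
theorem subset_of_inter_ball_subset_union {Ω u v : Set X} {x : X} {r : ℝ} {Δ : X → ℂ}
    (hΔ : DifferentiableOn ℂ Δ (ball x r)) (hΩ : ∀ y ∈ ball x r, y ∈ Ω ↔ Δ y ≠ 0)
    (hu : IsOpen u) (hv : IsOpen v) (huv : Ω ⊆ u ∪ v) (hd : Ω ∩ (u ∩ v) = ∅) :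
    Ω ∩ ball x r ⊆ u ∨ Ω ∩ ball x r ⊆ v := by
  classical
  rw [or_iff_not_imp_right, not_subset]
  rintro ⟨q, ⟨hqΩ, hqb⟩, hqv⟩ p ⟨hpΩ, hpb⟩
  by_contra hpu
  have hpv : p ∈ v := (huv hpΩ).resolve_left hpu
  have hqu : q ∈ u := (huv hqΩ).resolve_right hqv
  set G : X → ℂ := fun y => if y ∈ u then Δ y ^ 2 else 0 with hG
  have hnear : ∀ y ∈ ball x r, y ∈ Ω → ∀ᶠ w in 𝓝 y, w ∈ Ω := by
    intro y hy hyΩ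
    filter_upwards [isOpen_ball.mem_nhds hy, (hΔ.continuousOn.continuousAt
      (isOpen_ball.mem_nhds hy)).eventually_ne ((hΩ y hy).1 hyΩ)] with w hw hw'
    exact (hΩ w hw).2 hw'
  have hnotu : ∀ w ∈ Ω, w ∈ v → w ∉ u := fun w hw hwv hwu =>
    (Set.eq_empty_iff_forall_notMem.1 hd w) ⟨hw, hwu, hwv⟩
  have hGd : DifferentiableOn ℂ G (ball x r) := by
    intro y hy
    refine DifferentiableAt.differentiableWithinAt ?_
    have hΔy := hΔ.differentiableAt (isOpen_ball.mem_nhds hy)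
    by_cases hyΩ : y ∈ Ω
    · rcases huv hyΩ with hyu | hyv
      · refine (hΔy.pow 2).congr_of_eventuallyEq ?_
        filter_upwards [hu.mem_nhds hyu] with w hw
        simp [hG, hw]
      · refine (differentiableAt_const (0 : ℂ)).congr_of_eventuallyEq ?_
        filter_upwards [hnear y hy hyΩ, hv.mem_nhds hyv] with w hw hwv
        simp [hG, hnotu w hw hwv]
    -- at a zero of `Δ` the square has derivative zero, and it dominates `G` whatever `u` is nearby
    · have h0 : Δ y = 0 := by
        by_contra h
        exact hyΩ ((hΩ y hy).2 h)
      have hsq : HasFDerivAt (fun w => Δ w ^ 2) (0 : X →L[ℂ] ℂ) y := by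
        exact (hΔy.hasFDerivAt.pow 2).congr_fderiv (by ext; simp [h0])
      refine HasFDerivAt.differentiableAt (f' := (0 : X →L[ℂ] ℂ)) ?_
      refine HasFDerivAt.of_isLittleO ?_
      have hlo := hsq.isLittleO
      refine Asymptotics.IsBigO.trans_isLittleO ?_ hlo
      refine Asymptotics.IsBigO.of_bound 1 (Eventually.of_forall fun w => ?_)
      have hGy : G y = 0 := by simp [hG, h0]
      rw [hGy]
      by_cases hw : w ∈ u
      · simp [hG, hw, h0]
      · simp [hG, hw]
  have hG0 : G =ᶠ[𝓝 p] 0 := by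
    filter_upwards [hnear p hpb hpΩ, hv.mem_nhds hpv] with w hw hwv
    simp [hG, hnotu w hw hwv]
  have := hGd.eqOn_zero_ball hpb hG0 hqb
  simp only [hG, hqu, if_true, Pi.zero_apply] at this
  exact (hΩ q hqb).1 hqΩ (pow_eq_zero_iff two_ne_zero |>.1 this)

/-- If `Ω` is not empty, then no local defining function vanishes identically, and `Ω` is dense. -/
theorem IsHypersurfaceCompl.subset_closure_of_nonempty {M Ω : Set X} (h : IsHypersurfaceCompl M Ω)
    (hM : IsPreconnected M) (hne : (M ∩ Ω).Nonempty) : M ⊆ closure Ω := by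
  have key : M ⊆ interior (closure Ω) := by
    -- if the ball around `x` meets `Ω`, the defining function is not identically zero there
    have hloc : ∀ x ∈ M, x ∈ closure Ω → x ∈ interior (closure Ω) := by
      intro x hx hxc
      obtain ⟨Δ, r, hr, -, hΔ, hΩ⟩ := h x hx
      rw [mem_interior_iff_mem_nhds]
      refine mem_of_superset (ball_mem_nhds x hr) fun y hy => ?_
      by_contra hyc
      have hev : Δ =ᶠ[𝓝 y] 0 := by
        filter_upwards [isClosed_closure.isOpen_compl.mem_nhds hyc, isOpen_ball.mem_nhds hy]
          with w hw hwb
        by_contra h0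
        exact hw (subset_closure ((hΩ w hwb).2 h0))
      obtain ⟨q, hqb, hq⟩ := mem_closure_iff_nhds.1 hxc _ (ball_mem_nhds x hr)
      exact (hΩ q hqb).1 hq (hΔ.eqOn_zero_ball hy hev hqb)
    refine hM.subset_of_closure_inter_subset isOpen_interior ?_ ?_
    · obtain ⟨x, hx, hxΩ⟩ := hne
      exact ⟨x, hx, hloc x hx (subset_closure hxΩ)⟩
    · rintro x ⟨hx, hxM⟩
      exact hloc x hxM (closure_minimal interior_subset isClosed_closure hx)
  exact key.trans interior_subset

/-- The complement of a hypersurface in a connected open set is connected: a separation of `Ω` is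
locally constant near each point of `M`, hence extends to a separation of `M`. -/
theorem IsHypersurfaceCompl.isPreconnected {M Ω : Set X} (h : IsHypersurfaceCompl M Ω)
    (hM : IsPreconnected M) (hΩM : Ω ⊆ M) : IsPreconnected Ω := by
  rcases Ω.eq_empty_or_nonempty with rfl | ⟨x₀, hx₀⟩
  · exact isPreconnected_empty
  have hcl := h.subset_closure_of_nonempty hM ⟨x₀, hΩM hx₀, hx₀⟩
  rw [isPreconnected_iff_subset_of_disjoint] at hM ⊢
  intro u v hu hv huv hd
  have hopen : ∀ w : Set X, IsOpen {x | ∀ᶠ y in 𝓝 x, y ∈ Ω → y ∈ w} := fun w =>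
    isOpen_setOfPred_eventually_nhds
  have hcover : M ⊆ {x | ∀ᶠ y in 𝓝 x, y ∈ Ω → y ∈ u} ∪ {x | ∀ᶠ y in 𝓝 x, y ∈ Ω → y ∈ v} := by
    intro x hx
    obtain ⟨Δ, r, hr, -, hΔ, hΩ⟩ := h x hx
    rcases subset_of_inter_ball_subset_union hΔ hΩ hu hv huv hd with h1 | h1
    · exact Or.inl (by filter_upwards [ball_mem_nhds x hr] with y hy hyΩ using h1 ⟨hyΩ, hy⟩)
    · exact Or.inr (by filter_upwards [ball_mem_nhds x hr] with y hy hyΩ using h1 ⟨hyΩ, hy⟩)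
  have hdisj : M ∩ ({x | ∀ᶠ y in 𝓝 x, y ∈ Ω → y ∈ u} ∩ {x | ∀ᶠ y in 𝓝 x, y ∈ Ω → y ∈ v}) = ∅ := by
    refine Set.eq_empty_iff_forall_notMem.2 ?_
    rintro x ⟨hx, hxu, hxv⟩
    obtain ⟨y, hy, hyΩ⟩ := mem_closure_iff_nhds.1 (hcl hx) _ (Filter.inter_mem hxu hxv)
    exact Set.eq_empty_iff_forall_notMem.1 hd y ⟨hyΩ, hy.1 hyΩ, hy.2 hyΩ⟩
  rcases hM _ _ (hopen u) (hopen v) hcover hdisj with h1 | h1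
  · exact Or.inl fun y hy => (h1 (hΩM hy)).self_of_nhds hy
  · exact Or.inr fun y hy => (h1 (hΩM hy)).self_of_nhds hy

theorem IsHypersurfaceCompl.isOpen {M Ω : Set X} (h : IsHypersurfaceCompl M Ω)
    (hΩM : Ω ⊆ M) : IsOpen Ω := by
  refine isOpen_iff_mem_nhds.2 fun x hx => ?_
  obtain ⟨Δ, r, hr, -, hΔ, hΩ⟩ := h x (hΩM hx)
  filter_upwards [ball_mem_nhds x hr, (hΔ.continuousOn.continuousAt
    (ball_mem_nhds x hr)).eventually_ne ((hΩ x (mem_ball_self hr)).1 hx)] with w hw hw'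
  exact (hΩ w hw).2 hw'

end AnalyticComplement

/-! ### Fredholm operators of index zero -/

section Fredholm

variable {H V : Type*} [NormedAddCommGroup H] [NormedSpace ℂ H]
  [NormedAddCommGroup V] [NormedSpace ℂ V]

variable (H) in
/-- The bounded operators on `H` whose range has finite dimension. -/
def finiteRank : Submodule ℂ (H →L[ℂ] H) where
  carrier := {A | FiniteDimensional ℂ A.range}
  zero_mem' := by
    have : ((0 : H →L[ℂ] H) : H →ₗ[ℂ] H).range = ⊥ := LinearMap.range_zero
    change FiniteDimensional ℂ ((0 : H →L[ℂ] H) : H →ₗ[ℂ] H).range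
    rw [this]; infer_instance
  add_mem' := by
    intro A B hA hB
    have hA' : FiniteDimensional ℂ (A : H →ₗ[ℂ] H).range := hA
    have hB' : FiniteDimensional ℂ (B : H →ₗ[ℂ] H).range := hB
    refine Submodule.finiteDimensional_of_le
      (S₂ := (A : H →ₗ[ℂ] H).range ⊔ (B : H →ₗ[ℂ] H).range) ?_
    rintro _ ⟨x, rfl⟩
    exact Submodule.add_mem_sup ⟨x, rfl⟩ ⟨x, rfl⟩
  smul_mem' := by
    intro c A hA
    have hA' : FiniteDimensional ℂ (A : H →ₗ[ℂ] H).range := hA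
    refine Submodule.finiteDimensional_of_le (S₂ := (A : H →ₗ[ℂ] H).range) ?_
    rintro _ ⟨x, rfl⟩
    exact Submodule.smul_mem _ c ⟨x, rfl⟩

theorem mul_mem_finiteRank_left (B : H →L[ℂ] H) {A : H →L[ℂ] H} (hA : A ∈ finiteRank H) :
    B * A ∈ finiteRank H := by
  have hA' : FiniteDimensional ℂ (A : H →ₗ[ℂ] H).range := hA
  refine Submodule.finiteDimensional_of_le
    (S₂ := (A : H →ₗ[ℂ] H).range.map (B : H →ₗ[ℂ] H)) ?_
  rintro _ ⟨x, rfl⟩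
  exact ⟨A x, ⟨x, rfl⟩, rfl⟩

theorem mul_mem_finiteRank_right {A : H →L[ℂ] H} (hA : A ∈ finiteRank H) (B : H →L[ℂ] H) :
    A * B ∈ finiteRank H := by
  have hA' : FiniteDimensional ℂ (A : H →ₗ[ℂ] H).range := hA
  refine Submodule.finiteDimensional_of_le (S₂ := (A : H →ₗ[ℂ] H).range) ?_
  rintro _ ⟨x, rfl⟩
  exact ⟨B x, rfl⟩

variable (H) in
/-- The norm closure of the operators of finite rank, a closed two-sided ideal. -/
def approximable : Submodule ℂ (H →L[ℂ] H) := (finiteRank H).topologicalClosure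

theorem finiteRank_le_approximable : finiteRank H ≤ approximable H :=
  Submodule.le_topologicalClosure _

theorem isClosed_approximable : IsClosed (approximable H : Set (H →L[ℂ] H)) :=
  Submodule.isClosed_topologicalClosure _

theorem mul_mem_approximable_left (B : H →L[ℂ] H) {A : H →L[ℂ] H} (hA : A ∈ approximable H) :
    B * A ∈ approximable H :=
  map_mem_closure (f := fun A => B * A) (continuous_const_mul B) hA
    fun _ h => mul_mem_finiteRank_left B h

theorem mul_mem_approximable_right {A : H →L[ℂ] H} (hA : A ∈ approximable H) (B : H →L[ℂ] H) :
    A * B ∈ approximable H :=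
  map_mem_closure (f := fun A => A * B) (continuous_mul_const B) hA
    fun _ h => mul_mem_finiteRank_right h B

/-- `T` is the sum of an invertible operator and a limit of operators of finite rank; this is the
form in which "Fredholm of index zero" is used. -/
def IsFredholmZero (T : H →L[ℂ] H) : Prop :=
  ∃ G : H →L[ℂ] H, IsUnit G ∧ T - G ∈ approximable H

theorem IsUnit.isFredholmZero {T : H →L[ℂ] H} (h : IsUnit T) : IsFredholmZero T :=
  ⟨T, h, by simp⟩

/-- If `c` is the inverse of `1 + b a`, then `1 - a c b` is the inverse of `1 + a b`. -/
theorem isUnit_one_add_comp_of_swap {a : V →L[ℂ] H} {b : H →L[ℂ] V}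
    (h : IsUnit (1 + b.comp a : V →L[ℂ] V)) : IsUnit (1 + a.comp b : H →L[ℂ] H) := by
  obtain ⟨⟨p, c, hpc, hcp⟩, rfl⟩ := h
  have h1 : ∀ v, b (a (c v)) = v - c v := fun v => by
    have := congrArg (fun L : V →L[ℂ] V => L v) hpc
    simp only [mul_apply_eq_comp, add_apply,
      one_apply_eq_self, ContinuousLinearMap.comp_apply] at this
    rw [eq_sub_iff_add_eq, add_comm]; exact this
  have h2 : ∀ v, c (b (a v)) = v - c v := fun v => by
    have := congrArg (fun L : V →L[ℂ] V => L v) hcp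
    simp only [mul_apply_eq_comp, add_apply, map_add,
      one_apply_eq_self, ContinuousLinearMap.comp_apply] at this
    rw [eq_sub_iff_add_eq, add_comm]; exact this
  refine ⟨⟨1 + a.comp b, 1 - a.comp (c.comp b), ?_, ?_⟩, rfl⟩
  · ext x
    simp [h1]
  · ext x
    simp [h2]

theorem isUnit_one_add_comp_swap {a : V →L[ℂ] H} {b : H →L[ℂ] V} :
    IsUnit (1 + a.comp b : H →L[ℂ] H) ↔ IsUnit (1 + b.comp a : V →L[ℂ] V) :=
  ⟨isUnit_one_add_comp_of_swap, isUnit_one_add_comp_of_swap⟩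

/-- Invertibility of a perturbation that factors through `V` is decided on `V`. -/
theorem isUnit_add_comp_iff {G : H →L[ℂ] H} (hG : IsUnit G) (ι : V →L[ℂ] H) (π : H →L[ℂ] V) :
    IsUnit (G + ι.comp π) ↔ IsUnit (1 + π.comp ((Ring.inverse G).comp ι) : V →L[ℂ] V) := by
  have : G + ι.comp π = G * (1 + ((Ring.inverse G).comp ι).comp π) := by
    rw [mul_add, mul_one, ContinuousLinearMap.comp_assoc]
    change _ = G + G * (Ring.inverse G * ι.comp π)
    rw [← mul_assoc, Ring.mul_inverse_cancel G hG, one_mul]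
  obtain ⟨u, rfl⟩ := hG
  rw [this, Units.isUnit_units_mul, isUnit_one_add_comp_swap]

theorem IsFredholmZero.exists_finiteRank [CompleteSpace H] {T : H →L[ℂ] H} (h : IsFredholmZero T) :
    ∃ K ∈ finiteRank H, IsUnit (T - K) := by
  obtain ⟨G, hG, hK⟩ := h
  have hopen : {K : H →L[ℂ] H | IsUnit (T - K)} ∈ 𝓝 (T - G) := by
    have hc : Continuous fun K : H →L[ℂ] H => T - K := by fun_prop
    exact (Units.isOpen.preimage hc).mem_nhds (by simpa using hG)
  obtain ⟨K, hK1, hK2⟩ := mem_closure_iff_nhds.1 hK _ hopen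
  exact ⟨K, hK2, hK1⟩

theorem isFredholmZero_of_finiteRank {T K : H →L[ℂ] H} (hK : K ∈ finiteRank H)
    (h : IsUnit (T - K)) : IsFredholmZero T :=
  ⟨T - K, h, by simpa using finiteRank_le_approximable hK⟩

/-- The Fredholm alternative. -/
theorem IsFredholmZero.isUnit_of_injective [CompleteSpace H] {T : H →L[ℂ] H}
    (h : IsFredholmZero T) (hT : Function.Injective T) : IsUnit T := by
  obtain ⟨K, hK, hG⟩ := h.exists_finiteRank
  have hfd : FiniteDimensional ℂ K.range := hK
  have : CompleteSpace K.range := FiniteDimensional.complete ℂ _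
  set ι := K.range.subtypeL
  set π : H →L[ℂ] K.range := K.codRestrict K.range fun x => ⟨x, rfl⟩
  have hKι : K = ι.comp π := rfl
  have hTK : T = (T - K) + ι.comp π := by rw [← hKι, sub_add_cancel]
  rw [hTK, isUnit_add_comp_iff hG, ContinuousLinearMap.isUnit_iff_bijective]
  set B := 1 + π.comp ((Ring.inverse (T - K)).comp ι) with hB
  have hinj : Function.Injective (B : K.range →ₗ[ℂ] K.range) := by
    refine (injective_iff_map_eq_zero _).2 fun v hv => ?_
    set w := Ring.inverse (T - K) (ι v) with hw
    have h1 : (T - K) w = ι v :=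
      congrArg (fun L : H →L[ℂ] H => L (ι v)) (Ring.mul_inverse_cancel _ hG)
    have h2 : v + π w = 0 := hv
    have h3 : T w = 0 := by
      have : T w = (T - K) w + ι (π w) := by
        change _ = (T - K) w + K w
        simp
      rw [this, h1, ← map_add, h2, map_zero]
    have h4 : w = 0 := hT (by rw [h3, map_zero])
    rw [h4, map_zero] at h1
    exact Subtype.ext h1.symm
  exact ⟨hinj, LinearMap.surjective_of_injective hinj⟩

theorem differentiableOn_matrix_det {X n : Type*} [NormedAddCommGroup X] [NormedSpace ℂ X]
    [Fintype n] [DecidableEq n] {A : X → Matrix n n ℂ} {s : Set X}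
    (hA : ∀ i j, DifferentiableOn ℂ (fun x => A x i j) s) :
    DifferentiableOn ℂ (fun x => (A x).det) s := by
  simp only [Matrix.det_apply']
  exact DifferentiableOn.fun_sum fun σ _ => DifferentiableOn.const_mul
    (fun x hx => (HasFDerivWithinAt.finsetProd (g := fun i x => A x (σ i) i) fun i _ =>
      (hA (σ i) i x hx).hasFDerivWithinAt).differentiableWithinAt) _

/-- The analytic Fredholm theorem, in local form: near `x` the operator `T y` differs from the
invertible `T y - K` by the fixed operator `K` of finite rank, and `Δ` is the determinant of an
endomorphism of the range of `K`. -/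
theorem exists_holomorphic_isUnit_iff [CompleteSpace H] {X : Type*} [NormedAddCommGroup X]
    [NormedSpace ℂ X] {M : Set X} (hM : IsOpen M) {T : X → (H →L[ℂ] H)}
    (hT : DifferentiableOn ℂ T M) {x : X} (hx : x ∈ M) (h : IsFredholmZero (T x)) :
    ∃ (Δ : X → ℂ) (r : ℝ), 0 < r ∧ ball x r ⊆ M ∧ DifferentiableOn ℂ Δ (ball x r) ∧
      ∀ y ∈ ball x r, IsUnit (T y) ↔ Δ y ≠ 0 := by
  obtain ⟨K, hK, hG⟩ := h.exists_finiteRank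
  have hfd : FiniteDimensional ℂ K.range := hK
  have : CompleteSpace K.range := FiniteDimensional.complete ℂ _
  set ι := K.range.subtypeL
  set π : H →L[ℂ] K.range := K.codRestrict K.range fun x => ⟨x, rfl⟩
  have hKι : K = ι.comp π := rfl
  have hev : ∀ᶠ y in 𝓝 x, y ∈ M ∧ IsUnit (T y - K) := by
    refine Filter.Eventually.and (hM.mem_nhds hx) ?_
    have hc : ContinuousAt (fun y => T y - K) x :=
      (hT.continuousOn.continuousAt (hM.mem_nhds hx)).sub continuousAt_const
    exact hc (Units.isOpen.mem_nhds hG)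
  obtain ⟨r, hr, hb⟩ := Metric.eventually_nhds_iff_ball.1 hev
  set B : X → (K.range →L[ℂ] K.range) :=
    fun y => 1 + π.comp ((Ring.inverse (T y - K)).comp ι) with hB
  set b := Module.finBasis ℂ K.range
  refine ⟨fun y => (LinearMap.toMatrix b b (B y : K.range →ₗ[ℂ] K.range)).det, r, hr,
    fun y hy => (hb y hy).1, ?_, ?_⟩
  · have hinv : DifferentiableOn ℂ (fun y => Ring.inverse (T y - K)) (ball x r) :=
      DifferentiableOn.inverse ((hT.mono fun y hy => (hb y hy).1).sub_const K)
        fun y hy => (hb y hy).2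
    have hBd : DifferentiableOn ℂ B (ball x r) :=
      (differentiableOn_const (1 : K.range →L[ℂ] K.range)).add
        ((differentiableOn_const π).clm_comp (hinv.clm_comp (differentiableOn_const ι)))
    refine differentiableOn_matrix_det fun i j => ?_
    simp only [LinearMap.toMatrix_apply]
    have hcoord : Differentiable ℂ fun v : K.range => b.repr v i :=
      (LinearMap.toContinuousLinearMap (b.coord i)).differentiable
    exact hcoord.comp_differentiableOn (hBd.clm_apply (differentiableOn_const _))
  · intro y hy
    have hTy : T y = (T y - K) + ι.comp π := by rw [← hKι, sub_add_cancel]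
    beta_reduce
    rw [hTy, isUnit_add_comp_iff (hb y hy).2, LinearMap.det_toMatrix, ← isUnit_iff_ne_zero,
      ← LinearMap.isUnit_iff_isUnit_det, ContinuousLinearMap.isUnit_iff_isUnit_toLinearMap]

/-- An operator with a left parametrix `R` is Fredholm of index zero if there is such an operator
`T` so close to it that `1 + R (T - T₀)` is invertible. -/
theorem isFredholmZero_of_leftParametrix {T₀ T R : H →L[ℂ] H} (hR : R * T₀ - 1 ∈ approximable H)
    (hT : IsFredholmZero T) (hJ : IsUnit (1 + R * (T - T₀))) : IsFredholmZero T₀ := by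
  obtain ⟨_, ⟨G, rfl⟩, hK⟩ := hT
  obtain ⟨J, hJ⟩ := hJ
  refine ⟨G * ↑J⁻¹, (G.isUnit.mul J⁻¹.isUnit), ?_⟩
  set k₁ := T - G with hk₁
  set k₂ := R * T₀ - 1 with hk₂
  set k₃ := k₂ - R * k₁ with hk₃
  have hk₃m : k₃ ∈ approximable H := sub_mem hR (mul_mem_approximable_left R hK)
  have h1 : R * G = J + k₃ := by
    rw [hJ, hk₃, hk₂, hk₁]; noncomm_ring
  have h2 : (J : H →L[ℂ] H) * (↑G⁻¹ * T₀) + k₃ * (↑G⁻¹ * T₀) = 1 + k₂ := by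
    rw [← add_mul, ← h1, ← mul_assoc, mul_assoc R, Units.mul_inv, mul_one, hk₂]; abel
  have h3 : T₀ = G * (↑J⁻¹ * (1 + k₂ - k₃ * (↑G⁻¹ * T₀))) := by
    rw [← h2, add_sub_cancel_right, Units.inv_mul_cancel_left, Units.mul_inv_cancel_left]
  have h4 : T₀ - G * ↑J⁻¹ = (G * ↑J⁻¹ : H →L[ℂ] H) * (k₂ - k₃ * (↑G⁻¹ * T₀)) := by
    nth_rewrite 1 [h3]; noncomm_ring
  rw [h4]
  exact mul_mem_approximable_left _ (sub_mem hR (mul_mem_approximable_right hk₃m _))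

/-- Index zero propagates along a connected family of operators with left parametrices, because it
is an open condition in general and a closed one in the presence of such parametrices. -/
theorem isFredholmZero_of_isPreconnected [CompleteSpace H] {X : Type*} [TopologicalSpace X]
    {M : Set X} (hM : IsOpen M) (hMc : IsPreconnected M) {T : X → (H →L[ℂ] H)}
    (hT : ContinuousOn T M) (hR : ∀ x ∈ M, ∃ R : H →L[ℂ] H, R * T x - 1 ∈ approximable H)
    {x₀ : X} (hx₀ : x₀ ∈ M) (h₀ : IsFredholmZero (T x₀)) : ∀ x ∈ M, IsFredholmZero (T x) := by
  have hcont : ∀ x ∈ M, ContinuousAt T x := fun x hx => hT.continuousAt (hM.mem_nhds hx)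
  have key : M ⊆ {x | x ∈ M ∧ IsFredholmZero (T x)} := by
    refine hMc.subset_of_closure_inter_subset (isOpen_iff_mem_nhds.2 ?_) ⟨x₀, hx₀, hx₀, h₀⟩ ?_
    · rintro x ⟨hx, h⟩
      obtain ⟨K, hK, hG⟩ := h.exists_finiteRank
      have hc : ContinuousAt (fun y => T y - K) x := (hcont x hx).sub continuousAt_const
      filter_upwards [hM.mem_nhds hx, hc (Units.isOpen.mem_nhds hG)] with y hy hyu
      exact ⟨hy, isFredholmZero_of_finiteRank hK hyu⟩
    · rintro x ⟨hxc, hx⟩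
      obtain ⟨R, hRx⟩ := hR x hx
      have hc : ContinuousAt (fun y => 1 + R * (T y - T x)) x :=
        continuousAt_const.add (continuousAt_const.mul ((hcont x hx).sub continuousAt_const))
      have hu : {y | IsUnit (1 + R * (T y - T x))} ∈ 𝓝 x :=
        hc (Units.isOpen.mem_nhds (by simp))
      obtain ⟨y, hyu, -, hyF⟩ := mem_closure_iff_nhds.1 hxc _ hu
      exact ⟨hx, isFredholmZero_of_leftParametrix hRx hyF hyu⟩
  exact fun x hx => (key hx).2

end Fredholm

/-! ### Toeplitz operators on summable sequences -/

section Degree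

/-- `(n, p) ↦ (n - p, p)`: indexes pairs of integers by their sum. -/
def degreeEquiv : ℤ × ℤ ≃ ℤ × ℤ where
  toFun x := (x.1 - x.2, x.2)
  invFun x := (x.1 + x.2, x.2)
  left_inv x := by simp
  right_inv x := by simp

variable {M : Type*} [NormedAddCommGroup M] [CompleteSpace M] {B : ℤ × ℤ → M}

theorem summable_degree (hB : Summable B) (n : ℤ) : Summable fun p => B (n - p, p) :=
  (degreeEquiv.summable_iff.2 hB).prod_factor n

theorem summable_tsum_degree (hB : Summable B) : Summable fun n => ∑' p, B (n - p, p) :=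
  (degreeEquiv.summable_iff.2 hB).prod

theorem tsum_eq_tsum_degree (hB : Summable B) : ∑' x, B x = ∑' n, ∑' p, B (n - p, p) := by
  rw [← degreeEquiv.tsum_eq]
  exact (degreeEquiv.summable_iff.2 hB).tsum_prod

end Degree

section LaurentOperator

variable {E H : Type*} [NormedRing E] [NormedAlgebra ℂ E]
  [NormedAddCommGroup H] [NormedSpace ℂ H]

theorem hasSum_tsum_of_summable_norm {ι : Type*} [CompleteSpace H] {A : ι → (H →L[ℂ] H)}
    (hA : Summable fun i => ‖A i‖) : HasSum A (∑' i, A i) :=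
  hA.of_norm.hasSum

theorem tsum_mem_approximable {ι : Type*}
    {A : ι → (H →L[ℂ] H)} (hA : ∀ i, A i ∈ approximable H) : ∑' i, A i ∈ approximable H := by
  by_cases hs : Summable A
  · exact isClosed_approximable.mem_of_tendsto hs.hasSum
      (Eventually.of_forall fun s => sum_mem fun i _ => hA i)
  · rw [tsum_eq_zero_of_not_summable hs]; exact zero_mem _

theorem norm_rep_mul_le {R : E →L[ℂ] H →L[ℂ] H} {S : ℤ → (H →L[ℂ] H)}
    (hR : ∀ a, ‖R a‖ ≤ ‖a‖) (hS : ∀ n, ‖S n‖ ≤ 1) (a : E) (n : ℤ) : ‖R a * S n‖ ≤ ‖a‖ := by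
  refine (norm_mul_le _ _).trans ?_
  simpa using mul_le_mul (hR a) (hS n) (norm_nonneg _) (norm_nonneg _)

theorem summable_norm_mul_of_le {R : E →L[ℂ] H →L[ℂ] H} {S : ℤ → (H →L[ℂ] H)}
    (hR : ∀ a, ‖R a‖ ≤ ‖a‖) (hS : ∀ n, ‖S n‖ ≤ 1) {c : ℤ → E} (hc : Summable fun n => ‖c n‖) :
    Summable fun n => ‖R (c n) * S n‖ :=
  Summable.of_nonneg_of_le (fun _ => norm_nonneg _) (fun n => norm_rep_mul_le hR hS (c n) n) hc

/-- Modulo `approximable H`, an anti-representation `R` of `E` and an almost-representation `S` of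
`ℤ` that commute give an anti-representation of the algebra of absolutely convergent Laurent
series. -/
theorem tsum_mul_tsum_sub_one_mem_approximable [CompleteSpace E] [CompleteSpace H]
    {R : E →L[ℂ] H →L[ℂ] H} {S : ℤ → (H →L[ℂ] H)} (hR : ∀ a, ‖R a‖ ≤ ‖a‖) (hS : ∀ n, ‖S n‖ ≤ 1)
    (hRR : ∀ a b, R a * R b = R (b * a)) (hSR : ∀ n a, S n * R a = R a * S n) (hR1 : R 1 = 1)
    (hS0 : S 0 = 1) (hSS : ∀ m n, S m * S n - S (m + n) ∈ approximable H) {c d : ℤ → E}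
    (hc : Summable fun n => ‖c n‖) (hd : Summable fun n => ‖d n‖)
    (hcd : ∀ n : ℤ, ∑' p : ℤ, c p * d (n - p) = if n = 0 then 1 else 0) :
    (∑' n, R (d n) * S n) * (∑' n, R (c n) * S n) - 1 ∈ approximable H := by
  set A : ℤ × ℤ → (H →L[ℂ] H) := fun x =>
    (R (d x.1) * S x.1) * (R (c x.2) * S x.2) with hA
  set B : ℤ × ℤ → (H →L[ℂ] H) := fun x =>
    R (c x.2 * d x.1) * S (x.1 + x.2) with hB
  have hAs : Summable A := summable_mul_of_summable_norm (f := fun n => R (d n) * S n)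
    (g := fun n => R (c n) * S n)
    (summable_norm_mul_of_le hR hS hd) (summable_norm_mul_of_le hR hS hc)
  have hAt : (∑' n, R (d n) * S n) * (∑' n, R (c n) * S n) = ∑' x, A x :=
    tsum_mul_tsum_of_summable_norm (f := fun n => R (d n) * S n)
      (g := fun n => R (c n) * S n) (summable_norm_mul_of_le hR hS hd)
      (summable_norm_mul_of_le hR hS hc)
  have hcds : Summable fun x : ℤ × ℤ => ‖c x.2‖ * ‖d x.1‖ := by
    have := hd.mul_of_nonneg hc (fun _ => norm_nonneg _) (fun _ => norm_nonneg _)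
    simpa [mul_comm] using this
  have hBn : Summable fun x => ‖B x‖ := by
    refine Summable.of_nonneg_of_le (fun _ => norm_nonneg _) (fun x => ?_) hcds
    exact (norm_rep_mul_le hR hS _ _).trans (norm_mul_le _ _)
  have hBt : ∑' x, B x = 1 := by
    rw [tsum_eq_tsum_degree hBn.of_norm]
    have h1 : ∀ n : ℤ, ∑' p : ℤ, B (n - p, p) = if n = 0 then 1 else 0 := by
      intro n
      have hs : Summable fun p : ℤ => c p * d (n - p) :=
        Summable.of_norm_bounded (summable_degree hcds n) fun p => norm_mul_le _ _
      have h2 := ((((ContinuousLinearMap.mul ℂ (H →L[ℂ] H)).flip (S n)).comp R).hasSum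
        hs.hasSum).tsum_eq
      have h3 : ∀ p : ℤ, B (n - p, p) = R (c p * d (n - p)) * S n := fun p => by
        simp only [hB, sub_add_cancel]
      simp_rw [h3]
      refine h2.trans ?_
      change R _ * S n = _
      rw [hcd n]
      split_ifs with h
      · rw [h, hR1, hS0, mul_one]
      · rw [map_zero, zero_mul]
    simp_rw [h1]
    rw [tsum_ite_eq]
  rw [hAt, ← hBt, ← hAs.tsum_sub hBn.of_norm]
  refine tsum_mem_approximable fun x => ?_
  have : A x - B x = R (c x.2 * d x.1) *
      (S x.1 * S x.2 - S (x.1 + x.2)) := by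
    simp only [hA, hB]
    rw [mul_sub, ← hRR]
    congr 1
    rw [mul_assoc, ← mul_assoc (S x.1), hSR]
    simp only [mul_assoc]
  rw [this]
  exact mul_mem_approximable_left _ (hSS _ _)

end LaurentOperator

section Toeplitz

/-- Absolutely summable `E`-valued sequences; `m` stands for the function `∑ m i z^(-1-i)`, so that
the space is that of absolutely convergent Laurent series with negative powers only. -/
abbrev SummableSeq (E : Type*) [NormedAddCommGroup E] : Type _ := lp (fun _ : ℕ => E) 1

variable {E : Type*} [NormedRing E] [NormedAlgebra ℂ E]

omit [NormedAlgebra ℂ E] in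
theorem memℓp_one_iff {ι : Type*} {f : ι → E} : Memℓp f 1 ↔ Summable fun i => ‖f i‖ := by
  rw [memℓp_gen_iff (by simp)]; simp

omit [NormedAlgebra ℂ E] in
theorem SummableSeq.summable_norm (m : SummableSeq E) : Summable fun i => ‖m i‖ :=
  memℓp_one_iff.1 m.2

omit [NormedAlgebra ℂ E] in
theorem SummableSeq.norm_eq (m : SummableSeq E) : ‖m‖ = ∑' i, ‖m i‖ := by
  rw [lp.norm_eq_tsum_rpow (by simp)]; simp

variable (E) in
/-- `(m₀, m₁, …) ↦ (m₁, m₂, …)`: multiply by `z` and drop the constant term. -/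
def leftShift : SummableSeq E →L[ℂ] SummableSeq E :=
  LinearMap.mkContinuous
    { toFun := fun m => ⟨fun i => m (i + 1),
        memℓp_one_iff.2 ((summable_nat_add_iff 1).2 m.summable_norm)⟩
      map_add' := fun _ _ => rfl
      map_smul' := fun _ _ => rfl } 1 (fun m => by
    rw [SummableSeq.norm_eq, SummableSeq.norm_eq, m.summable_norm.tsum_eq_zero_add, one_mul]
    exact le_add_of_nonneg_left (norm_nonneg _))

@[simp] theorem leftShift_apply (m : SummableSeq E) (i : ℕ) : leftShift E m i = m (i + 1) := rfl

variable (E) in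
/-- `(m₀, m₁, …) ↦ (0, m₀, m₁, …)`: multiply by `z⁻¹`. -/
def rightShift : SummableSeq E →L[ℂ] SummableSeq E :=
  LinearMap.mkContinuous
    { toFun := fun m => ⟨fun i => Nat.casesOn i 0 fun k => m k,
        memℓp_one_iff.2 ((summable_nat_add_iff 1).1 m.summable_norm)⟩
      map_add' := fun m m' => by
        ext i; cases i
        · exact (add_zero (0 : E)).symm
        · rfl
      map_smul' := fun a m => by
        ext i; cases i
        · exact (smul_zero a).symm
        · rfl } 1 (fun m => by
    rw [SummableSeq.norm_eq, SummableSeq.norm_eq, one_mul, Summable.tsum_eq_zero_add]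
    · simp
    · exact (summable_nat_add_iff 1).1 m.summable_norm)

@[simp] theorem rightShift_zero (m : SummableSeq E) : rightShift E m 0 = 0 := rfl

@[simp] theorem rightShift_succ (m : SummableSeq E) (i : ℕ) : rightShift E m (i + 1) = m i := rfl

theorem leftShift_mul_rightShift : leftShift E * rightShift E = 1 := by
  ext m i; rfl

variable (E) in
/-- `a ↦ (a, 0, 0, …)`, which stands for `a z⁻¹`. -/
def headSeq : E →ₗ[ℂ] SummableSeq E where
  toFun a := ⟨fun i => Nat.casesOn i a fun _ => 0, memℓp_one_iff.2
    ((summable_nat_add_iff 1).1 (by simp))⟩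
  map_add' a b := by
    ext i; cases i
    · rfl
    · exact (add_zero (0 : E)).symm
  map_smul' a b := by
    ext i; cases i
    · rfl
    · exact (smul_zero a).symm

@[simp] theorem headSeq_zero (a : E) : headSeq E a 0 = a := rfl

@[simp] theorem headSeq_succ (a : E) (i : ℕ) : headSeq E a (i + 1) = 0 := rfl

theorem rightShift_mul_leftShift_sub_one_mem [FiniteDimensional ℂ E] :
    rightShift E * leftShift E - 1 ∈ finiteRank (SummableSeq E) := by
  refine Submodule.finiteDimensional_of_le (S₂ := (headSeq E).range) ?_
  rintro _ ⟨m, rfl⟩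
  refine ⟨-m 0, ?_⟩
  ext i
  cases i
  · change -m 0 = 0 - m 0
    simp
  · rename_i i
    change (0 : E) = m (i + 1) - m (i + 1)
    simp

theorem norm_leftShift_le : ‖leftShift E‖ ≤ 1 := LinearMap.mkContinuous_norm_le _ zero_le_one _

theorem norm_rightShift_le : ‖rightShift E‖ ≤ 1 := LinearMap.mkContinuous_norm_le _ zero_le_one _

variable (E) in
/-- The compression of multiplication by `z ^ n` to negative powers of `z`. -/
def shift : ℤ → (SummableSeq E →L[ℂ] SummableSeq E)
  | Int.ofNat n => leftShift E ^ n
  | Int.negSucc n => rightShift E ^ (n + 1)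

theorem norm_pow_le_one_of_norm_le_one {H : Type*} [NormedAddCommGroup H] [NormedSpace ℂ H]
    {A : H →L[ℂ] H} (hA : ‖A‖ ≤ 1) (n : ℕ) : ‖A ^ n‖ ≤ 1 := by
  induction n with
  | zero => exact ContinuousLinearMap.norm_id_le
  | succ k ih =>
    rw [pow_succ]
    exact (norm_mul_le _ _).trans (mul_le_one₀ ih (norm_nonneg _) hA)

theorem norm_shift_le (n : ℤ) : ‖shift E n‖ ≤ 1 := by
  cases n
  · exact norm_pow_le_one_of_norm_le_one norm_leftShift_le _
  · exact norm_pow_le_one_of_norm_le_one norm_rightShift_le _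

theorem shift_zero : shift E 0 = 1 := rfl

theorem leftShift_mul_shift (n : ℤ) : leftShift E * shift E n = shift E (n + 1) := by
  rcases n with n | n
  · exact (pow_succ' _ _).symm
  · have h : leftShift E * shift E (Int.negSucc n) = rightShift E ^ n := by
      change leftShift E * rightShift E ^ (n + 1) = _
      rw [pow_succ', ← mul_assoc, leftShift_mul_rightShift, one_mul]
    rw [h]
    cases n with
    | zero => rfl
    | succ n => rfl

theorem shift_apply (n : ℤ) (m : SummableSeq E) (j : ℕ) :
    shift E n m j = if 0 ≤ j + n then m (j + n).toNat else 0 := by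
  rcases n with n | n
  · have : ∀ (n j : ℕ), (leftShift E ^ n) m j = m (j + n) := by
      intro n
      induction n with
      | zero => intro j; rfl
      | succ k ih =>
        intro j
        rw [pow_succ']
        change (leftShift E ^ k) m (j + 1) = _
        rw [ih, add_right_comm, add_assoc]
    change (leftShift E ^ n) m j = _
    rw [this, if_pos (by simp only [Int.ofNat_eq_natCast]; omega)]
    congr 1
  · have : ∀ (n j : ℕ), (rightShift E ^ n) m j = if n ≤ j then m (j - n) else 0 := by
      intro n
      induction n with
      | zero => intro j; simp
      | succ k ih =>
        intro j
        rw [pow_succ']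
        cases j with
        | zero => simp [mul_apply_eq_comp]
        | succ j =>
          change (rightShift E ^ k) m j = _
          rw [ih]; simp
    change (rightShift E ^ (n + 1)) m j = _
    rw [this]
    rw [Int.negSucc_eq]
    have h1 : (0 ≤ (j : ℤ) + -(n + 1)) ↔ n + 1 ≤ j := by omega
    simp only [h1]
    split_ifs with h
    · rw [show ((j : ℤ) + -(n + 1)).toNat = j - (n + 1) by omega]
    · rfl

theorem shift_mul_shift_sub_mem [FiniteDimensional ℂ E] (m n : ℤ) :
    shift E m * shift E n - shift E (m + n) ∈ approximable (SummableSeq E) := by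
  have hdown : ∀ k : ℤ, rightShift E * shift E k - shift E (k - 1) ∈
      approximable (SummableSeq E) := by
    intro k
    have h : rightShift E * shift E k - shift E (k - 1) =
        (rightShift E * leftShift E - 1) * shift E (k - 1) := by
      have := leftShift_mul_shift (E := E) (k - 1)
      rw [sub_add_cancel] at this
      rw [← this]; noncomm_ring
    rw [h]
    exact mul_mem_approximable_right
      (finiteRank_le_approximable rightShift_mul_leftShift_sub_one_mem) _
  induction m using Int.induction_on with
  | zero => simp [shift_zero]
  | succ k ih =>
    have : shift E (k + 1) * shift E n - shift E (k + 1 + n) =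
        leftShift E * (shift E k * shift E n - shift E (k + n)) := by
      rw [mul_sub, leftShift_mul_shift, ← mul_assoc, leftShift_mul_shift, add_right_comm]
    rw [this]
    exact mul_mem_approximable_left _ ih
  | pred k ih =>
    have : shift E (-k - 1) * shift E n - shift E (-k - 1 + n) =
        rightShift E * (shift E (-k) * shift E n - shift E (-k + n)) -
          (rightShift E * shift E (-k) - shift E (-k - 1)) * shift E n +
          (rightShift E * shift E (-k + n) - shift E (-k + n - 1)) := by
      rw [show (-k - 1 + n : ℤ) = -k + n - 1 by ring]; noncomm_ring
    rw [this]
    exact add_mem (sub_mem (mul_mem_approximable_left _ ih)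
      (mul_mem_approximable_right (hdown _) _)) (hdown _)

variable (E) in
/-- Termwise right multiplication by an element of `E`. -/
def rightMul : E →L[ℂ] SummableSeq E →L[ℂ] SummableSeq E :=
  LinearMap.mkContinuous₂ (LinearMap.mk₂ ℂ (fun a (m : SummableSeq E) => MulOpposite.op a • m)
    (fun a b m => by rw [MulOpposite.op_add, add_smul])
    (fun c a m => by ext i; simp)
    (fun a m m' => by rw [smul_add])
    (fun c a m => by ext i; simp)) 1 (fun a m => by
      rw [one_mul]; exact norm_smul_le _ _)

@[simp] theorem rightMul_apply (a : E) (m : SummableSeq E) (i : ℕ) :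
    rightMul E a m i = m i * a := rfl

theorem norm_rightMul_le (a : E) : ‖rightMul E a‖ ≤ ‖a‖ := by
  refine ContinuousLinearMap.opNorm_le_bound _ (norm_nonneg _) fun m => ?_
  exact norm_smul_le (MulOpposite.op a) m

theorem rightMul_mul_rightMul (a b : E) : rightMul E a * rightMul E b = rightMul E (b * a) := by
  ext m i; exact mul_assoc _ _ _

theorem shift_mul_rightMul (n : ℤ) (a : E) :
    shift E n * rightMul E a = rightMul E a * shift E n := by
  ext m j
  change shift E n (rightMul E a m) j = shift E n m j * a
  rw [shift_apply, shift_apply]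
  split_ifs <;> simp

/-- The Toeplitz operator of the symbol `∑ c n z ^ n`: multiply on the right by the symbol and keep
the negative powers. -/
def toeplitz (c : ℤ → E) : SummableSeq E →L[ℂ] SummableSeq E :=
  ∑' n, rightMul E (c n) * shift E n

variable [CompleteSpace E]

omit [CompleteSpace E] in
theorem summable_toeplitz {c : ℤ → E} (hc : Summable fun n => ‖c n‖) :
    Summable fun n => ‖rightMul E (c n) * shift E n‖ :=
  summable_norm_mul_of_le norm_rightMul_le norm_shift_le hc

theorem hasSum_toeplitz {c : ℤ → E} (hc : Summable fun n => ‖c n‖) :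
    HasSum (fun n => rightMul E (c n) * shift E n) (toeplitz c) :=
  hasSum_tsum_of_summable_norm (summable_toeplitz hc)

theorem toeplitz_apply {c : ℤ → E} (hc : Summable fun n => ‖c n‖) (m : SummableSeq E) (j : ℕ) :
    toeplitz c m j = ∑' i : ℕ, m i * c (i - j) := by
  have h1 : HasSum (fun n => rightMul E (c n) * shift E n) (toeplitz c) :=
    hasSum_toeplitz hc
  let ev : (SummableSeq E →L[ℂ] SummableSeq E) →L[ℂ] E :=
    (lp.evalCLM ℂ (fun _ : ℕ => E) 1 j).comp (ContinuousLinearMap.apply ℂ (SummableSeq E) m)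
  have h2 := ev.hasSum h1
  have h3 : ∀ n, ev (rightMul E (c n) * shift E n) =
      if 0 ≤ j + n then m (j + n).toNat * c n else 0 := by
    intro n
    change shift E n m j * c n = _
    rw [shift_apply]; split_ifs <;> simp
  have hinj : Function.Injective fun i : ℕ => (i : ℤ) - j := fun a b h => by
    simpa using h
  have h4 := (hinj.hasSum_iff (f := fun n => ev (rightMul E (c n) * shift E n))
    (a := ev (toeplitz c)) (fun n hn => by
      rw [h3, if_neg]
      intro h0
      exact hn ⟨(j + n).toNat, by simp; omega⟩)).2 h2
  refine (HasSum.tsum_eq ?_).symm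
  change HasSum _ (ev (toeplitz c))
  convert h4 using 1
  funext i
  simp only [Function.comp_apply]
  rw [h3, if_pos (by omega), show ((j : ℤ) + (i - j)).toNat = i by omega]

/-- The Toeplitz operator of the inverse symbol is a left parametrix. -/
theorem toeplitz_mul_toeplitz_sub_one_mem [FiniteDimensional ℂ E] {c d : ℤ → E}
    (hc : Summable fun n => ‖c n‖) (hd : Summable fun n => ‖d n‖)
    (hcd : ∀ n : ℤ, ∑' p : ℤ, c p * d (n - p) = if n = 0 then 1 else 0) :
    toeplitz d * toeplitz c - 1 ∈ approximable (SummableSeq E) :=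
  tsum_mul_tsum_sub_one_mem_approximable norm_rightMul_le norm_shift_le rightMul_mul_rightMul
    shift_mul_rightMul (by ext m i; exact mul_one _) shift_zero shift_mul_shift_sub_mem hc hd hcd

end Toeplitz

/-! ### Laurent series on the unit circle -/

section Laurent

variable {E : Type*} [NormedAddCommGroup E] [NormedSpace ℂ E]

/-- The Laurent (that is, Fourier) coefficients of a function on the unit circle. -/
def laurentCoeff (F : ℂ → E) (n : ℤ) : E :=
  (2 * Real.pi * Complex.I : ℂ)⁻¹ • ∮ z in C(0, 1), z ^ (-n - 1) • F z

/-- Geometric decay of the coefficients of a function that is holomorphic on an annulus: the circle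
of integration is moved to radius `r⁻¹` for `n ≥ 0` and to radius `r` for `n ≤ 0`. -/
theorem norm_laurentCoeff_le {O : Set ℂ} (hO : IsOpen O) {F : ℂ → E}
    (hF : DifferentiableOn ℂ F O) {r C : ℝ} (hr0 : 0 < r) (hr1 : r < 1)
    (hsub : ∀ z : ℂ, r ≤ ‖z‖ → ‖z‖ ≤ r⁻¹ → z ∈ O)
    (hC : ∀ z : ℂ, r ≤ ‖z‖ → ‖z‖ ≤ r⁻¹ → ‖F z‖ ≤ C) (n : ℤ) :
    ‖laurentCoeff F n‖ ≤ C * r ^ n.natAbs := by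
  have hr1' : 1 < r⁻¹ := (one_lt_inv₀ hr0).2 hr1
  set G : ℂ → E := fun z => z ^ (-n - 1) • F z with hG
  have hGd : ∀ z : ℂ, r ≤ ‖z‖ → ‖z‖ ≤ r⁻¹ → DifferentiableAt ℂ G z := by
    intro z h1 h2
    have hz : z ≠ 0 := norm_pos_iff.1 (hr0.trans_le h1)
    exact (differentiableAt_zpow.2 (Or.inl hz)).smul
      (hF.differentiableAt (hO.mem_nhds (hsub z h1 h2)))
  have hmove : ∀ ρ₁ ρ₂ : ℝ, r ≤ ρ₁ → ρ₁ ≤ ρ₂ → ρ₂ ≤ r⁻¹ →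
      (∮ z in C(0, ρ₂), G z) = ∮ z in C(0, ρ₁), G z := by
    intro ρ₁ ρ₂ h1 h2 h3
    refine Complex.circleIntegral_eq_of_differentiable_on_annulus_off_countable
      (hr0.trans_le h1) h2 countable_empty ?_ ?_
    · rintro z ⟨hz1, hz2⟩
      simp only [mem_closedBall_zero_iff, mem_ball_zero_iff, not_lt] at hz1 hz2
      exact (hGd z (h1.trans hz2) (hz1.trans h3)).continuousAt.continuousWithinAt
    · rintro z ⟨⟨hz1, hz2⟩, -⟩
      simp only [mem_closedBall_zero_iff, mem_ball_zero_iff, not_le] at hz1 hz2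
      exact hGd z (h1.trans hz2.le) (hz1.le.trans h3)
  have hbound : ∀ ρ : ℝ, r ≤ ρ → ρ ≤ r⁻¹ →
      ‖(2 * Real.pi * Complex.I : ℂ)⁻¹ • ∮ z in C(0, ρ), G z‖ ≤ C * ρ ^ (-n) := by
    intro ρ h1 h2
    have hρ : 0 < ρ := hr0.trans_le h1
    have := circleIntegral.norm_two_pi_i_inv_smul_integral_le_of_norm_le_const (f := G) (c := 0)
      (C := ρ ^ (-n - 1) * C) hρ.le (fun z hz => by
        rw [mem_sphere_zero_iff_norm] at hz
        rw [hG, norm_smul, norm_zpow, hz]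
        exact mul_le_mul_of_nonneg_left (hC z (by rw [hz]; exact h1) (by rw [hz]; exact h2))
          (zpow_nonneg hρ.le _))
    refine this.trans (le_of_eq ?_)
    rw [zpow_sub_one₀ hρ.ne']
    field_simp
  rcases le_total 0 n with hn | hn
  · obtain ⟨k, rfl⟩ := Int.eq_ofNat_of_zero_le hn
    have h := hbound r⁻¹ (hr1.le.trans hr1'.le) le_rfl
    rw [hmove 1 r⁻¹ hr1.le hr1'.le le_rfl] at h
    simpa [laurentCoeff] using h
  · obtain ⟨k, hk⟩ := Int.eq_ofNat_of_zero_le (neg_nonneg.2 hn)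
    have h := hbound r le_rfl (hr1.le.trans hr1'.le)
    rw [← hmove r 1 le_rfl hr1.le hr1'.le, hk] at h
    have hk' : n = -(k : ℤ) := by omega
    subst hk'
    simpa [laurentCoeff, hG] using h

theorem summable_pow_natAbs {r : ℝ} (hr0 : 0 ≤ r) (hr1 : r < 1) :
    Summable fun n : ℤ => r ^ n.natAbs := by
  refine Summable.of_nat_of_neg ?_ ?_
  · simpa using summable_geometric_of_lt_one hr0 hr1
  · simpa using summable_geometric_of_lt_one hr0 hr1

theorem laurentCoeff_eq_intervalIntegral (F : ℂ → E) (n : ℤ) :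
    laurentCoeff F n = (1 / (2 * Real.pi) : ℂ) • ∫ θ in (0 : ℝ)..2 * Real.pi,
      Complex.exp (-n * θ * Complex.I) • F (circleMap 0 1 θ) := by
  rw [laurentCoeff, circleIntegral]
  have : ∀ θ : ℝ, deriv (circleMap 0 1) θ • circleMap 0 1 θ ^ (-n - 1) • F (circleMap 0 1 θ) =
      Complex.I • Complex.exp (-n * θ * Complex.I) • F (circleMap 0 1 θ) := by
    intro θ
    have hne : circleMap 0 1 θ ≠ 0 := circleMap_ne_center one_ne_zero
    rw [deriv_circleMap, smul_smul, smul_smul, zpow_sub_one₀ hne]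
    congr 1
    have : circleMap 0 1 θ ^ (-n) = Complex.exp (-n * θ * Complex.I) := by
      simp only [circleMap, Complex.ofReal_one, one_mul, zero_add]
      rw [← Complex.exp_int_mul]; congr 1; push_cast; ring
    rw [this]; field_simp
  simp_rw [this]
  rw [intervalIntegral.integral_smul, smul_smul]
  congr 1
  field_simp

variable [CompleteSpace E]

theorem ContinuousLinearMap.map_laurentCoeff {F : ℂ → E} (hF : ContinuousOn F (sphere 0 1))
    (φ : E →L[ℂ] ℂ) (n : ℤ) : φ (laurentCoeff F n) = laurentCoeff (fun z => φ (F z)) n := by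
  rw [laurentCoeff_eq_intervalIntegral, laurentCoeff_eq_intervalIntegral, map_smul]
  congr 1
  rw [← ContinuousLinearMap.intervalIntegral_comp_comm]
  · simp
  · have h1 : Continuous fun θ : ℝ => F (circleMap 0 1 θ) :=
      hF.comp_continuous (by fun_prop) fun θ => circleMap_mem_sphere 0 zero_le_one θ
    exact (Continuous.smul (by fun_prop) h1).intervalIntegrable _ _

theorem hasSum_laurentCoeff_complex {F : ℂ → ℂ} (hF : ContinuousOn F (sphere 0 1))
    (hs : Summable (laurentCoeff F)) {z : ℂ} (hz : ‖z‖ = 1) :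
    HasSum (fun n : ℤ => z ^ n • laurentCoeff F n) (F z) := by
  have : Fact (0 < 2 * Real.pi) := ⟨Real.two_pi_pos⟩
  have hc : Continuous fun x : AddCircle (2 * Real.pi) => F (AddCircle.toCircle x) :=
    hF.comp_continuous (by fun_prop) fun x => mem_sphere_zero_iff_norm.2 (Circle.norm_coe _)
  set f : C(AddCircle (2 * Real.pi), ℂ) := ⟨_, hc⟩ with hf
  have htc : ∀ θ : ℝ, (AddCircle.toCircle (θ : AddCircle (2 * Real.pi)) : ℂ) =
      circleMap 0 1 θ := by
    intro θ
    rw [AddCircle.toCircle_apply_mk]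
    simp [circleMap, Real.pi_ne_zero]
  have hcoeff : fourierCoeff f = laurentCoeff F := by
    funext n
    rw [fourierCoeff_eq_intervalIntegral f n 0, laurentCoeff_eq_intervalIntegral, zero_add]
    rw [Complex.real_smul, smul_eq_mul]
    congr 1
    · push_cast; rfl
    · refine intervalIntegral.integral_congr fun θ _ => ?_
      change fourier (-n) (θ : AddCircle (2 * Real.pi)) • F _ = _
      rw [htc, fourier_coe_apply]
      congr 2
      push_cast
      field_simp
  have hsum := has_pointwise_sum_fourier_series_of_summable (f := f) (by rw [hcoeff]; exact hs)
  have hzθ : circleMap 0 1 z.arg = z := by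
    have := Complex.norm_mul_exp_arg_mul_I z
    rw [hz] at this
    simpa [circleMap] using this
  have h1 := hsum ((z.arg : ℝ) : AddCircle (2 * Real.pi))
  have h2 : f ((z.arg : ℝ) : AddCircle (2 * Real.pi)) = F z := by
    change F _ = _
    rw [htc, hzθ]
  rw [h2, hcoeff] at h1
  convert h1 using 2 with n
  rw [smul_eq_mul, smul_eq_mul, mul_comm, fourier_apply, AddCircle.toCircle_zsmul]
  push_cast
  rw [htc, hzθ]

/-- The vector-valued case follows from the scalar one by testing on continuous functionals. -/
theorem hasSum_laurentCoeff {F : ℂ → E} (hF : ContinuousOn F (sphere 0 1))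
    (hs : Summable fun n => ‖laurentCoeff F n‖) {z : ℂ} (hz : ‖z‖ = 1) :
    HasSum (fun n : ℤ => z ^ n • laurentCoeff F n) (F z) := by
  have hs' : Summable fun n : ℤ => z ^ n • laurentCoeff F n :=
    Summable.of_norm (by simpa [norm_smul, hz] using hs)
  have heq : ∑' n : ℤ, z ^ n • laurentCoeff F n = F z := by
    refine (SeparatingDual.eq_iff_forall_dual_eq (R := ℂ)).2 fun φ => ?_
    have h1 := φ.hasSum hs'.hasSum
    have h2 : HasSum (fun n : ℤ => z ^ n • laurentCoeff (fun z => φ (F z)) n) (φ (F z)) := by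
      refine hasSum_laurentCoeff_complex (φ.continuous.comp_continuousOn hF) ?_ hz
      have := (φ.hasSum hs.of_norm.hasSum).summable
      simpa only [Function.comp_def, φ.map_laurentCoeff hF] using this
    simp only [← φ.map_laurentCoeff hF, ← map_smul] at h2
    exact h1.unique h2
  rw [← heq]; exact hs'.hasSum

/-- The coefficients of an absolutely convergent Laurent series are determined by its sum on the
unit circle. -/
theorem laurentCoeff_eq_of_hasSum {F : ℂ → E} {a : ℤ → E} (ha : Summable fun n => ‖a n‖)
    (hF : ∀ z : ℂ, ‖z‖ = 1 → HasSum (fun n : ℤ => z ^ n • a n) (F z)) (n : ℤ) :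
    laurentCoeff F n = a n := by
  have hne : ∀ θ : ℝ, circleMap 0 1 θ ≠ 0 := fun θ => circleMap_ne_center one_ne_zero
  have hnorm : ∀ θ : ℝ, ‖circleMap 0 1 θ‖ = 1 := fun θ => by simp
  have h1 := intervalIntegral.hasSum_integral_of_dominated_convergence
    (μ := MeasureTheory.volume) (a := 0) (b := 2 * Real.pi)
    (F := fun (k : ℤ) (θ : ℝ) => deriv (circleMap 0 1) θ • circleMap 0 1 θ ^ (-n - 1) •
      circleMap 0 1 θ ^ k • a k)
    (f := fun θ => deriv (circleMap 0 1) θ • circleMap 0 1 θ ^ (-n - 1) • F (circleMap 0 1 θ))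
    (fun k _ => ‖a k‖) ?_ ?_ ?_ ?_ ?_
  · have h2 : ∀ k : ℤ, (∫ θ in (0 : ℝ)..2 * Real.pi, deriv (circleMap 0 1) θ •
        circleMap 0 1 θ ^ (-n - 1) • circleMap 0 1 θ ^ k • a k) =
        if k = n then (2 * Real.pi * Complex.I : ℂ) • a n else 0 := by
      intro k
      have h3 : (∫ θ in (0 : ℝ)..2 * Real.pi, deriv (circleMap 0 1) θ •
          circleMap 0 1 θ ^ (-n - 1) • circleMap 0 1 θ ^ k • a k) =
          (∮ z in C(0, 1), (z - 0) ^ (k - n - 1)) • a k := by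
        rw [circleIntegral, ← intervalIntegral.integral_smul_const]
        refine intervalIntegral.integral_congr fun θ _ => ?_
        rw [smul_smul, smul_smul, smul_eq_mul, sub_zero, mul_assoc, ← zpow_add₀ (hne θ)]
        congr 3; ring
      rw [h3]
      split_ifs with hk
      · subst hk
        rw [show k - k - 1 = -1 by ring]
        simp only [zpow_neg_one]
        rw [circleIntegral.integral_sub_inv_of_mem_ball (by simp)]
      · rw [circleIntegral.integral_sub_zpow_of_ne (by omega), zero_smul]
    simp_rw [h2] at h1
    have h4 := h1.unique (hasSum_ite_eq n _)
    rw [laurentCoeff, circleIntegral, h4, smul_smul, inv_mul_cancel₀ Complex.two_pi_I_ne_zero,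
      one_smul]
  · intro k
    have hcz : ∀ l : ℤ, Continuous fun θ : ℝ => circleMap 0 1 θ ^ l := fun l =>
      (continuous_circleMap 0 1).zpow₀ l fun θ => Or.inl (hne θ)
    have : Continuous fun θ : ℝ => deriv (circleMap 0 1) θ • circleMap 0 1 θ ^ (-n - 1) •
      circleMap 0 1 θ ^ k • a k := by
      simp only [deriv_circleMap]
      exact Continuous.smul (f := fun θ => circleMap 0 1 θ * Complex.I) (by fun_prop)
        ((hcz _).smul ((hcz _).smul continuous_const))
    exact this.aestronglyMeasurable
  · intro k
    refine Eventually.of_forall fun θ _ => ?_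
    simp [norm_smul, norm_zpow]
  · exact Eventually.of_forall fun θ _ => ha
  · simp
  · exact Eventually.of_forall fun θ _ =>
      ((hF _ (hnorm θ)).const_smul _).const_smul _

omit [CompleteSpace E] in
theorem hasSum_zpow_smul_ite (z : ℂ) (a : E) :
    HasSum (fun k : ℤ => z ^ k • if k = 0 then a else 0) a := by
  have : (fun k : ℤ => z ^ k • if k = 0 then a else 0) = fun k => if k = 0 then a else 0 := by
    funext k
    split_ifs with hk
    · simp [hk]
    · simp
  rw [this]
  exact hasSum_ite_eq 0 a

omit [NormedSpace ℂ E] [CompleteSpace E] in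
theorem summable_norm_ite (a : E) : Summable fun n : ℤ => ‖if n = 0 then a else 0‖ :=
  summable_of_ne_finset_zero (s := {0}) fun b hb => by
    rw [Finset.mem_singleton] at hb; simp [hb]

theorem laurentCoeff_const (a : E) (n : ℤ) :
    laurentCoeff (fun _ => a) n = if n = 0 then a else 0 :=
  laurentCoeff_eq_of_hasSum (a := fun n : ℤ => if n = 0 then a else 0) (summable_norm_ite a)
    (fun z _ => hasSum_zpow_smul_ite z a) n

end Laurent

section Product

variable {E : Type*} [NormedRing E] [NormedAlgebra ℂ E] [CompleteSpace E]

omit [NormedAlgebra ℂ E] [CompleteSpace E] in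
theorem summable_norm_mul_prod {c d : ℤ → E} (hc : Summable fun n => ‖c n‖)
    (hd : Summable fun n => ‖d n‖) : Summable fun x : ℤ × ℤ => ‖c x.2‖ * ‖d x.1‖ := by
  have := hd.mul_of_nonneg hc (fun _ => norm_nonneg _) (fun _ => norm_nonneg _)
  simpa [mul_comm] using this

omit [NormedAlgebra ℂ E] [CompleteSpace E] in
theorem summable_norm_conv {c d : ℤ → E} (hc : Summable fun n => ‖c n‖)
    (hd : Summable fun n => ‖d n‖) : Summable fun n : ℤ => ‖∑' p, c p * d (n - p)‖ := by
  have h := summable_norm_mul_prod hc hd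
  refine Summable.of_nonneg_of_le (fun _ => norm_nonneg _) (fun n => ?_) (summable_tsum_degree h)
  exact tsum_of_norm_bounded (summable_degree h n).hasSum fun p => norm_mul_le _ _

/-- The product of two absolutely convergent Laurent series. -/
theorem hasSum_conv {c d : ℤ → E} (hc : Summable fun n => ‖c n‖) (hd : Summable fun n => ‖d n‖)
    {z : ℂ} (hz : ‖z‖ = 1) {A B : E} (hA : HasSum (fun n : ℤ => z ^ n • c n) A)
    (hB : HasSum (fun n : ℤ => z ^ n • d n) B) :
    HasSum (fun n : ℤ => z ^ n • ∑' p, c p * d (n - p)) (A * B) := by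
  have hz0 : z ≠ 0 := fun h => by simp [h] at hz
  have hcz : Summable fun n : ℤ => ‖z ^ n • c n‖ := by simpa [norm_smul, norm_zpow, hz] using hc
  have hdz : Summable fun n : ℤ => ‖z ^ n • d n‖ := by simpa [norm_smul, norm_zpow, hz] using hd
  have hs0 : Summable fun x : ℤ × ℤ => (z ^ x.1 • c x.1) * (z ^ x.2 • d x.2) :=
    summable_mul_of_summable_norm (f := fun n : ℤ => z ^ n • c n) (g := fun n : ℤ => z ^ n • d n)
      hcz hdz
  have hs : Summable fun x : ℤ × ℤ => (z ^ x.2 • c x.2) * (z ^ x.1 • d x.1) :=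
    (Equiv.prodComm ℤ ℤ).summable_iff.2 hs0
  have ht : A * B = ∑' x : ℤ × ℤ, (z ^ x.2 • c x.2) * (z ^ x.1 • d x.1) := by
    rw [← hA.tsum_eq, ← hB.tsum_eq, tsum_mul_tsum_of_summable_norm (f := fun n : ℤ => z ^ n • c n)
      (g := fun n : ℤ => z ^ n • d n) hcz hdz, ← (Equiv.prodComm ℤ ℤ).tsum_eq]
    rfl
  have hterm : ∀ n : ℤ, ∑' p : ℤ, (z ^ p • c p) * (z ^ (n - p) • d (n - p)) =
      z ^ n • ∑' p, c p * d (n - p) := by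
    intro n
    have hsn : Summable fun p : ℤ => c p * d (n - p) :=
      Summable.of_norm_bounded (summable_degree (summable_norm_mul_prod hc hd) n)
        fun p => norm_mul_le _ _
    rw [← hsn.tsum_const_smul]
    congr 1
    funext p
    rw [smul_mul_smul_comm, ← zpow_add₀ hz0, add_sub_cancel]
  rw [ht, tsum_eq_tsum_degree hs]
  simp_rw [hterm]
  refine Summable.hasSum (Summable.of_norm ?_)
  simpa [norm_smul, norm_zpow, hz] using summable_norm_conv hc hd

theorem conv_eq_of_mul_eq_one {F G : ℂ → E} {c d : ℤ → E} (hc : Summable fun n => ‖c n‖)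
    (hd : Summable fun n => ‖d n‖)
    (hF : ∀ z : ℂ, ‖z‖ = 1 → HasSum (fun n : ℤ => z ^ n • c n) (F z))
    (hG : ∀ z : ℂ, ‖z‖ = 1 → HasSum (fun n : ℤ => z ^ n • d n) (G z))
    (hFG : ∀ z : ℂ, ‖z‖ = 1 → F z * G z = 1) (n : ℤ) :
    ∑' p, c p * d (n - p) = if n = 0 then 1 else 0 := by
  have h1 := laurentCoeff_eq_of_hasSum (F := fun z => F z * G z) (summable_norm_conv hc hd)
    (fun z hz => hasSum_conv hc hd hz (hF z hz) (hG z hz)) n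
  have h2 := laurentCoeff_eq_of_hasSum (F := fun z => F z * G z)
    (a := fun n : ℤ => if n = 0 then (1 : E) else 0) (summable_norm_ite 1)
    (fun z hz => by rw [hFG z hz]; exact hasSum_zpow_smul_ite z 1) n
  exact h1.symm.trans h2

end Product

/-! ### Birkhoff factorization and the kernel of the Toeplitz operator -/

section Birkhoff

theorem closure_compl_closedBall_one : closure (closedBall (0 : ℂ) 1)ᶜ = {z | 1 ≤ ‖z‖} := by
  rw [closure_compl, interior_closedBall _ one_ne_zero]
  ext z
  simp

theorem closure_ball_one : closure (ball (0 : ℂ) 1) = {z | ‖z‖ ≤ 1} := by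
  rw [closure_ball _ one_ne_zero]
  ext z
  simp

/-- Liouville's theorem for two functions, inside and outside, glued along the unit circle. -/
theorem eq_of_eqOn_sphere_of_tendsto {E : Type*} [NormedAddCommGroup E] [NormedSpace ℂ E]
    [CompleteSpace E] {hp hm : ℂ → E} {a : E} (hpd : DiffContOnCl ℂ hp (ball 0 1))
    (hmd : DiffContOnCl ℂ hm (closedBall 0 1)ᶜ) (heq : ∀ z : ℂ, ‖z‖ = 1 → hp z = hm z)
    (hlim : Tendsto hm (cocompact ℂ) (𝓝 a)) : hp 0 = a := by
  have hmc : ∀ z : ℂ, 1 ≤ ‖z‖ → ContinuousWithinAt hm {z | 1 ≤ ‖z‖} z := fun z hz => by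
    have := hmd.continuousOn
    rw [closure_compl_closedBall_one] at this
    exact this z hz
  have hmdiff : ∀ z : ℂ, 1 < ‖z‖ → DifferentiableAt ℂ hm z := fun z hz =>
    hmd.differentiableOn.differentiableAt (isClosed_closedBall.isOpen_compl.mem_nhds (by simpa))
  have h1 : (∮ z in C(0, 1), (z - 0)⁻¹ • hp z) = (2 * Real.pi * Complex.I : ℂ) • hp 0 :=
    hpd.circleIntegral_sub_inv_smul (mem_ball_self one_pos)
  have h2 : (∮ z in C(0, 1), (z - 0)⁻¹ • hp z) = ∮ z in C(0, 1), (z - 0)⁻¹ • hm z := by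
    refine circleIntegral.integral_congr zero_le_one fun z hz => ?_
    rw [mem_sphere_zero_iff_norm] at hz
    simp only [heq z hz]
  have h3 : ∀ R : ℝ, 1 ≤ R → (∮ z in C(0, R), (z - 0)⁻¹ • hm z) =
      ∮ z in C(0, 1), (z - 0)⁻¹ • hm z := by
    intro R hR
    refine Complex.circleIntegral_sub_center_inv_smul_eq_of_differentiable_on_annulus_off_countable
      one_pos hR countable_empty ?_ ?_
    · rintro z ⟨-, hz⟩
      simp only [mem_ball_zero_iff, not_lt] at hz
      refine (hmc z hz).mono ?_
      rintro w ⟨-, hw⟩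
      simpa using hw
    · rintro z ⟨⟨-, hz⟩, -⟩
      simp only [mem_closedBall_zero_iff, not_le] at hz
      exact hmdiff z hz
  have h4 : ∀ ε > 0, ‖(2 * Real.pi * Complex.I : ℂ) • (hp 0 - a)‖ ≤ 2 * Real.pi * ε := by
    intro ε hε
    have hev : ∀ᶠ z in cocompact ℂ, ‖hm z - a‖ < ε := by
      have := Metric.tendsto_nhds.1 hlim ε hε
      simpa only [dist_eq_norm] using this
    obtain ⟨R₀, -, hR₀⟩ := (Metric.hasBasis_cobounded_compl_closedBall (0 : ℂ)).eventually_iff.1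
      (by rwa [← Metric.cobounded_eq_cocompact] at hev)
    set R := max 1 (R₀ + 1) with hR
    have hR1 : 1 ≤ R := le_max_left _ _
    have hRpos : 0 < R := one_pos.trans_le hR1
    have hbig : ∀ z ∈ sphere (0 : ℂ) R, ‖hm z - a‖ < ε := fun z hz => by
      rw [mem_sphere_zero_iff_norm] at hz
      refine hR₀ ?_
      simp only [mem_compl_iff, mem_closedBall_zero_iff, not_le, hz]
      exact lt_of_lt_of_le (lt_add_one R₀) (le_max_right _ _)
    have hcont : ContinuousOn hm (sphere (0 : ℂ) R) := fun z hz =>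
      (hmc z (by rw [mem_sphere_zero_iff_norm.1 hz]; exact hR1)).mono fun w hw => by
        rw [mem_ofPred_eq, mem_sphere_zero_iff_norm.1 hw]; exact hR1
    have hinv : ContinuousOn (fun z : ℂ => (z - 0)⁻¹) (sphere (0 : ℂ) R) := by
      refine ContinuousOn.inv₀ (by fun_prop) fun z hz => ?_
      rw [sub_zero]; exact ne_zero_of_mem_sphere hRpos.ne' ⟨z, hz⟩
    have h5 : (2 * Real.pi * Complex.I : ℂ) • (hp 0 - a) =
        ∮ z in C(0, R), (z - 0)⁻¹ • (hm z - a) := by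
      rw [smul_sub, ← h1, h2, ← h3 R hR1]
      have h6 : (∮ z in C(0, R), (z - 0)⁻¹ • a) = (2 * Real.pi * Complex.I : ℂ) • a := by
        rw [circleIntegral.integral_smul_const,
          circleIntegral.integral_sub_inv_of_mem_ball (mem_ball_self hRpos)]
      rw [← h6, ← circleIntegral.integral_sub (f := fun z => (z - 0)⁻¹ • hm z)
        (g := fun z => (z - 0)⁻¹ • a) ((hinv.smul hcont).circleIntegrable hRpos.le)
        ((hinv.smul continuousOn_const).circleIntegrable hRpos.le)]
      simp only [smul_sub]
    rw [h5]
    have := circleIntegral.norm_integral_le_of_norm_le_const (f := fun z => (z - 0)⁻¹ • (hm z - a))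
      (c := 0) (C := R⁻¹ * ε) hRpos.le (fun z hz => by
        rw [norm_smul, norm_inv, sub_zero, mem_sphere_zero_iff_norm.1 hz]
        exact mul_le_mul_of_nonneg_left (hbig z hz).le (by positivity))
    refine this.trans (le_of_eq ?_)
    field_simp
  have h5 : ‖(2 * Real.pi * Complex.I : ℂ) • (hp 0 - a)‖ = 0 := by
    refine le_antisymm (le_of_forall_pos_le_add fun ε hε => ?_) (norm_nonneg _)
    have h6 := h4 (ε / (2 * Real.pi)) (by positivity)
    rw [mul_div_cancel₀ _ Real.two_pi_pos.ne'] at h6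
    simpa using h6
  rw [norm_eq_zero, smul_eq_zero_iff_right Complex.two_pi_I_ne_zero, sub_eq_zero] at h5
  exact h5

variable {E : Type*} [NormedRing E] [NormedAlgebra ℂ E] [CompleteSpace E]

theorem diffContOnCl_ringInverse {s : Set ℂ} {f : ℂ → E} (hf : DiffContOnCl ℂ f s)
    (hu : ∀ z ∈ closure s, IsUnit (f z)) : DiffContOnCl ℂ (fun z => Ring.inverse (f z)) s :=
  ⟨hf.differentiableOn.inverse fun z hz => hu z (subset_closure hz), fun z hz => by
    obtain ⟨u, h⟩ := hu z hz
    have := NormedRing.inverse_continuousAt u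
    rw [h] at this
    exact this.comp_continuousWithinAt (hf.continuousOn z hz)⟩

omit [CompleteSpace E] in
theorem diffContOnCl_mul {s : Set ℂ} {f g : ℂ → E} (hf : DiffContOnCl ℂ f s)
    (hg : DiffContOnCl ℂ g s) : DiffContOnCl ℂ (fun z => f z * g z) s :=
  ⟨hf.differentiableOn.mul hg.differentiableOn, hf.continuousOn.mul hg.continuousOn⟩

theorem summable_powerSeries {a : ℕ → E} (ha : Summable fun k => ‖a k‖) {w : ℂ} (hw : ‖w‖ ≤ 1) :
    Summable fun k => w ^ k • a k := by
  refine Summable.of_norm_bounded ha fun k => ?_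
  rw [norm_smul, norm_pow]
  exact mul_le_of_le_one_left (norm_nonneg _) (pow_le_one₀ (norm_nonneg _) hw)

theorem diffContOnCl_powerSeries {a : ℕ → E} (ha : Summable fun k => ‖a k‖) :
    DiffContOnCl ℂ (fun w : ℂ => ∑' k, w ^ k • a k) (ball 0 1) := by
  have hb : ∀ (k : ℕ) (w : ℂ), ‖w‖ ≤ 1 → ‖w ^ k • a k‖ ≤ ‖a k‖ := fun k w hw => by
    rw [norm_smul, norm_pow]
    exact mul_le_of_le_one_left (norm_nonneg _) (pow_le_one₀ (norm_nonneg _) hw)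
  refine ⟨?_, ?_⟩
  · refine Complex.differentiableOn_tsum_of_summable_norm ha (fun k => by fun_prop) isOpen_ball ?_
    intro k w hw
    exact hb k w (mem_ball_zero_iff.1 hw).le
  · refine continuousOn_tsum (fun k => by fun_prop) ha ?_
    intro k w hw
    rw [closure_ball_one] at hw
    exact hb k w hw

omit [CompleteSpace E] in
theorem powerSeries_zero (a : ℕ → E) : ∑' k, (0 : ℂ) ^ k • a k = a 0 := by
  rw [tsum_eq_single 0 fun k hk => by simp [hk]]
  simp

theorem tendsto_inv_cocompact : Tendsto (fun z : ℂ => z⁻¹) (cocompact ℂ) (𝓝 0) :=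
  tendsto_inv₀_cobounded.mono_left (Metric.cobounded_eq_cocompact (α := ℂ)).ge

omit [CompleteSpace E] in
theorem diffContOnCl_comp_inv {φ : ℂ → E} (hφ : DiffContOnCl ℂ φ (ball 0 1)) :
    DiffContOnCl ℂ (fun z => φ z⁻¹) (closedBall 0 1)ᶜ := by
  refine ⟨?_, ?_⟩
  · refine hφ.differentiableOn.comp (fun z hz => ?_) fun z hz => ?_
    · have : z ≠ 0 := by rintro rfl; simp at hz
      exact (differentiableAt_inv this).differentiableWithinAt
    · simp only [mem_compl_iff, mem_closedBall_zero_iff, not_le] at hz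
      rw [mem_ball_zero_iff, norm_inv]
      exact inv_lt_one_of_one_lt₀ hz
  · have := hφ.continuousOn
    rw [closure_ball_one] at this
    rw [closure_compl_closedBall_one]
    refine this.comp (fun z hz => ?_) fun z hz => ?_
    · have : z ≠ 0 := by rintro rfl; simp [zero_lt_one.not_ge] at hz
      exact (continuousAt_inv₀ this).continuousWithinAt
    · rw [mem_ofPred_eq, norm_inv]
      exact inv_le_one_of_one_le₀ hz

/-- The coefficients, indexed by `ℤ`, of `∑ m i z^(-1-i)`. -/
def principalPart (m : SummableSeq E) (n : ℤ) : E := if n < 0 then m (-1 - n).toNat else 0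

theorem injective_neg_one_sub : Function.Injective fun i : ℕ => -1 - (i : ℤ) := fun a b h => by
  simpa using h

omit [NormedAlgebra ℂ E] [CompleteSpace E] in
theorem principalPart_neg_one_sub (m : SummableSeq E) (i : ℕ) : principalPart m (-1 - i) = m i := by
  rw [principalPart, if_pos (by omega), show (-1 - (-1 - (i : ℤ))).toNat = i by omega]

omit [NormedAlgebra ℂ E] [CompleteSpace E] in
theorem principalPart_eq_zero (m : SummableSeq E) (n : ℤ)
    (hn : n ∉ range fun i : ℕ => -1 - (i : ℤ)) : principalPart m n = 0 := by
  rw [principalPart, if_neg]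
  intro h
  exact hn ⟨(-1 - n).toNat, by simp; omega⟩

omit [NormedAlgebra ℂ E] [CompleteSpace E] in
theorem summable_norm_principalPart (m : SummableSeq E) :
    Summable fun n => ‖principalPart m n‖ := by
  rw [← injective_neg_one_sub.summable_iff fun n hn => by
    rw [principalPart_eq_zero m n hn, norm_zero]]
  simpa only [Function.comp_def, principalPart_neg_one_sub] using m.summable_norm

omit [NormedAlgebra ℂ E] [CompleteSpace E] in
theorem conv_principalPart (m : SummableSeq E) (c : ℤ → E) (n : ℤ) :
    ∑' p, principalPart m p * c (n - p) = ∑' i : ℕ, m i * c (n + 1 + i) := by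
  rw [← injective_neg_one_sub.tsum_eq]
  · refine tsum_congr fun i => ?_
    rw [principalPart_neg_one_sub]
    congr 2; ring
  · intro p hp
    by_contra h
    exact hp (by beta_reduce; rw [principalPart_eq_zero m p h, zero_mul])

theorem toeplitz_apply_eq_conv {c : ℤ → E} (hc : Summable fun n => ‖c n‖) (m : SummableSeq E)
    (j : ℕ) : toeplitz c m j = ∑' p, principalPart m p * c (-1 - j - p) := by
  rw [toeplitz_apply hc, conv_principalPart]
  refine tsum_congr fun i => ?_
  congr 2; ring

theorem hasSum_principalPart (m : SummableSeq E) {z : ℂ} (hz : ‖z‖ = 1) :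
    HasSum (fun n : ℤ => z ^ n • principalPart m n) (z⁻¹ • ∑' i, z⁻¹ ^ i • m i) := by
  have hz0 : z ≠ 0 := fun h => by simp [h] at hz
  rw [← injective_neg_one_sub.hasSum_iff fun n hn => by
    rw [principalPart_eq_zero m n hn, smul_zero]]
  have h1 := (summable_powerSeries m.summable_norm (w := z⁻¹) (by simp [hz])).hasSum
  convert h1.const_smul z⁻¹ using 1
  funext i
  simp only [Function.comp_apply]
  rw [principalPart_neg_one_sub, smul_smul]
  congr 1
  rw [zpow_sub₀ hz0, zpow_neg_one, zpow_natCast, inv_pow, div_eq_mul_inv]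

/-- A preimage of `headSeq a` under the Toeplitz operator of a loop with a Birkhoff factorization
has the leading coefficient prescribed by the factorization: the function equal to
`(∑ m i z⁻ⁱ) f₋⁻¹` outside and to `(a + O(z)) f₊⁻¹` inside is constant. -/
theorem head_mul_inverse_eq {F fm fp : ℂ → E} {g : E} {c : ℤ → E} (hc : Summable fun n => ‖c n‖)
    (hF : ∀ z : ℂ, ‖z‖ = 1 → HasSum (fun n : ℤ => z ^ n • c n) (F z))
    (hpd : DiffContOnCl ℂ fp (ball 0 1)) (hpu : ∀ z : ℂ, ‖z‖ ≤ 1 → IsUnit (fp z))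
    (hmd : DiffContOnCl ℂ fm (closedBall 0 1)ᶜ) (hmu : ∀ z : ℂ, 1 ≤ ‖z‖ → IsUnit (fm z))
    (hg : IsUnit g) (hlim : Tendsto fm (cocompact ℂ) (𝓝 g))
    (hfac : ∀ z : ℂ, ‖z‖ = 1 → F z = Ring.inverse (fm z) * fp z)
    {m : SummableSeq E} {a : E} (hm : toeplitz c m = headSeq E a) :
    m 0 * Ring.inverse g = a * Ring.inverse (fp 0) := by
  set e : ℤ → E := fun n => ∑' p, principalPart m p * c (n - p) with he
  have hes : Summable fun n => ‖e n‖ := summable_norm_conv (summable_norm_principalPart m) hc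
  have hej : ∀ j : ℕ, e (-1 - j) = headSeq E a j := fun j => by
    rw [← hm, toeplitz_apply_eq_conv hc]
  have hek : Summable fun k : ℕ => ‖e (k - 1)‖ :=
    hes.comp_injective (i := fun k : ℕ => (k : ℤ) - 1) fun x y h => by simpa using h
  -- on the unit circle, `z⁻¹ Q(z⁻¹)` is the function of `m`, and its product with `F` has leading
  -- term `a z⁻¹` by hypothesis, that is, the product is `z⁻¹ P(z)` with `P(0) = a`
  set P : ℂ → E := fun w => ∑' k : ℕ, w ^ k • e (k - 1) with hP
  set Q : ℂ → E := fun w => ∑' i : ℕ, w ^ i • m i with hQ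
  have hPQ : ∀ z : ℂ, ‖z‖ = 1 → P z = Q z⁻¹ * F z := by
    intro z hz
    have hz0 : z ≠ 0 := fun h => by simp [h] at hz
    have h1 := hasSum_conv (summable_norm_principalPart m) hc hz (hasSum_principalPart m hz)
      (hF z hz)
    have hinj : Function.Injective fun k : ℕ => (k : ℤ) - 1 := fun x y h => by simpa using h
    rw [← hinj.hasSum_iff] at h1
    · have h2 := h1.const_smul z
      rw [smul_mul_assoc, smul_smul, mul_inv_cancel₀ hz0, one_smul] at h2
      refine h2.tsum_eq.symm ▸ tsum_congr fun k => ?_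
      simp only [Function.comp_apply]
      rw [smul_smul, ← zpow_one_add₀ hz0, add_sub_cancel, zpow_natCast]
    · intro n hn
      have hn' : n + 1 < 0 := by
        by_contra h
        exact hn ⟨(n + 1).toNat, by simp; omega⟩
      have h3 := hej (-1 - n).toNat
      rw [show (-1 - ((-1 - n).toNat : ℤ)) = n by omega] at h3
      obtain ⟨l, hl⟩ : ∃ l, (-1 - n).toNat = l + 1 := ⟨(-1 - n).toNat - 1, by omega⟩
      rw [hl, headSeq_succ] at h3
      change z ^ n • e n = 0
      rw [h3, smul_zero]
  have hpu' : ∀ z ∈ closure (ball (0 : ℂ) 1), IsUnit (fp z) := fun z hz =>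
    hpu z (by rwa [closure_ball_one] at hz)
  have hmu' : ∀ z ∈ closure (closedBall (0 : ℂ) 1)ᶜ, IsUnit (fm z) := fun z hz =>
    hmu z (by rwa [closure_compl_closedBall_one] at hz)
  have key := eq_of_eqOn_sphere_of_tendsto (hp := fun z => P z * Ring.inverse (fp z))
    (hm := fun z => Q z⁻¹ * Ring.inverse (fm z)) (a := m 0 * Ring.inverse g)
    (diffContOnCl_mul (diffContOnCl_powerSeries hek) (diffContOnCl_ringInverse hpd hpu'))
    (diffContOnCl_mul (diffContOnCl_comp_inv (diffContOnCl_powerSeries m.summable_norm))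
      (diffContOnCl_ringInverse hmd hmu')) ?_ ?_
  · have hP0 : P 0 = a := by
      have h1 := powerSeries_zero fun k : ℕ => e (k - 1)
      have h2 := hej 0
      simp only [Nat.cast_zero, zero_sub, sub_zero, headSeq_zero] at h1 h2
      rw [← h2, ← h1]
    simp only [hP0] at key
    exact key.symm
  · intro z hz
    rw [hPQ z hz, hfac z hz, mul_assoc, mul_assoc,
      Ring.mul_inverse_cancel _ (hpu z hz.le), mul_one]
  · refine Tendsto.mul ?_ ?_
    · have h1 : ContinuousAt Q 0 :=
        (diffContOnCl_powerSeries m.summable_norm).differentiableOn.continuousOn.continuousAt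
          (ball_mem_nhds 0 one_pos)
      have h2 : Q 0 = m 0 := powerSeries_zero _
      have h3 : Tendsto Q (𝓝 0) (𝓝 (m 0)) := by rw [← h2]; exact h1
      exact h3.comp tendsto_inv_cocompact
    · obtain ⟨u, rfl⟩ := hg
      exact (NormedRing.inverse_continuousAt u).tendsto.comp hlim

/-- By `head_mul_inverse_eq` the elements of the kernel have leading coefficient zero; as the kernel
is then stable under `leftShift`, all coefficients vanish. -/
theorem toeplitz_injective {F fm fp : ℂ → E} {g : E} {c : ℤ → E} (hc : Summable fun n => ‖c n‖)
    (hF : ∀ z : ℂ, ‖z‖ = 1 → HasSum (fun n : ℤ => z ^ n • c n) (F z))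
    (hpd : DiffContOnCl ℂ fp (ball 0 1)) (hpu : ∀ z : ℂ, ‖z‖ ≤ 1 → IsUnit (fp z))
    (hmd : DiffContOnCl ℂ fm (closedBall 0 1)ᶜ) (hmu : ∀ z : ℂ, 1 ≤ ‖z‖ → IsUnit (fm z))
    (hg : IsUnit g) (hlim : Tendsto fm (cocompact ℂ) (𝓝 g))
    (hfac : ∀ z : ℂ, ‖z‖ = 1 → F z = Ring.inverse (fm z) * fp z) :
    Function.Injective (toeplitz c) := by
  have hzero : ∀ m : SummableSeq E, toeplitz c m = 0 → m 0 = 0 := by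
    intro m hm
    have h := head_mul_inverse_eq hc hF hpd hpu hmd hmu hg hlim hfac
      (m := m) (a := 0) (by rw [hm, map_zero])
    rw [zero_mul] at h
    have h2 := congrArg (· * g) h
    simpa [mul_assoc, Ring.inverse_mul_cancel g hg] using h2
  have hshift : ∀ m : SummableSeq E, toeplitz c m = 0 → toeplitz c (leftShift E m) = 0 := by
    intro m hm
    ext j
    have h1 := congrArg (fun x : SummableSeq E => x (j + 1)) hm
    simp only [toeplitz_apply hc] at h1 ⊢
    have hs : Summable fun i : ℕ => m i * c (i - (j + 1 : ℕ)) := by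
      obtain ⟨C, hC⟩ := hc.tendsto_cofinite_zero.bddAbove_range_of_cofinite
      refine Summable.of_norm_bounded (m.summable_norm.mul_right C) fun i => ?_
      exact (norm_mul_le _ _).trans
        (mul_le_mul_of_nonneg_left (hC ⟨_, rfl⟩) (norm_nonneg _))
    rw [hs.tsum_eq_zero_add, hzero m hm, zero_mul, zero_add] at h1
    refine Eq.trans (tsum_congr fun i => ?_) h1
    rw [leftShift_apply]
    congr 2; push_cast; ring
  have hall : ∀ (n : ℕ) (m : SummableSeq E), toeplitz c m = 0 → m n = 0 := by
    intro n
    induction n with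
    | zero => exact hzero
    | succ n ih => exact fun m hm => ih _ (hshift m hm)
  refine (injective_iff_map_eq_zero _).2 fun m hm => ?_
  ext n
  exact hall n m hm

end Birkhoff

/-! ### Holomorphic families of loops -/

section LoopFamily

variable {X E : Type*} [NormedAddCommGroup X] [NormedSpace ℂ X]
  [NormedRing E] [NormedAlgebra ℂ E]

/-- A holomorphic family, parametrized by the open set `M`, of invertible loops: `Φ x` is defined
and invertible near the unit circle for `x ∈ M`. Only the behaviour of `Φ` on the open set `O` of
pairs of a parameter and a point of the plane matters. -/
structure IsLoopFamily (Φ : X → ℂ → E) (M : Set X) (O : Set (X × ℂ)) : Prop where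
  isOpen : IsOpen M
  isOpen_domain : IsOpen O
  mem : ∀ x ∈ M, ∀ z : ℂ, ‖z‖ = 1 → (x, z) ∈ O
  differentiableOn : DifferentiableOn ℂ (fun p : X × ℂ => Φ p.1 p.2) O
  isUnit : ∀ p ∈ O, IsUnit (Φ p.1 p.2)

omit [NormedAlgebra ℂ E] [NormedSpace ℂ X] in
/-- By compactness of the unit circle, the annulus and the bound are uniform in `x` near `x₀`. -/
theorem exists_annulus_subset {O : Set (X × ℂ)} (hO : IsOpen O) {Ψ : X → ℂ → E}
    (hΨ : ContinuousOn (fun p : X × ℂ => Ψ p.1 p.2) O) {x₀ : X}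
    (h : ∀ z : ℂ, ‖z‖ = 1 → (x₀, z) ∈ O) :
    ∃ r ε C : ℝ, 0 < r ∧ r < 1 ∧ 0 < ε ∧ ∀ x ∈ ball x₀ ε, ∀ z : ℂ, r ≤ ‖z‖ → ‖z‖ ≤ r⁻¹ →
      (x, z) ∈ O ∧ ‖Ψ x z‖ ≤ C := by
  have h' : ∀ z ∈ sphere (0 : ℂ) 1, (x₀, z) ∈ O := fun z hz =>
    h z (mem_sphere_zero_iff_norm.1 hz)
  obtain ⟨C, hC⟩ := exists_norm_lt_of_sphere hΨ h'
  have hK : IsCompact (({x₀} : Set X) ×ˢ sphere (0 : ℂ) 1) :=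
    isCompact_singleton.prod (isCompact_sphere 0 1)
  obtain ⟨δ, hδ, hsub⟩ := hK.exists_cthickening_subset_open
    (hΨ.norm.isOpen_inter_preimage hO (isOpen_Iio (a := C))) (by
      rintro ⟨x, z⟩ ⟨hx, hz⟩
      rw [mem_singleton_iff] at hx
      subst hx
      exact ⟨h' z hz, hC z hz⟩)
  refine ⟨(1 + δ)⁻¹, δ, C, by positivity, inv_lt_one_of_one_lt₀ (by linarith), hδ, ?_⟩
  intro x hx z hz1 hz2
  have hz0 : 0 < ‖z‖ := lt_of_lt_of_le (by positivity) hz1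
  have hdist : |‖z‖ - 1| ≤ δ := by
    rw [inv_inv] at hz2
    rw [abs_le]
    refine ⟨?_, by linarith⟩
    have h1 : 1 - δ ≤ (1 + δ)⁻¹ := by
      rw [← one_div, le_div_iff₀ (by positivity)]
      nlinarith
    linarith
  set w : ℂ := (‖z‖⁻¹ : ℝ) • z with hw
  have hw1 : ‖w‖ = 1 := by
    rw [hw, norm_smul, Real.norm_of_nonneg (by positivity), inv_mul_cancel₀ hz0.ne']
  have hzw : dist z w ≤ δ := by
    have : z - w = (1 - ‖z‖⁻¹ : ℝ) • z := by rw [hw, sub_smul, one_smul]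
    rw [dist_eq_norm, this, norm_smul, Real.norm_eq_abs]
    calc |1 - ‖z‖⁻¹| * ‖z‖ = |(1 - ‖z‖⁻¹) * ‖z‖| := by rw [abs_mul, abs_norm]
      _ = |‖z‖ - 1| := by rw [sub_mul, one_mul, inv_mul_cancel₀ hz0.ne']
      _ ≤ δ := hdist
  have hmem : (x, z) ∈ cthickening δ (({x₀} : Set X) ×ˢ sphere (0 : ℂ) 1) := by
    refine mem_cthickening_of_dist_le (x, z) (x₀, w) δ _
      ⟨rfl, mem_sphere_zero_iff_norm.2 hw1⟩ ?_
    rw [Prod.dist_eq]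
    exact max_le (mem_ball.1 hx).le hzw
  have := hsub hmem
  exact ⟨this.1, (show ‖Ψ x z‖ < C from this.2).le⟩

variable [CompleteSpace E]

omit [CompleteSpace E] in
theorem exists_laurentCoeff_bound {O : Set (X × ℂ)} (hO : IsOpen O) {Ψ : X → ℂ → E}
    (hΨ : DifferentiableOn ℂ (fun p : X × ℂ => Ψ p.1 p.2) O) {x₀ : X}
    (h : ∀ z : ℂ, ‖z‖ = 1 → (x₀, z) ∈ O) :
    ∃ (ε : ℝ) (u : ℤ → ℝ), 0 < ε ∧ Summable u ∧ ∀ x ∈ ball x₀ ε, ∀ n,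
      ‖laurentCoeff (Ψ x) n‖ ≤ u n := by
  obtain ⟨r, ε, C, hr0, hr1, hε, hb⟩ := exists_annulus_subset hO hΨ.continuousOn h
  refine ⟨ε, fun n => C * r ^ n.natAbs, hε, (summable_pow_natAbs hr0.le hr1).mul_left C, ?_⟩
  intro x hx n
  have hc : Continuous fun z : ℂ => (x, z) := by fun_prop
  refine norm_laurentCoeff_le (hO.preimage hc) (F := Ψ x) ?_ hr0 hr1
    (fun z h1 h2 => (hb x hx z h1 h2).1) (fun z h1 h2 => (hb x hx z h1 h2).2) n
  exact DifferentiableOn.comp (g := fun p : X × ℂ => Ψ p.1 p.2) (f := fun z : ℂ => (x, z)) hΨ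
    (by fun_prop) fun z hz => hz

theorem hasSum_laurentCoeff_of_mem {O : Set (X × ℂ)} (hO : IsOpen O) {Ψ : X → ℂ → E}
    (hΨ : DifferentiableOn ℂ (fun p : X × ℂ => Ψ p.1 p.2) O) {x : X}
    (h : ∀ z : ℂ, ‖z‖ = 1 → (x, z) ∈ O) :
    (Summable fun n => ‖laurentCoeff (Ψ x) n‖) ∧
      ∀ z : ℂ, ‖z‖ = 1 → HasSum (fun n : ℤ => z ^ n • laurentCoeff (Ψ x) n) (Ψ x z) := by
  obtain ⟨ε, u, hε, hu, hb⟩ := exists_laurentCoeff_bound hO hΨ h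
  have hs : Summable fun n => ‖laurentCoeff (Ψ x) n‖ :=
    Summable.of_nonneg_of_le (fun _ => norm_nonneg _) (hb x (mem_ball_self hε)) hu
  refine ⟨hs, fun z hz => hasSum_laurentCoeff ?_ hs hz⟩
  exact ContinuousOn.comp (g := fun p : X × ℂ => Ψ p.1 p.2) (f := fun z : ℂ => (x, z))
    hΨ.continuousOn (by fun_prop) fun z hz => h z (mem_sphere_zero_iff_norm.1 hz)

omit [CompleteSpace E] in
theorem differentiableAt_tsum_mul {H : Type*} [NormedAddCommGroup H] [NormedSpace ℂ H]
    [CompleteSpace H] {R : E →L[ℂ] H →L[ℂ] H} {S : ℤ → (H →L[ℂ] H)}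
    (hR : ∀ a, ‖R a‖ ≤ ‖a‖) (hS : ∀ n, ‖S n‖ ≤ 1) {c : X → ℤ → E} {x : X} {ε : ℝ} {u : ℤ → ℝ}
    (hε : 0 < ε) (hu : Summable u) (hb : ∀ y ∈ ball x ε, ∀ n, ‖c y n‖ ≤ u n)
    (hc : ∀ n, DifferentiableOn ℂ (fun y => c y n) (ball x ε)) :
    DifferentiableAt ℂ (fun y => ∑' n, R (c y n) * S n) x := by
  refine differentiableAt_tsum_of_norm_le hu hε (fun n => ?_)
    fun n y hy => (norm_rep_mul_le hR hS _ _).trans (hb y hy n)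
  exact (R.differentiable.comp_differentiableOn (hc n)).mul_const (S n)

namespace IsLoopFamily

variable {Φ : X → ℂ → E} {M : Set X} {O : Set (X × ℂ)}

theorem summable (h : IsLoopFamily Φ M O) {x : X} (hx : x ∈ M) :
    Summable fun n => ‖laurentCoeff (Φ x) n‖ :=
  (hasSum_laurentCoeff_of_mem h.isOpen_domain h.differentiableOn (h.mem x hx)).1

theorem hasSum (h : IsLoopFamily Φ M O) {x : X} (hx : x ∈ M) {z : ℂ} (hz : ‖z‖ = 1) :
    HasSum (fun n : ℤ => z ^ n • laurentCoeff (Φ x) n) (Φ x z) :=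
  (hasSum_laurentCoeff_of_mem h.isOpen_domain h.differentiableOn (h.mem x hx)).2 z hz

theorem differentiableOn_laurentCoeff [FiniteDimensional ℂ X] (h : IsLoopFamily Φ M O) (n : ℤ) :
    DifferentiableOn ℂ (fun x => laurentCoeff (Φ x) n) M := by
  intro x hx
  refine DifferentiableAt.differentiableWithinAt ?_
  set O' : Set (X × ℂ) := O ∩ {p | p.2 ≠ 0} with hO'
  have hO'o : IsOpen O' := h.isOpen_domain.inter (isOpen_ne.preimage continuous_snd)
  have hd : DifferentiableOn ℂ (fun p : X × ℂ => p.2 ^ (-n - 1) • Φ p.1 p.2) O' := by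
    have h1 : DifferentiableOn ℂ (fun p : X × ℂ => p.2 ^ (-n - 1)) O' := fun p hp =>
      (DifferentiableAt.comp (g := fun z : ℂ => z ^ (-n - 1)) p
        (differentiableAt_zpow.2 (Or.inl hp.2)) differentiableAt_snd).differentiableWithinAt
    exact h1.smul (h.differentiableOn.mono inter_subset_left)
  have := differentiableAt_circleIntegral (Φ := fun x z => z ^ (-n - 1) • Φ x z) (x₀ := x)
    (R := 1) hO'o hd (hd.continuousOn_fderiv_of_finiteDimensional hO'o) zero_le_one
    (fun z hz => ⟨h.mem x hx z (mem_sphere_zero_iff_norm.1 hz),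
      ne_zero_of_mem_sphere one_ne_zero ⟨z, hz⟩⟩)
  exact this.const_smul _

theorem differentiableOn_toeplitz [FiniteDimensional ℂ X] (h : IsLoopFamily Φ M O) :
    DifferentiableOn ℂ (fun x => toeplitz (laurentCoeff (Φ x))) M := by
  intro x hx
  obtain ⟨ε, u, hε, hu, hb⟩ :=
    exists_laurentCoeff_bound h.isOpen_domain h.differentiableOn (h.mem x hx)
  obtain ⟨ε', hε', hb'⟩ := Metric.isOpen_iff.1 h.isOpen x hx
  exact (differentiableAt_tsum_mul (c := fun x => laurentCoeff (Φ x)) norm_rightMul_le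
    norm_shift_le (lt_min hε hε') hu
    (fun y hy => hb y (ball_subset_ball (min_le_left _ _) hy))
    (fun n => (h.differentiableOn_laurentCoeff n).mono
      ((ball_subset_ball (min_le_right _ _)).trans hb'))).differentiableWithinAt

theorem exists_leftParametrix [FiniteDimensional ℂ E] (h : IsLoopFamily Φ M O) {x : X}
    (hx : x ∈ M) : ∃ R : SummableSeq E →L[ℂ] SummableSeq E,
      R * toeplitz (laurentCoeff (Φ x)) - 1 ∈ approximable (SummableSeq E) := by
  have hd : DifferentiableOn ℂ (fun p : X × ℂ => Ring.inverse (Φ p.1 p.2)) O :=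
    h.differentiableOn.inverse h.isUnit
  obtain ⟨hs, hsum⟩ := hasSum_laurentCoeff_of_mem (Ψ := fun x z => Ring.inverse (Φ x z))
    h.isOpen_domain hd (h.mem x hx)
  exact ⟨_, toeplitz_mul_toeplitz_sub_one_mem (h.summable hx) hs
    (conv_eq_of_mul_eq_one (h.summable hx) hs (fun z hz => h.hasSum hx hz) hsum
      fun z hz => Ring.mul_inverse_cancel _ (h.isUnit (x, z) (h.mem x hx z hz)))⟩

theorem isFredholmZero [FiniteDimensional ℂ X] [FiniteDimensional ℂ E] (h : IsLoopFamily Φ M O)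
    {M' : Set X} (hM' : IsOpen M') (hc : IsPreconnected M') (hsub : M' ⊆ M) {x₀ : X}
    (hx₀ : x₀ ∈ M') (h₀ : IsFredholmZero (toeplitz (laurentCoeff (Φ x₀)))) :
    ∀ x ∈ M', IsFredholmZero (toeplitz (laurentCoeff (Φ x))) :=
  isFredholmZero_of_isPreconnected hM' hc (h.differentiableOn_toeplitz.continuousOn.mono hsub)
    (fun _ hx => h.exists_leftParametrix (hsub hx)) hx₀ h₀

end IsLoopFamily

omit [CompleteSpace E] in
theorem toeplitz_const (a : E) :
    toeplitz (fun n : ℤ => if n = 0 then a else 0) = rightMul E a := by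
  rw [toeplitz, tsum_eq_single 0 fun n hn => by rw [if_neg hn, map_zero, zero_mul], if_pos rfl,
    shift_zero, mul_one]

/-- A loop that extends holomorphically and invertibly to the plane is deformed to a constant by
shrinking the circle. -/
theorem isFredholmZero_toeplitz_of_entire [FiniteDimensional ℂ E] {F : ℂ → E}
    (hF : Differentiable ℂ F) (hu : ∀ z, IsUnit (F z)) :
    IsFredholmZero (toeplitz (laurentCoeff F)) := by
  have hfam : IsLoopFamily (fun w z : ℂ => F (w * z)) univ univ :=
    { isOpen := isOpen_univ
      isOpen_domain := isOpen_univ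
      mem := fun _ _ _ _ => mem_univ _
      differentiableOn := by
        have : Differentiable ℂ fun p : ℂ × ℂ => F (p.1 * p.2) := hF.comp (by fun_prop)
        exact this.differentiableOn
      isUnit := fun _ _ => hu _ }
  have h0 : IsFredholmZero (toeplitz (laurentCoeff fun z : ℂ => F (0 * z))) := by
    have hcoeff : laurentCoeff (fun z : ℂ => F (0 * z)) =
        fun n : ℤ => if n = 0 then F 0 else 0 := by
      simp_rw [zero_mul]
      exact funext (laurentCoeff_const (F 0))
    rw [hcoeff, toeplitz_const]
    obtain ⟨v, hv⟩ := hu 0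
    refine IsUnit.isFredholmZero ⟨⟨rightMul E (F 0), rightMul E ↑v⁻¹, ?_, ?_⟩, rfl⟩
    · rw [rightMul_mul_rightMul, ← hv, Units.inv_mul]
      ext m i; exact mul_one _
    · rw [rightMul_mul_rightMul, ← hv, Units.mul_inv]
      ext m i; exact mul_one _
  have := hfam.isFredholmZero isOpen_univ isPreconnected_univ Subset.rfl (mem_univ 0) h0 1
    (mem_univ 1)
  simpa using this

end LoopFamily

/-! ### The loops of a fundamental solution -/

theorem locallyPathConnectedSpace_of_complex (X : Type*) [NormedAddCommGroup X]
    [NormedSpace ℂ X] : LocallyPathConnectedSpace X :=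
  let _ : NormedSpace ℝ X := NormedSpace.restrictScalars ℝ ℂ X
  inferInstance

/-- Stated for a general ring, where the instances are found; on matrices the search does not see
that the topology is the one of the norm. -/
theorem completeSpace_summableSeq (E : Type*) [NormedRing E] [CompleteSpace E] :
    CompleteSpace (SummableSeq E) := inferInstance

namespace Isomonodromy

instance (N : ℕ) : CompleteSpace (SummableSeq (Gl N)) := completeSpace_summableSeq (Gl N)

variable {N : ℕ} {𝔞 : Submodule ℂ (Gl N)} {W : Set 𝔞} {f : 𝔞 → ℂ → Gl N}
  {β : 𝔞 → (𝔞 →L[ℂ] Gl N)}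

theorem mem_circlePairs_iff {x : 𝔞 × 𝔞} :
    x ∈ circlePairs W ↔ ∀ z : ℂ, ‖z‖ = 1 → z⁻¹ • x.1 + x.2 ∈ W := by
  constructor
  · intro h z hz
    have h1 := Complex.norm_mul_exp_arg_mul_I z⁻¹
    rw [norm_inv, hz, inv_one, Complex.ofReal_one, one_mul] at h1
    have h2 := h z⁻¹.arg
    rwa [h1, add_comm] at h2
  · intro h θ
    have h1 := h (Complex.exp (-(θ * Complex.I))) (by
      rw [← neg_mul, ← Complex.ofReal_neg, Complex.norm_exp_ofReal_mul_I])
    rwa [← Complex.exp_neg, neg_neg, add_comm] at h1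

/-- The set of all `((s, t), z)` for which `f (z⁻¹ s + t, z)` makes sense. -/
def loopDomain (W : Set 𝔞) : Set ((𝔞 × 𝔞) × ℂ) :=
  {p | p.2 ≠ 0 ∧ p.2⁻¹ • p.1.1 + p.1.2 ∈ W}

theorem isOpen_loopDomain (hW : IsOpen W) : IsOpen (loopDomain W) := by
  have h1 : IsOpen {p : (𝔞 × 𝔞) × ℂ | p.2 ≠ 0} := isOpen_ne.preimage continuous_snd
  refine ContinuousOn.isOpen_inter_preimage (f := fun p : (𝔞 × 𝔞) × ℂ => p.2⁻¹ • p.1.1 + p.1.2)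
    ?_ h1 hW
  have h2 : ContinuousOn (fun p : (𝔞 × 𝔞) × ℂ => p.2⁻¹) {p | p.2 ≠ 0} :=
    ContinuousOn.inv₀ (f := fun p : (𝔞 × 𝔞) × ℂ => p.2) continuous_snd.continuousOn
      fun p hp => hp
  exact (h2.smul (by fun_prop)).add (by fun_prop)

theorem mem_loopDomain {x : 𝔞 × 𝔞} (hx : x ∈ circlePairs W) {z : ℂ} (hz : ‖z‖ = 1) :
    (x, z) ∈ loopDomain W :=
  ⟨fun h => by simp only at h; simp [h] at hz, mem_circlePairs_iff.1 hx z hz⟩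

theorem isOpen_circlePairs (hW : IsOpen W) : IsOpen (circlePairs W) := by
  refine Metric.isOpen_iff.2 fun x hx => ?_
  obtain ⟨ε, hε, hb⟩ := exists_ball_prod_subset_of_sphere (isOpen_loopDomain hW) (x₀ := x)
    (R := 1) fun z hz => mem_loopDomain hx (mem_sphere_zero_iff_norm.1 hz)
  exact ⟨ε, hε, fun y hy => mem_circlePairs_iff.2 fun z hz =>
    (hb y hy z (mem_sphere_zero_iff_norm.2 hz)).2⟩

theorem zero_mem_circlePairs {t : 𝔞} (ht : t ∈ W) : ((0 : 𝔞), t) ∈ circlePairs W := fun θ => by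
  simpa using ht

theorem mainPairs_subset : mainPairs W ⊆ circlePairs W :=
  iUnion₂_subset fun _ _ => connectedComponentIn_subset _ _

theorem isOpen_mainPairs (hW : IsOpen W) : IsOpen (mainPairs W) :=
  have : LocallyPathConnectedSpace 𝔞 := locallyPathConnectedSpace_of_complex 𝔞
  isOpen_iUnion fun _ => isOpen_iUnion fun _ => (isOpen_circlePairs hW).connectedComponentIn

theorem zero_mem_mainPairs {t : 𝔞} (ht : t ∈ W) : ((0 : 𝔞), t) ∈ mainPairs W :=
  mem_iUnion₂.2 ⟨t, ht, mem_connectedComponentIn (zero_mem_circlePairs ht)⟩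

theorem mainPairs_eq (hW : IsPreconnected W) {t : 𝔞} (ht : t ∈ W) :
    mainPairs W = connectedComponentIn (circlePairs W) (0, t) := by
  have hpre : IsPreconnected ((fun t : 𝔞 => ((0 : 𝔞), t)) '' W) :=
    hW.image _ (by fun_prop)
  have hsub : (fun t : 𝔞 => ((0 : 𝔞), t)) '' W ⊆ connectedComponentIn (circlePairs W) (0, t) :=
    hpre.subset_connectedComponentIn ⟨t, ht, rfl⟩ (by
      rintro _ ⟨t', ht', rfl⟩; exact zero_mem_circlePairs ht')
  refine Subset.antisymm (iUnion₂_subset fun t' ht' => ?_)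
    (subset_iUnion₂_of_subset t ht Subset.rfl)
  rw [connectedComponentIn_eq (hsub ⟨t', ht', rfl⟩)]

theorem isPreconnected_mainPairs (hW : IsPreconnected W) : IsPreconnected (mainPairs W) := by
  rcases W.eq_empty_or_nonempty with rfl | ⟨t, ht⟩
  · simp [mainPairs, isPreconnected_empty]
  · rw [mainPairs_eq hW ht]; exact isPreconnected_connectedComponentIn

/-- The component of `s` in a slice lies in the main component. -/
theorem mem_mainPairs_of_mem_slice {s s' t : 𝔞} (h : (s, t) ∈ mainPairs W)
    (hs' : s' ∈ connectedComponentIn (circleSlice W t) s) : (s', t) ∈ mainPairs W := by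
  obtain ⟨t₀, ht₀, hx⟩ := mem_iUnion₂.1 h
  refine mem_iUnion₂.2 ⟨t₀, ht₀, ?_⟩
  rw [connectedComponentIn_eq hx]
  have hmem : s ∈ circleSlice W t := mainPairs_subset h
  have hpre : IsPreconnected
      ((fun s : 𝔞 => (s, t)) '' connectedComponentIn (circleSlice W t) s) :=
    isPreconnected_connectedComponentIn.image _ (by fun_prop)
  refine hpre.subset_connectedComponentIn ⟨s, mem_connectedComponentIn hmem, rfl⟩ ?_ ⟨s', hs', rfl⟩
  rintro _ ⟨r, hr, rfl⟩
  have hr' : r ∈ circleSlice W t := connectedComponentIn_subset _ _ hr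
  exact hr'

theorem isOpen_circleSlice (hW : IsOpen W) (t : 𝔞) : IsOpen (circleSlice W t) :=
  (isOpen_circlePairs hW).preimage (f := fun s : 𝔞 => (s, t)) (by fun_prop)

/-- The loop `z ↦ f (z⁻¹ s + t, z)` that is to be factorized. -/
def loop (f : 𝔞 → ℂ → Gl N) (x : 𝔞 × 𝔞) (z : ℂ) : Gl N := f (z⁻¹ • x.1 + x.2) z

theorem IsFundamentalSolution.isLoopFamily (hf : IsFundamentalSolution W β f) (hW : IsOpen W) :
    IsLoopFamily (loop f) (circlePairs W) (loopDomain W) where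
  isOpen := isOpen_circlePairs hW
  isOpen_domain := isOpen_loopDomain hW
  mem _ hx _ hz := mem_loopDomain hx hz
  differentiableOn := by
    refine DifferentiableOn.comp (g := fun p : 𝔞 × ℂ => f p.1 p.2)
      (f := fun p : (𝔞 × 𝔞) × ℂ => (p.2⁻¹ • p.1.1 + p.1.2, p.2)) hf.holomorphic ?_
      fun p hp => ⟨hp.2, mem_univ _⟩
    have h1 : DifferentiableOn ℂ (fun p : (𝔞 × 𝔞) × ℂ => p.2⁻¹) (loopDomain W) :=
      DifferentiableOn.inv (by fun_prop) fun p hp => hp.1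
    exact ((h1.smul (by fun_prop)).add (by fun_prop)).prodMk (by fun_prop)
  isUnit p hp := hf.isUnit _ hp.2 _

/-- The Toeplitz operator of the loop at `(s, t)`. -/
def loopToeplitz (f : 𝔞 → ℂ → Gl N) (x : 𝔞 × 𝔞) : SummableSeq (Gl N) →L[ℂ] SummableSeq (Gl N) :=
  toeplitz (laurentCoeff (loop f x))

/-- The loop at `(0, t₀)` is the entire function `f(t₀, ·)`, so the index there is zero; it is
constant on the connected set `mainPairs W`. -/
theorem IsFundamentalSolution.isFredholmZero (hf : IsFundamentalSolution W β f) (hW : IsOpen W)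
    (hWc : IsPreconnected W) {x : 𝔞 × 𝔞} (hx : x ∈ mainPairs W) :
    IsFredholmZero (loopToeplitz f x) := by
  obtain ⟨t₀, ht₀, -⟩ := mem_iUnion₂.1 hx
  refine (hf.isLoopFamily hW).isFredholmZero (isOpen_mainPairs hW) (isPreconnected_mainPairs hWc)
    mainPairs_subset (zero_mem_mainPairs ht₀) ?_ x hx
  have h1 : loop f (0, t₀) = f t₀ := by
    funext z; simp [loop]
  rw [h1]
  refine isFredholmZero_toeplitz_of_entire (fun z => ?_) (hf.isUnit t₀ ht₀)
  have h2 := hf.holomorphic.differentiableAt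
    ((hW.prod isOpen_univ).mem_nhds (show (t₀, z) ∈ W ×ˢ univ from ⟨ht₀, mem_univ z⟩))
  exact DifferentiableAt.comp (g := fun p : 𝔞 × ℂ => f p.1 p.2) (f := fun z => (t₀, z)) z h2
    (by fun_prop)

/-- The inverse of `f₊(s, t, 0)`, read off from the Toeplitz operator; it is holomorphic in `(s, t)`
wherever that operator is invertible. Elsewhere `Ring.inverse` makes it `0`. -/
def recip (f : 𝔞 → ℂ → Gl N) (x : 𝔞 × 𝔞) : Gl N :=
  (Ring.inverse (loopToeplitz f x) (headSeq (Gl N) 1)) 0 * NormedSpace.exp (-(x.1 : Gl N))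

/-- A Birkhoff factorization makes the Toeplitz operator injective, hence invertible, and identifies
`recip f` with the inverse of `f₊` at `z = 0`. -/
theorem IsFundamentalSolution.recip_eq (hf : IsFundamentalSolution W β f) (hW : IsOpen W)
    (hWc : IsPreconnected W) {s t : 𝔞} (hx : (s, t) ∈ mainPairs W) {fm fp : ℂ → Gl N}
    (h : IsBirkhoffFactorization f s t fm fp) :
    IsUnit (loopToeplitz f (s, t)) ∧ recip f (s, t) = (fp 0)⁻¹ := by
  have hxc := mainPairs_subset hx
  have hL := hf.isLoopFamily hW
  have hexp : IsUnit (NormedSpace.exp (s : Gl N)) := NormedSpace.isUnit_exp _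
  have hfac : ∀ z : ℂ, ‖z‖ = 1 → loop f (s, t) z = Ring.inverse (fm z) * fp z := fun z hz => by
    rw [← Matrix.nonsing_inv_eq_ringInverse]; exact h.factorization z hz
  have hu : IsUnit (loopToeplitz f (s, t)) :=
    (hf.isFredholmZero hW hWc hx).isUnit_of_injective
      (toeplitz_injective (hL.summable hxc) (fun z hz => hL.hasSum hxc hz) h.holomorphic_inside
        h.isUnit_inside h.holomorphic_outside h.isUnit_outside hexp h.at_infinity hfac)
  refine ⟨hu, ?_⟩
  have h1 : loopToeplitz f (s, t) (Ring.inverse (loopToeplitz f (s, t)) (headSeq (Gl N) 1)) =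
      headSeq (Gl N) 1 :=
    congrArg (fun L : SummableSeq (Gl N) →L[ℂ] SummableSeq (Gl N) => L (headSeq (Gl N) 1))
      (Ring.mul_inverse_cancel _ hu)
  have h2 := head_mul_inverse_eq (hL.summable hxc) (fun z hz => hL.hasSum hxc hz)
    h.holomorphic_inside h.isUnit_inside h.holomorphic_outside h.isUnit_outside hexp
    h.at_infinity hfac h1
  have h3 : Ring.inverse (NormedSpace.exp (s : Gl N)) = NormedSpace.exp (-(s : Gl N)) :=
    Ring.inverse_exp _
  rw [one_mul, h3] at h2
  rw [recip, h2, Matrix.nonsing_inv_eq_ringInverse]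

/-- The pairs in the main component at which the Toeplitz operator is invertible. -/
def regularPairs (W : Set 𝔞) (f : 𝔞 → ℂ → Gl N) : Set (𝔞 × 𝔞) :=
  {x | x ∈ mainPairs W ∧ IsUnit (loopToeplitz f x)}

/-- The regular pairs at which the candidate for `f₊(s, t, 0)⁻¹` is invertible. -/
def factorPairs (W : Set 𝔞) (f : 𝔞 → ℂ → Gl N) : Set (𝔞 × 𝔞) :=
  {x | x ∈ regularPairs W f ∧ IsUnit (recip f x)}

theorem IsFundamentalSolution.mem_factorPairs (hf : IsFundamentalSolution W β f) (hW : IsOpen W)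
    (hWc : IsPreconnected W) {s t : 𝔞} (hx : (s, t) ∈ mainPairs W) {fm fp : ℂ → Gl N}
    (h : IsBirkhoffFactorization f s t fm fp) : (s, t) ∈ factorPairs W f := by
  obtain ⟨h1, h2⟩ := hf.recip_eq hW hWc hx h
  refine ⟨⟨hx, h1⟩, ?_⟩
  rw [h2, Matrix.nonsing_inv_eq_ringInverse, isUnit_ringInverse]
  exact h.isUnit_inside 0 (by simp)

theorem IsFundamentalSolution.differentiableOn_recip (hf : IsFundamentalSolution W β f)
    (hW : IsOpen W) : DifferentiableOn ℂ (recip f) (regularPairs W f) := by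
  have h1 : DifferentiableOn ℂ (fun x => Ring.inverse (loopToeplitz f x)) (regularPairs W f) :=
    ((hf.isLoopFamily hW).differentiableOn_toeplitz.mono
      fun x hx => mainPairs_subset hx.1).inverse fun x hx => hx.2
  let ev : (SummableSeq (Gl N) →L[ℂ] SummableSeq (Gl N)) →L[ℂ] Gl N :=
    (lp.evalCLM ℂ (fun _ : ℕ => Gl N) 1 0).comp
      (ContinuousLinearMap.apply ℂ (SummableSeq (Gl N)) (headSeq (Gl N) 1))
  have h2 : DifferentiableOn ℂ (fun x => ev (Ring.inverse (loopToeplitz f x)))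
    (regularPairs W f) := ev.differentiable.comp_differentiableOn h1
  have h3 : Differentiable ℂ fun x : 𝔞 × 𝔞 => NormedSpace.exp (-(x.1 : Gl N)) := by
    have h4 : Differentiable ℂ fun y : Gl N => NormedSpace.exp y := fun y =>
      (NormedSpace.exp_analytic (𝕂 := ℂ) y).differentiableAt
    have h5 : Differentiable ℂ fun x : 𝔞 × 𝔞 => -(x.1 : Gl N) :=
      (𝔞.subtypeL.comp (ContinuousLinearMap.fst ℂ 𝔞 𝔞)).differentiable.neg
    exact h4.comp h5
  exact h2.mul h3.differentiableOn

theorem IsFundamentalSolution.isHypersurfaceCompl_regularPairs (hf : IsFundamentalSolution W β f)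
    (hW : IsOpen W) (hWc : IsPreconnected W) :
    IsHypersurfaceCompl (mainPairs W) (regularPairs W f) := by
  intro x hx
  obtain ⟨Δ, r, hr, hsub, hΔ, hiff⟩ := exists_holomorphic_isUnit_iff (isOpen_mainPairs hW)
    ((hf.isLoopFamily hW).differentiableOn_toeplitz.mono mainPairs_subset) hx
    (hf.isFredholmZero hW hWc hx)
  exact ⟨Δ, r, hr, hsub, hΔ, fun y hy =>
    ⟨fun h => (hiff y hy).1 h.2, fun h => ⟨hsub hy, (hiff y hy).2 h⟩⟩⟩

theorem IsFundamentalSolution.isOpen_regularPairs (hf : IsFundamentalSolution W β f)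
    (hW : IsOpen W) (hWc : IsPreconnected W) : IsOpen (regularPairs W f) :=
  (hf.isHypersurfaceCompl_regularPairs hW hWc).isOpen fun _ hx => hx.1

theorem IsFundamentalSolution.isPreconnected_regularPairs (hf : IsFundamentalSolution W β f)
    (hW : IsOpen W) (hWc : IsPreconnected W) : IsPreconnected (regularPairs W f) :=
  (hf.isHypersurfaceCompl_regularPairs hW hWc).isPreconnected (isPreconnected_mainPairs hWc)
    fun _ hx => hx.1

theorem IsFundamentalSolution.isHypersurfaceCompl_factorPairs (hf : IsFundamentalSolution W β f)
    (hW : IsOpen W) (hWc : IsPreconnected W) :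
    IsHypersurfaceCompl (regularPairs W f) (factorPairs W f) := by
  intro x hx
  obtain ⟨r, hr, hsub⟩ := Metric.isOpen_iff.1 (hf.isOpen_regularPairs hW hWc) x hx
  refine ⟨fun y => (recip f y).det, r, hr, hsub, ?_, fun y hy => ?_⟩
  · refine differentiableOn_matrix_det fun i j => ?_
    have hentry : Differentiable ℂ fun A : Gl N => A i j :=
      (LinearMap.toContinuousLinearMap (Matrix.entryLinearMap ℂ ℂ i j)).differentiable
    exact hentry.comp_differentiableOn ((hf.differentiableOn_recip hW).mono hsub)
  · rw [← isUnit_iff_ne_zero, ← Matrix.isUnit_iff_isUnit_det]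
    exact ⟨fun h => h.2, fun h => ⟨hsub hy, h⟩⟩

theorem IsFundamentalSolution.isOpen_factorPairs (hf : IsFundamentalSolution W β f)
    (hW : IsOpen W) (hWc : IsPreconnected W) : IsOpen (factorPairs W f) :=
  (hf.isHypersurfaceCompl_factorPairs hW hWc).isOpen fun _ hx => hx.1

theorem IsFundamentalSolution.isPreconnected_factorPairs (hf : IsFundamentalSolution W β f)
    (hW : IsOpen W) (hWc : IsPreconnected W) : IsPreconnected (factorPairs W f) :=
  (hf.isHypersurfaceCompl_factorPairs hW hWc).isPreconnected
    (hf.isPreconnected_regularPairs hW hWc) fun _ hx => hx.1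

end Isomonodromy

/-! ### Factorization near the zero section -/

/-- Grönwall's inequality for a curve that starts at `1` and satisfies `‖y'‖ ≤ K ‖y‖`. -/
theorem norm_sub_one_le_of_norm_deriv_le {A : Type*} [NormedRing A] [NormedAlgebra ℂ A]
    {y y' : ℂ → A} {K : ℝ} (hK : 0 < K)
    (hy : ∀ l ∈ Icc (0 : ℝ) 1, HasDerivAt y (y' l) (l : ℂ))
    (hb : ∀ l ∈ Icc (0 : ℝ) 1, ‖y' l‖ ≤ K * ‖y l‖) (h0 : y 0 = 1) :
    ‖y 1 - 1‖ ≤ ‖(1 : A)‖ * (Real.exp K - 1) := by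
  let _ : NormedSpace ℝ A := NormedSpace.restrictScalars ℝ ℂ A
  have hd : ∀ l ∈ Icc (0 : ℝ) 1, HasDerivAt (fun l : ℝ => y l - 1) (y' l) l := fun l hl => by
    have h1 : HasDerivAt (fun l : ℝ => (l : ℂ)) 1 l := Complex.ofRealCLM.hasDerivAt
    have h2 := HasDerivAt.scomp (g₁ := y) (h := fun l : ℝ => (l : ℂ)) l (hy l hl) h1
    rw [one_smul] at h2
    exact h2.sub_const 1
  have h1 := norm_le_gronwallBound_of_norm_deriv_right_le (f := fun l : ℝ => y l - 1)
    (f' := fun l => y' l) (δ := 0) (K := K) (ε := K * ‖(1 : A)‖) (a := 0) (b := 1)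
    (fun l hl => (hd l hl).continuousAt.continuousWithinAt)
    (fun l hl => (hd l (Ico_subset_Icc_self hl)).hasDerivWithinAt)
    (by simp [h0])
    (fun l hl => by
      refine (hb l (Ico_subset_Icc_self hl)).trans ?_
      rw [← mul_add]
      refine mul_le_mul_of_nonneg_left ?_ hK.le
      calc ‖y l‖ = ‖(y l - 1) + 1‖ := by rw [sub_add_cancel]
        _ ≤ ‖y l - 1‖ + ‖(1 : A)‖ := norm_add_le _ _) 1 (by simp)
  rw [gronwallBound_of_K_ne_0 hK.ne'] at h1
  simpa [mul_comm, hK.ne'] using h1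

namespace Isomonodromy

variable {N : ℕ} {𝔞 : Submodule ℂ (Gl N)} {W : Set 𝔞} {f : 𝔞 → ℂ → Gl N}
  {β : 𝔞 → (𝔞 →L[ℂ] Gl N)}

theorem IsFundamentalSolution.differentiableAt_left (hf : IsFundamentalSolution W β f)
    (hW : IsOpen W) {a : 𝔞} (ha : a ∈ W) (z : ℂ) : DifferentiableAt ℂ (fun a => f a z) a := by
  have h2 := hf.holomorphic.differentiableAt
    ((hW.prod isOpen_univ).mem_nhds (show (a, z) ∈ W ×ˢ univ from ⟨ha, mem_univ z⟩))
  exact DifferentiableAt.comp (g := fun p : 𝔞 × ℂ => f p.1 p.2) (f := fun a => (a, z)) a h2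
    (by fun_prop)

theorem IsFundamentalSolution.differentiableAt_right (hf : IsFundamentalSolution W β f)
    (hW : IsOpen W) {a : 𝔞} (ha : a ∈ W) (z : ℂ) : DifferentiableAt ℂ (f a) z := by
  have h2 := hf.holomorphic.differentiableAt
    ((hW.prod isOpen_univ).mem_nhds (show (a, z) ∈ W ×ˢ univ from ⟨ha, mem_univ z⟩))
  exact DifferentiableAt.comp (g := fun p : 𝔞 × ℂ => f p.1 p.2) (f := fun z => (a, z)) z h2
    (by fun_prop)

/-- The comparison `exp(λ s) f(t + λ z⁻¹ s, z) G` of the fundamental solution with the exponential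
along a segment of length `O(z⁻¹)` satisfies a linear equation with coefficient
`-z⁻¹ exp(λ s) β(s) exp(-λ s)`. The constant `G` is used to normalize it at `λ = 0`. -/
theorem IsFundamentalSolution.hasDerivAt_comparison (hf : IsFundamentalSolution W β f)
    (hW : IsOpen W) {s t : 𝔞} {z l : ℂ} (hz : z ≠ 0) (hmem : (l * z⁻¹) • s + t ∈ W) (G : Gl N) :
    HasDerivAt (fun l : ℂ => NormedSpace.exp (l • (s : Gl N)) * f ((l * z⁻¹) • s + t) z * G)
      (-(z⁻¹ • (NormedSpace.exp (l • (s : Gl N)) * β ((l * z⁻¹) • s + t) s *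
        NormedSpace.exp (-(l • (s : Gl N))) *
        (NormedSpace.exp (l • (s : Gl N)) * f ((l * z⁻¹) • s + t) z * G)))) l := by
  have h1 : HasDerivAt (fun l : ℂ => NormedSpace.exp (l • (s : Gl N)))
      (NormedSpace.exp (l • (s : Gl N)) * (s : Gl N)) l := hasDerivAt_exp_smul_const (s : Gl N) l
  have h2 : HasDerivAt (fun l : ℂ => (l * z⁻¹) • s + t) (z⁻¹ • s) l := by
    have := (((hasDerivAt_id l).mul_const z⁻¹).smul_const s).add_const t
    simp only [id, one_mul] at this
    exact this
  have h3 : HasDerivAt (fun l : ℂ => f ((l * z⁻¹) • s + t) z)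
      (fderiv ℂ (fun a => f a z) ((l * z⁻¹) • s + t) (z⁻¹ • s)) l := HasFDerivAt.comp_hasDerivAt
    (l := fun a => f a z) l (hf.differentiableAt_left hW hmem z).hasFDerivAt h2
  have h4 := hf.linear _ hmem z (z⁻¹ • s)
  have h5 : (fderiv ℂ (fun a => f a z) ((l * z⁻¹) • s + t)) (z⁻¹ • s) =
      -(z⁻¹ • (β ((l * z⁻¹) • s + t) s * f ((l * z⁻¹) • s + t) z)) -
        (s : Gl N) * f ((l * z⁻¹) • s + t) z := by
    rw [map_smul] at h4 ⊢
    rw [map_smul, smul_mul_assoc, Submodule.coe_smul, smul_mul_assoc, smul_smul,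
      mul_inv_cancel₀ hz, one_smul] at h4
    rw [eq_sub_iff_add_eq, eq_neg_iff_add_eq_zero, ← h4]
    abel
  refine ((h1.mul (h3.congr_deriv h5)).mul_const G).congr_deriv ?_
  have h6 : NormedSpace.exp (-(l • (s : Gl N))) * NormedSpace.exp (l • (s : Gl N)) = 1 := by
    have h7 : Ring.inverse (NormedSpace.exp (l • (s : Gl N))) =
      NormedSpace.exp (-(l • (s : Gl N))) := Ring.inverse_exp _
    rw [← h7]
    exact Ring.inverse_mul_cancel _ (NormedSpace.isUnit_exp _)
  generalize NormedSpace.exp (-(l • (s : Gl N))) = E' at *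
  generalize NormedSpace.exp (l • (s : Gl N)) = E at *
  generalize f ((l * z⁻¹) • s + t) z = F
  generalize β ((l * z⁻¹) • s + t) s = B
  have h8 : E * B * E' * (E * F * G) = E * B * F * G := by
    rw [show E * B * E' * (E * F * G) = E * B * (E' * E) * F * G by simp only [mul_assoc], h6,
      mul_one]
  rw [h8]
  simp only [mul_sub, mul_neg, sub_mul, add_mul, neg_mul, mul_smul_comm, smul_mul_assoc, mul_assoc]
  abel

/-- If the closed disc `t + ζ s`, `|ζ| ≤ 1`, lies in `W`, then the loop has the explicit
factorization with `f₊ = f(t, ·)`. The limit of `f₋` at infinity comes from Grönwall's inequality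
for `IsFundamentalSolution.hasDerivAt_comparison`. -/
theorem IsFundamentalSolution.exists_factorization (hf : IsFundamentalSolution W β f)
    (hW : IsOpen W) (hβ : ContinuousOn β W) {s t : 𝔞}
    (hst : ∀ ζ : ℂ, ‖ζ‖ ≤ 1 → ζ • s + t ∈ W) :
    ∃ fm : ℂ → Gl N, IsBirkhoffFactorization f s t fm (f t) := by
  have ht : t ∈ W := by simpa using hst 0 (by simp)
  have hin : ∀ z : ℂ, 1 ≤ ‖z‖ → z⁻¹ • s + t ∈ W := fun z hz =>
    hst _ (by rw [norm_inv]; exact inv_le_one_of_one_le₀ hz)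
  have hloop : ∀ z : ℂ, 1 ≤ ‖z‖ → IsUnit (f (z⁻¹ • s + t) z) := fun z hz =>
    hf.isUnit _ (hin z hz) z
  have hdiff : ∀ z : ℂ, 1 ≤ ‖z‖ →
      DifferentiableAt ℂ (fun z => f t z * Ring.inverse (f (z⁻¹ • s + t) z)) z := fun z hz => by
    have hz0 : z ≠ 0 := by rintro rfl; simp at hz; linarith
    have h1 := (hf.isLoopFamily hW).differentiableOn.differentiableAt
      ((isOpen_loopDomain hW).mem_nhds (show ((s, t), z) ∈ loopDomain W from ⟨hz0, hin z hz⟩))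
    have h2 : DifferentiableAt ℂ (fun z => f (z⁻¹ • s + t) z) z :=
      DifferentiableAt.comp (g := fun p : (𝔞 × 𝔞) × ℂ => loop f p.1 p.2)
        (f := fun z => ((s, t), z)) z h1 (by fun_prop)
    exact (hf.differentiableAt_right hW ht z).mul (h2.inverse (hloop z hz))
  obtain ⟨C, hC⟩ := ((isCompact_Icc (a := (0 : ℝ)) (b := 1)).prod
    (isCompact_closedBall (0 : ℂ) 1)).exists_bound_of_continuousOn
    (f := fun p : ℝ × ℂ => NormedSpace.exp ((p.1 : ℂ) • (s : Gl N)) * β (p.2 • s + t) s *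
        NormedSpace.exp (-((p.1 : ℂ) • (s : Gl N)))) (by
      have hexp : Continuous (NormedSpace.exp : Gl N → Gl N) := NormedSpace.exp_continuous
      have h1 : Continuous fun p : ℝ × ℂ => (p.1 : ℂ) • (s : Gl N) := by fun_prop
      have h2 : ContinuousOn (fun p : ℝ × ℂ => β (p.2 • s + t))
          (Icc (0 : ℝ) 1 ×ˢ closedBall (0 : ℂ) 1) :=
        hβ.comp (by fun_prop) fun p hp => hst _ (mem_closedBall_zero_iff.1 hp.2)
      exact ((hexp.comp h1).continuousOn.mul (h2.clm_apply continuousOn_const)).mul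
        (hexp.comp h1.neg).continuousOn)
  let D : ℝ := max C 1
  have hD : 0 < D := lt_max_of_lt_right one_pos
  let y : ℂ → Gl N := fun z =>
    NormedSpace.exp (s : Gl N) * f (z⁻¹ • s + t) z * Ring.inverse (f t z)
  have hest : ∀ z : ℂ, 1 ≤ ‖z‖ → ‖y z - 1‖ ≤ ‖(1 : Gl N)‖ * (Real.exp (‖z‖⁻¹ * D) - 1) := by
    intro z hz
    have hzp : 0 < ‖z‖ := one_pos.trans_le hz
    have hball : ∀ l ∈ Icc (0 : ℝ) 1, ‖(l : ℂ) * z⁻¹‖ ≤ 1 := fun l hl => by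
      rw [norm_mul, norm_inv, Complex.norm_real, Real.norm_of_nonneg hl.1]
      exact mul_le_one₀ hl.2 (by positivity) (inv_le_one_of_one_le₀ hz)
    have h1 := norm_sub_one_le_of_norm_deriv_le (K := ‖z‖⁻¹ * D)
      (y := fun l : ℂ => NormedSpace.exp (l • (s : Gl N)) * f ((l * z⁻¹) • s + t) z *
        Ring.inverse (f t z))
      (y' := fun l : ℂ => -(z⁻¹ • (NormedSpace.exp (l • (s : Gl N)) *
        β ((l * z⁻¹) • s + t) s * NormedSpace.exp (-(l • (s : Gl N))) *
        (NormedSpace.exp (l • (s : Gl N)) * f ((l * z⁻¹) • s + t) z * Ring.inverse (f t z)))))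
      (by positivity)
      (fun l hl => hf.hasDerivAt_comparison hW (norm_pos_iff.1 hzp) (hst _ (hball l hl))
        (Ring.inverse (f t z)))
      (fun l hl => by
        rw [norm_neg, norm_smul, norm_inv, mul_assoc ‖z‖⁻¹]
        refine mul_le_mul_of_nonneg_left (le_trans (norm_mul_le (_ : Gl N) (_ : Gl N)) ?_)
          (by positivity)
        exact mul_le_mul_of_nonneg_right ((hC (l, (l : ℂ) * z⁻¹)
          ⟨hl, mem_closedBall_zero_iff.2 (hball l hl)⟩).trans (le_max_left _ _)) (norm_nonneg _))
      (by
        simp only [zero_smul, zero_mul, zero_add, NormedSpace.exp_zero, one_mul]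
        exact Ring.mul_inverse_cancel _ (hf.isUnit t ht z))
    simpa only [one_smul, one_mul] using h1
  have hy : Tendsto y (cocompact ℂ) (𝓝 1) := by
    refine tendsto_iff_norm_sub_tendsto_zero.2 ?_
    have h1 : Tendsto (fun z : ℂ => ‖(1 : Gl N)‖ * (Real.exp (‖z‖⁻¹ * D) - 1)) (cocompact ℂ)
        (𝓝 0) := by
      have h2 : Tendsto (fun z : ℂ => ‖z‖⁻¹) (cocompact ℂ) (𝓝 0) :=
        tendsto_inv_atTop_zero.comp tendsto_norm_cocompact_atTop
      have h3 : Continuous fun x : ℝ => ‖(1 : Gl N)‖ * (Real.exp (x * D) - 1) := by fun_prop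
      have h4 := (h3.tendsto 0).comp h2
      simpa [Function.comp_def] using h4
    refine squeeze_zero' (Eventually.of_forall fun z => norm_nonneg _) ?_ h1
    filter_upwards [tendsto_norm_cocompact_atTop.eventually_ge_atTop (1 : ℝ)] with z hz
      using hest z hz
  refine ⟨fun z => f t z * Ring.inverse (f (z⁻¹ • s + t) z), ?_, fun z _ => hf.isUnit t ht z, ?_,
    fun z hz => (hf.isUnit t ht z).mul (isUnit_ringInverse.2 (hloop z hz)), ?_, fun z hz => ?_⟩
  · exact DifferentiableOn.diffContOnCl fun z _ =>
      (hf.differentiableAt_right hW ht z).differentiableWithinAt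
  · refine DifferentiableOn.diffContOnCl fun z hz => ?_
    rw [closure_compl_closedBall_one] at hz
    exact (hdiff z (by simpa using hz)).differentiableWithinAt
  · have h1 : Tendsto (fun z => Ring.inverse (y z)) (cocompact ℂ) (𝓝 (Ring.inverse 1)) :=
      (NormedRing.inverse_continuousAt (1 : (Gl N)ˣ)).tendsto.comp hy
    have h2 := h1.mul_const (NormedSpace.exp (s : Gl N))
    rw [Ring.inverse_one, one_mul] at h2
    refine h2.congr' ?_
    filter_upwards [tendsto_norm_cocompact_atTop.eventually_ge_atTop (1 : ℝ)] with z hz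
    have hu1 := hf.isUnit t ht z
    have hu2 := hloop z hz
    have huy : IsUnit (y z) :=
      ((NormedSpace.isUnit_exp (s : Gl N)).mul hu2).mul (isUnit_ringInverse.2 hu1)
    have h3 : y z * (f t z * Ring.inverse (f (z⁻¹ • s + t) z)) = NormedSpace.exp (s : Gl N) := by
      simp only [y]
      rw [mul_assoc, ← mul_assoc (Ring.inverse _), Ring.inverse_mul_cancel _ hu1, one_mul,
        mul_assoc, Ring.mul_inverse_cancel _ hu2, mul_one]
    rw [← h3, ← mul_assoc, Ring.inverse_mul_cancel _ huy, one_mul]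
  · have hu1 := hf.isUnit t ht z
    have hu2 := hloop z hz.ge
    have h1 : f t z * Ring.inverse (f (z⁻¹ • s + t) z) * f (z⁻¹ • s + t) z = f t z := by
      rw [mul_assoc, Ring.inverse_mul_cancel _ hu2, mul_one]
    rw [Matrix.nonsing_inv_eq_ringInverse]
    nth_rewrite 2 [← h1]
    rw [← mul_assoc, Ring.inverse_mul_cancel _ (hu1.mul (isUnit_ringInverse.2 hu2)), one_mul]

theorem IsFundamentalSolution.eventually_factorization (hf : IsFundamentalSolution W β f)
    (hW : IsOpen W) (hβ : ContinuousOn β W) {t₀ : 𝔞} (ht₀ : t₀ ∈ W) :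
    ∀ᶠ x : 𝔞 × 𝔞 in 𝓝 (0, t₀), x ∈ mainPairs W ∧
      ∃ fm : ℂ → Gl N, IsBirkhoffFactorization f x.1 x.2 fm (f x.2) := by
  obtain ⟨ε, hε, hball⟩ := Metric.isOpen_iff.1 hW t₀ ht₀
  have h1 : ∀ᶠ x : 𝔞 × 𝔞 in 𝓝 (0, t₀), ‖x.1‖ + dist x.2 t₀ < ε := by
    have hc : Continuous fun x : 𝔞 × 𝔞 => ‖x.1‖ + dist x.2 t₀ := by fun_prop
    exact hc.continuousAt.eventually_lt_const (by simpa using hε)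
  filter_upwards [h1, (isOpen_mainPairs hW).mem_nhds (zero_mem_mainPairs ht₀)] with x hx hxm
  refine ⟨hxm, hf.exists_factorization hW hβ fun ζ hζ => hball ?_⟩
  rw [mem_ball, dist_eq_norm, add_sub_assoc]
  refine (norm_add_le _ _).trans_lt (lt_of_le_of_lt ?_ hx)
  rw [← dist_eq_norm, norm_smul]
  exact add_le_add (mul_le_of_le_one_left (norm_nonneg _) hζ) le_rfl

end Isomonodromy

/-! ### Continuation of the solution -/

section PartialDerivative

variable {X Y E : Type*} [NormedAddCommGroup X] [NormedSpace ℂ X] [NormedAddCommGroup Y]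
  [NormedSpace ℂ Y] [NormedAddCommGroup E] [NormedSpace ℂ E]

theorem apply_eq_of_fderiv_apply_left_eq_zero {F : X × Y → E} {U : Set X} (hU : IsOpen U)
    (hUc : IsPreconnected U) {y : Y} (hF : ∀ x ∈ U, DifferentiableAt ℂ F (x, y))
    (h0 : ∀ x ∈ U, ∀ v, fderiv ℂ F (x, y) (v, 0) = 0) {x x' : X} (hx : x ∈ U) (hx' : x' ∈ U) :
    F (x, y) = F (x', y) := by
  have hd : ∀ x ∈ U, HasFDerivAt (fun x => F (x, y))
      ((fderiv ℂ F (x, y)).comp (ContinuousLinearMap.inl ℂ X Y)) x := fun x hx =>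
    HasFDerivAt.comp (g := F) (f := fun x => (x, y)) x (hF x hx).hasFDerivAt
      (hasFDerivAt_prodMk_left x y)
  refine hU.is_const_of_fderiv_eq_zero (𝕜 := ℂ) (f := fun x => F (x, y)) hUc
    (fun x hx => (hd x hx).differentiableAt.differentiableWithinAt) (fun x hx => ?_) hx hx'
  rw [(hd x hx).fderiv]
  ext v
  simpa using h0 x hx v

theorem fderiv_eq_of_eventuallyEq_comp_snd {F : X × Y → E} {g : Y → E} {x : X × Y}
    (h : F =ᶠ[𝓝 x] fun x => g x.2) (hg : DifferentiableAt ℂ g x.2) (v : X) (w : Y) :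
    fderiv ℂ F x (v, w) = fderiv ℂ g x.2 w := by
  have h1 : HasFDerivAt (fun x : X × Y => g x.2)
      ((fderiv ℂ g x.2).comp (ContinuousLinearMap.snd ℂ X Y)) x :=
    HasFDerivAt.comp (g := g) (f := fun x : X × Y => x.2) x hg.hasFDerivAt hasFDerivAt_snd
  rw [h.fderiv_eq, h1.fderiv]
  rfl

theorem differentiableAt_and_fderiv_of_eventuallyEq_slice {F : X × Y → E} {g : Y → E} {x : X}
    {y : Y} (h : g =ᶠ[𝓝 y] fun y => F (x, y)) (hF : DifferentiableAt ℂ F (x, y)) :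
    DifferentiableAt ℂ g y ∧
      fderiv ℂ g y = (fderiv ℂ F (x, y)).comp (ContinuousLinearMap.inr ℂ X Y) := by
  have h1 : HasFDerivAt g ((fderiv ℂ F (x, y)).comp (ContinuousLinearMap.inr ℂ X Y)) y :=
    (HasFDerivAt.comp (g := F) (f := fun y => (x, y)) y hF.hasFDerivAt
      (hasFDerivAt_prodMk_right x y)).congr_of_eventuallyEq h
  exact ⟨h1.differentiableAt, h1.fderiv⟩

theorem isPreconnected_ball_of_complex (x : X) (r : ℝ) : IsPreconnected (ball x r) :=
  let _ : NormedSpace ℝ X := NormedSpace.restrictScalars ℝ ℂ X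
  (convex_ball x r).isPreconnected

variable (X E)

/-- The operator norm on continuous linear maps, as a named term: on matrix-valued forms it is not
found by instance search, because the topology and the algebraic structure of matrices are declared
independently of the norm. -/
abbrev normedAddCommGroupCLM : NormedAddCommGroup (X →L[ℂ] E) := inferInstance

/-- The normed space structure that goes with `normedAddCommGroupCLM`. -/
abbrev normedSpaceCLM : NormedSpace ℂ (X →L[ℂ] E) := inferInstance

theorem completeSpaceCLM [CompleteSpace E] : CompleteSpace (X →L[ℂ] E) := inferInstance

theorem continuousAddCLM : ContinuousAdd (X →L[ℂ] E) := inferInstance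

theorem continuousSMulCLM : ContinuousSMul ℂ (X →L[ℂ] E) := inferInstance

end PartialDerivative

namespace Isomonodromy

instance (N : ℕ) (𝔞 : Submodule ℂ (Gl N)) : NormedAddCommGroup (𝔞 →L[ℂ] Gl N) :=
  normedAddCommGroupCLM 𝔞 (Gl N)

instance (N : ℕ) (𝔞 : Submodule ℂ (Gl N)) : NormedSpace ℂ (𝔞 →L[ℂ] Gl N) :=
  normedSpaceCLM 𝔞 (Gl N)

instance (N : ℕ) (𝔞 : Submodule ℂ (Gl N)) : ContinuousAdd (𝔞 →L[ℂ] Gl N) :=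
  continuousAddCLM 𝔞 (Gl N)

instance (N : ℕ) (𝔞 : Submodule ℂ (Gl N)) : ContinuousSMul ℂ (𝔞 →L[ℂ] Gl N) :=
  continuousSMulCLM 𝔞 (Gl N)

instance (N : ℕ) (𝔞 : Submodule ℂ (Gl N)) :
    @CompleteSpace (𝔞 →L[ℂ] Gl N) PseudoMetricSpace.toUniformSpace :=
  completeSpaceCLM 𝔞 (Gl N)

variable {N : ℕ} {𝔞 : Submodule ℂ (Gl N)} {W : Set 𝔞} {f : 𝔞 → ℂ → Gl N}
  {b : 𝔞 → Gl N} {β : 𝔞 → (𝔞 →L[ℂ] Gl N)}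

theorem fderiv_eq_of_eventuallyEq_gl {F : 𝔞 × 𝔞 → Gl N} {g : 𝔞 → Gl N} {x : 𝔞 × 𝔞}
    (h : F =ᶠ[𝓝 x] fun x => g x.2) (hg : DifferentiableAt ℂ g x.2) (v w : 𝔞) :
    fderiv ℂ F x (v, w) = fderiv ℂ g x.2 w :=
  fderiv_eq_of_eventuallyEq_comp_snd h hg v w

theorem fderiv_eq_of_eventuallyEq_form {F : 𝔞 × 𝔞 → (𝔞 →L[ℂ] Gl N)} {g : 𝔞 → (𝔞 →L[ℂ] Gl N)}
    {x : 𝔞 × 𝔞} (h : F =ᶠ[𝓝 x] fun x => g x.2) (hg : DifferentiableAt ℂ g x.2) (v w : 𝔞) :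
    fderiv ℂ F x (v, w) = fderiv ℂ g x.2 w :=
  fderiv_eq_of_eventuallyEq_comp_snd h hg v w

/-- The value `f₊(s, t, 0)`, wherever there is a factorization. -/
def headValue (f : 𝔞 → ℂ → Gl N) (x : 𝔞 × 𝔞) : Gl N := Ring.inverse (recip f x)

/-- The 1-form `-(d k) k⁻¹` for `k = headValue f (s, ·)` with fixed `s`, with `recip f`
for `k⁻¹`. -/
def headForm (f : 𝔞 → ℂ → Gl N) (x : 𝔞 × 𝔞) : 𝔞 →L[ℂ] Gl N :=
  -(((ContinuousLinearMap.mul ℂ (Gl N)).flip (recip f x)).comp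
    ((fderiv ℂ (headValue f) x).comp (ContinuousLinearMap.inr ℂ 𝔞 𝔞)))

/-- The contraction of `headForm` with the Euler vector field in `t`. -/
def headHiggs (f : 𝔞 → ℂ → Gl N) (x : 𝔞 × 𝔞) : Gl N := headForm f x x.2

theorem headForm_apply (x : 𝔞 × 𝔞) (c : 𝔞) :
    headForm f x c = -(fderiv ℂ (headValue f) x (0, c) * recip f x) := rfl

namespace IsFundamentalSolution

section Identities

variable (hf : IsFundamentalSolution W β f) (hW : IsOpen W) (hWc : IsPreconnected W)
  (hb : IsDeformationSolution W b β)
include hf hW hWc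

omit hWc in
theorem differentiableOn_headValue : DifferentiableOn ℂ (headValue f) (factorPairs W f) :=
  ((hf.differentiableOn_recip hW).mono fun _ hx => hx.1).inverse fun _ hx => hx.2

theorem differentiableOn_headForm : DifferentiableOn ℂ (headForm f) (factorPairs W f) := by
  have h1 := (hf.differentiableOn_headValue hW).fderiv_of_finiteDimensional
    (hf.isOpen_factorPairs hW hWc)
  have h2 : DifferentiableOn ℂ (fun x => (ContinuousLinearMap.mul ℂ (Gl N)).flip (recip f x))
      (factorPairs W f) :=
    ((ContinuousLinearMap.mul ℂ (Gl N)).flip).differentiable.comp_differentiableOn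
      ((hf.differentiableOn_recip hW).mono fun _ hx => hx.1)
  exact (h2.clm_comp (h1.clm_comp (differentiableOn_const _))).neg

theorem differentiableOn_headHiggs : DifferentiableOn ℂ (headHiggs f) (factorPairs W f) :=
  (hf.differentiableOn_headForm hW hWc).clm_apply differentiableOn_snd

include hb

theorem eventually_recip {t : 𝔞} (ht : t ∈ W) :
    ∀ᶠ x : 𝔞 × 𝔞 in 𝓝 (0, t), x ∈ factorPairs W f ∧ x.2 ∈ W ∧
      recip f x = Ring.inverse (f x.2 0) := by
  have h1 : ∀ᶠ x : 𝔞 × 𝔞 in 𝓝 (0, t), x.2 ∈ W :=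
    continuous_snd.continuousAt (hW.mem_nhds ht)
  filter_upwards [hf.eventually_factorization hW hb.holomorphic_form.continuousOn ht, h1]
    with x ⟨hx, fm, h⟩ hxW
  exact ⟨hf.mem_factorPairs hW hWc hx h, hxW, by
    rw [← Matrix.nonsing_inv_eq_ringInverse]; exact (hf.recip_eq hW hWc hx h).2⟩

theorem zero_mem_factorPairs {t : 𝔞} (ht : t ∈ W) : ((0 : 𝔞), t) ∈ factorPairs W f :=
  (hf.eventually_recip hW hWc hb ht).self_of_nhds.1

theorem eventually_headValue {t : 𝔞} (ht : t ∈ W) :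
    ∀ᶠ x : 𝔞 × 𝔞 in 𝓝 (0, t), headValue f x = f x.2 0 := by
  filter_upwards [hf.eventually_recip hW hWc hb ht] with x hx
  rw [headValue, hx.2.2, Ring.inverse_inverse (hf.isUnit _ hx.2.1 0)]

theorem eventually_headForm {t : 𝔞} (ht : t ∈ W) :
    ∀ᶠ x : 𝔞 × 𝔞 in 𝓝 (0, t), headForm f x = β x.2 := by
  filter_upwards [hf.eventually_recip hW hWc hb ht,
    (hf.eventually_headValue hW hWc hb ht).eventually_nhds] with x hx hxk
  ext1 c
  have h1 := hf.linear x.2 hx.2.1 0 c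
  rw [zero_smul, add_zero, add_eq_zero_iff_eq_neg] at h1
  rw [headForm_apply, fderiv_eq_of_eventuallyEq_gl (g := fun a => f a 0) hxk
    (hf.differentiableAt_left hW hx.2.1 0), h1, hx.2.2, neg_mul, neg_neg, mul_assoc,
    Ring.mul_inverse_cancel _ (hf.isUnit _ hx.2.1 0), mul_one]

theorem eventually_headHiggs {t : 𝔞} (ht : t ∈ W) :
    ∀ᶠ x : 𝔞 × 𝔞 in 𝓝 (0, t), headHiggs f x = b x.2 := by
  filter_upwards [hf.eventually_recip hW hWc hb ht, hf.eventually_headForm hW hWc hb ht]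
    with x hx hxf
  rw [headHiggs, hxf, hb.higgs _ hx.2.1]
  rfl

/-- The identity theorem on the connected set `factorPairs W f`. -/
theorem eq_zero_of_mem_factorPairs {E : Type*} [NormedAddCommGroup E] [NormedSpace ℂ E]
    [CompleteSpace E] {G : 𝔞 × 𝔞 → E} (hG : DifferentiableOn ℂ G (factorPairs W f))
    (h0 : ∀ t ∈ W, ∀ᶠ x in 𝓝 ((0 : 𝔞), t), G x = 0) {x : 𝔞 × 𝔞} (hx : x ∈ factorPairs W f) :
    G x = 0 := by
  obtain ⟨t, ht, -⟩ := mem_iUnion₂.1 hx.1.1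
  exact hG.eqOn_zero_of_isPreconnected (hf.isOpen_factorPairs hW hWc)
    (hf.isPreconnected_factorPairs hW hWc) (hf.zero_mem_factorPairs hW hWc hb ht) (h0 t ht) hx

/-- `recip f` is locally independent of `s`: near `(0, t)` it is the inverse of `f(t, 0)`, and
`regularPairs W f` is connected. -/
theorem fderiv_recip_left {x : 𝔞 × 𝔞} (hx : x ∈ regularPairs W f) (v : 𝔞) :
    fderiv ℂ (recip f) x (v, 0) = 0 := by
  obtain ⟨t, ht, -⟩ := mem_iUnion₂.1 hx.1
  have hG : DifferentiableOn ℂ (fun x => fderiv ℂ (recip f) x (v, 0)) (regularPairs W f) :=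
    ((hf.differentiableOn_recip hW).fderiv_of_finiteDimensional
      (hf.isOpen_regularPairs hW hWc)).clm_apply (differentiableOn_const _)
  refine hG.eqOn_zero_of_isPreconnected (hf.isOpen_regularPairs hW hWc)
    (hf.isPreconnected_regularPairs hW hWc) (hf.zero_mem_factorPairs hW hWc hb ht).1 ?_ hx
  filter_upwards [(hf.eventually_recip hW hWc hb ht).eventually_nhds] with x hx
  have h1 : recip f =ᶠ[𝓝 x] fun x => (fun a => Ring.inverse (f a 0)) x.2 := hx.mono fun _ h => h.2.2
  have hxW : x.2 ∈ W := hx.self_of_nhds.2.1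
  have h2 : DifferentiableAt ℂ (fun a => Ring.inverse (f a 0)) x.2 :=
    (hf.differentiableAt_left hW hxW 0).inverse (hf.isUnit _ hxW 0)
  rw [fderiv_eq_of_eventuallyEq_gl h1 h2, map_zero]
  rfl

theorem fderiv_headForm_left {x : 𝔞 × 𝔞} (hx : x ∈ factorPairs W f) (v : 𝔞) :
    fderiv ℂ (headForm f) x (v, 0) = 0 := by
  refine hf.eq_zero_of_mem_factorPairs hW hWc hb (G := fun x => fderiv ℂ (headForm f) x (v, 0))
    (((hf.differentiableOn_headForm hW hWc).fderiv_of_finiteDimensional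
      (hf.isOpen_factorPairs hW hWc)).clm_apply (differentiableOn_const _)) (fun t ht => ?_) hx
  filter_upwards [(hf.eventually_headForm hW hWc hb ht).eventually_nhds,
    hf.eventually_recip hW hWc hb ht] with x hx hxr
  rw [fderiv_eq_of_eventuallyEq_form hx
    (hb.holomorphic_form.differentiableAt (hW.mem_nhds hxr.2.1)), map_zero]
  rfl

/-- The equation holds near `(0, t)`, where `headHiggs` and `headForm` are `b` and `β`, and
continues to the connected set `factorPairs W f`; likewise for the two identities that follow. -/
theorem headHiggs_deformation {x : 𝔞 × 𝔞} (hx : x ∈ factorPairs W f) (c : 𝔞) :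
    fderiv ℂ (headHiggs f) x (0, c) + ⁅headForm f x c, headHiggs f x⁆ = 0 := by
  have h1 := hf.differentiableOn_headForm hW hWc
  have h2 := hf.differentiableOn_headHiggs hW hWc
  have h3 : DifferentiableOn ℂ (fun x => headForm f x c) (factorPairs W f) :=
    h1.clm_apply (differentiableOn_const _)
  refine hf.eq_zero_of_mem_factorPairs hW hWc hb
    (G := fun x => fderiv ℂ (headHiggs f) x (0, c) + ⁅headForm f x c, headHiggs f x⁆) ?_
    (fun t ht => ?_) hx
  · simp only [Ring.lie_def]
    exact ((h2.fderiv_of_finiteDimensional (hf.isOpen_factorPairs hW hWc)).clm_apply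
      (differentiableOn_const _)).add ((h3.mul h2).sub (h2.mul h3))
  · filter_upwards [(hf.eventually_headHiggs hW hWc hb ht).eventually_nhds,
      hf.eventually_headForm hW hWc hb ht, hf.eventually_recip hW hWc hb ht] with x hx hxf hxr
    rw [fderiv_eq_of_eventuallyEq_gl hx
      (hb.holomorphic_b.differentiableAt (hW.mem_nhds hxr.2.1)), hxf, hx.self_of_nhds]
    exact hb.deformation _ hxr.2.1 c

theorem headForm_bracket {x : 𝔞 × 𝔞} (hx : x ∈ factorPairs W f) (c : 𝔞) :
    ⁅headForm f x c, (x.2 : Gl N)⁆ = ⁅headHiggs f x, (c : Gl N)⁆ := by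
  have h2 := hf.differentiableOn_headHiggs hW hWc
  have h3 : DifferentiableOn ℂ (fun x => headForm f x c) (factorPairs W f) :=
    (hf.differentiableOn_headForm hW hWc).clm_apply (differentiableOn_const _)
  have h4 : DifferentiableOn ℂ (fun x : 𝔞 × 𝔞 => (x.2 : Gl N)) (factorPairs W f) :=
    (𝔞.subtypeL.comp (ContinuousLinearMap.snd ℂ 𝔞 𝔞)).differentiable.differentiableOn
  refine sub_eq_zero.1 (hf.eq_zero_of_mem_factorPairs hW hWc hb
    (G := fun x => ⁅headForm f x c, (x.2 : Gl N)⁆ - ⁅headHiggs f x, (c : Gl N)⁆) ?_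
    (fun t ht => ?_) hx)
  · simp only [Ring.lie_def]
    exact ((h3.mul h4).sub (h4.mul h3)).sub
      ((h2.mul (differentiableOn_const _)).sub ((differentiableOn_const _).mul h2))
  · filter_upwards [hf.eventually_headHiggs hW hWc hb ht, hf.eventually_headForm hW hWc hb ht,
      hf.eventually_recip hW hWc hb ht] with x hx hxf hxr
    rw [hxf, hx, sub_eq_zero]
    exact hb.bracket _ hxr.2.1 c

theorem headForm_invariant {x : 𝔞 × 𝔞} (hx : x ∈ factorPairs W f) :
    fderiv ℂ (headForm f) x (0, x.2) + headForm f x = 0 := by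
  have h1 := hf.differentiableOn_headForm hW hWc
  refine hf.eq_zero_of_mem_factorPairs hW hWc hb
    (G := fun x => fderiv ℂ (headForm f) x (0, x.2) + headForm f x) ?_ (fun t ht => ?_) hx
  · exact ((h1.fderiv_of_finiteDimensional (hf.isOpen_factorPairs hW hWc)).clm_apply
      ((differentiableOn_const _).prodMk differentiableOn_snd)).add h1
  · filter_upwards [(hf.eventually_headForm hW hWc hb ht).eventually_nhds,
      hf.eventually_recip hW hWc hb ht] with x hx hxr
    rw [fderiv_eq_of_eventuallyEq_form hx
      (hb.holomorphic_form.differentiableAt (hW.mem_nhds hxr.2.1)), hx.self_of_nhds]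
    have h2 := hb.invariant _ hxr.2.1
    have h3 : fderiv ℂ (euler 𝔞) x.2 = ContinuousLinearMap.id ℂ 𝔞 := fderiv_id
    rwa [lieDerivative, h3, ContinuousLinearMap.comp_id] at h2

end Identities

section Slices

variable (hf : IsFundamentalSolution W β f) (hW : IsOpen W) (hWc : IsPreconnected W)
  (hb : IsDeformationSolution W b β)
include hf hW hWc hb

theorem recip_eq_recip {U : Set 𝔞} (hU : IsOpen U) (hUc : IsPreconnected U) {t : 𝔞}
    (hUt : ∀ s ∈ U, (s, t) ∈ regularPairs W f) {s s' : 𝔞} (hs : s ∈ U) (hs' : s' ∈ U) :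
    recip f (s, t) = recip f (s', t) :=
  apply_eq_of_fderiv_apply_left_eq_zero hU hUc
    (fun s hs => (hf.differentiableOn_recip hW).differentiableAt
      ((hf.isOpen_regularPairs hW hWc).mem_nhds (hUt s hs)))
    (fun s hs v => hf.fderiv_recip_left hW hWc hb (hUt s hs) v) hs hs'

omit hb in
/-- Any two points of a component of a slice at which the Toeplitz operator is invertible lie in
a common connected open set of such points. -/
theorem exists_isPreconnected_regular {s s' t : 𝔞} (hs : (s, t) ∈ regularPairs W f)
    (hs' : (s', t) ∈ regularPairs W f) (h : s' ∈ connectedComponentIn (circleSlice W t) s) :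
    ∃ U : Set 𝔞, IsOpen U ∧ IsPreconnected U ∧ (∀ r ∈ U, (r, t) ∈ regularPairs W f) ∧
      s ∈ U ∧ s' ∈ U := by
  have : LocallyPathConnectedSpace 𝔞 := locallyPathConnectedSpace_of_complex 𝔞
  set C := connectedComponentIn (circleSlice W t) s with hC
  have hCo : IsOpen C := (isOpen_circleSlice hW t).connectedComponentIn
  have hCm : ∀ r ∈ C, (r, t) ∈ mainPairs W := fun r hr => mem_mainPairs_of_mem_slice hs.1 hr
  have hslice : IsHypersurfaceCompl C {r | r ∈ C ∧ IsUnit (loopToeplitz f (r, t))} := by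
    intro r hr
    have hd : DifferentiableOn ℂ (fun r : 𝔞 => loopToeplitz f (r, t)) C :=
      (hf.isLoopFamily hW).differentiableOn_toeplitz.comp (f := fun r : 𝔞 => (r, t))
        (by fun_prop) fun r hr => mainPairs_subset (hCm r hr)
    obtain ⟨Δ, ε, hε, hsub, hΔ, hiff⟩ := exists_holomorphic_isUnit_iff hCo hd hr
      (hf.isFredholmZero hW hWc (hCm r hr))
    exact ⟨Δ, ε, hε, hsub, hΔ, fun y hy =>
      ⟨fun h => (hiff y hy).1 h.2, fun h => ⟨hsub hy, (hiff y hy).2 h⟩⟩⟩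
  have hsC : s ∈ C := mem_connectedComponentIn (mainPairs_subset hs.1)
  exact ⟨_, hslice.isOpen fun _ hr => hr.1,
    hslice.isPreconnected isPreconnected_connectedComponentIn fun _ hr => hr.1,
    fun r hr => ⟨hCm r hr.1, hr.2⟩, ⟨hsC, hs.2⟩, ⟨h, hs'.2⟩⟩

/-- `recip f` has derivative zero along a slice, so it takes one value on the connected set of
points of a component at which the Toeplitz operator is invertible. -/
theorem plus_zero_eq {s s' t : 𝔞} (hs : (s, t) ∈ mainPairs W)
    (h : s' ∈ connectedComponentIn (circleSlice W t) s) {fm fp fm' fp' : ℂ → Gl N}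
    (hfac : IsBirkhoffFactorization f s t fm fp)
    (hfac' : IsBirkhoffFactorization f s' t fm' fp') : fp 0 = fp' 0 := by
  have hs' := mem_mainPairs_of_mem_slice hs h
  obtain ⟨U, hU, hUc, hUr, hsU, hsU'⟩ := hf.exists_isPreconnected_regular hW hWc
    (hf.mem_factorPairs hW hWc hs hfac).1 (hf.mem_factorPairs hW hWc hs' hfac').1 h
  have h1 := hf.recip_eq_recip hW hWc hb hU hUc hUr hsU hsU'
  rw [(hf.recip_eq hW hWc hs hfac).2, (hf.recip_eq hW hWc hs' hfac').2,
    Matrix.nonsing_inv_eq_ringInverse, Matrix.nonsing_inv_eq_ringInverse] at h1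
  rw [← Ring.inverse_inverse (hfac.isUnit_inside 0 (by simp)), h1,
    Ring.inverse_inverse (hfac'.isUnit_inside 0 (by simp))]

theorem plus_zero_eq_apply {s t : 𝔞} (ht : t ∈ W)
    (h : s ∈ connectedComponentIn (circleSlice W t) 0) {fm fp : ℂ → Gl N}
    (hfac : IsBirkhoffFactorization f s t fm fp) : fp 0 = f t 0 := by
  obtain ⟨fm', h'⟩ := hf.exists_factorization hW hb.holomorphic_form.continuousOn (s := 0) (t := t)
    fun ζ _ => by simpa using ht
  exact (hf.plus_zero_eq hW hWc hb (zero_mem_mainPairs ht) h h' hfac).symm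

theorem headForm_eq {s t : 𝔞} (ht : t ∈ W) (h : s ∈ connectedComponentIn (circleSlice W t) 0)
    (hs : (s, t) ∈ factorPairs W f) : headForm f (s, t) = β t := by
  have h0 := hf.zero_mem_factorPairs hW hWc hb ht
  obtain ⟨U, hU, hUc, hUr, h0U, hsU⟩ := hf.exists_isPreconnected_regular hW hWc h0.1 hs.1 h
  -- the candidate for the reciprocal value is constant on `U`, hence invertible throughout `U`
  have hUf : ∀ r ∈ U, (r, t) ∈ factorPairs W f := fun r hr => ⟨hUr r hr, by
    rw [hf.recip_eq_recip hW hWc hb hU hUc hUr hr h0U]; exact h0.2⟩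
  rw [apply_eq_of_fderiv_apply_left_eq_zero (F := headForm f) hU hUc
    (fun s hs => (hf.differentiableOn_headForm hW hWc).differentiableAt
      ((hf.isOpen_factorPairs hW hWc).mem_nhds (hUf s hs)))
    (fun s hs v => hf.fderiv_headForm_left hW hWc hb (hUf s hs) v) hsU h0U]
  exact (hf.eventually_headForm hW hWc hb ht).self_of_nhds

/-- Near a regular pair, `recip f` does not depend on its first argument. -/
theorem eventually_recip_eq {x : 𝔞 × 𝔞} (hx : x ∈ regularPairs W f) :
    ∀ᶠ y in 𝓝 x, recip f y = recip f (x.1, y.2) := by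
  obtain ⟨r, hr, hsub⟩ := Metric.isOpen_iff.1 (hf.isOpen_regularPairs hW hWc) x hx
  filter_upwards [ball_mem_nhds x hr] with y hy
  have hy' : y.1 ∈ ball x.1 r ∧ y.2 ∈ ball x.2 r := by
    rwa [← mem_prod, ball_prod_same]
  exact hf.recip_eq_recip hW hWc hb isOpen_ball (isPreconnected_ball_of_complex _ _) (t := y.2)
    (fun s hs => hsub (by
    rw [← Prod.mk.eta (p := x), ← ball_prod_same]; exact ⟨hs, hy'.2⟩)) hy'.1 (mem_ball_self hr)

theorem formOf_eventuallyEq {V : Set 𝔞} (hV : IsOpen V) {σ : 𝔞 → 𝔞} (hσ : ContinuousOn σ V)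
    {k : 𝔞 → Gl N} (hσV : ∀ t ∈ V, (σ t, t) ∈ factorPairs W f)
    (hk : ∀ t ∈ V, k t = headValue f (σ t, t)) {t₀ : 𝔞} (ht₀ : t₀ ∈ V) :
    (k =ᶠ[𝓝 t₀] fun t => headValue f (σ t₀, t)) ∧
      formOf k =ᶠ[𝓝 t₀] fun t => headForm f (σ t₀, t) := by
  have hVn := hV.mem_nhds ht₀
  have hσc : Tendsto (fun t => (σ t, t)) (𝓝 t₀) (𝓝 (σ t₀, t₀)) :=
    (hσ.continuousAt hVn).prodMk_nhds tendsto_id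
  have h1 : k =ᶠ[𝓝 t₀] fun t => headValue f (σ t₀, t) := by
    filter_upwards [hVn, hσc.eventually (hf.eventually_recip_eq hW hWc hb (hσV t₀ ht₀).1)]
      with t ht h
    rw [hk t ht]
    exact congrArg Ring.inverse h
  refine ⟨h1, ?_⟩
  have h2 : Tendsto (fun t => (σ t₀, t)) (𝓝 t₀) (𝓝 (σ t₀, t₀)) :=
    Continuous.tendsto (by fun_prop) t₀
  filter_upwards [h1.eventuallyEq_nhds,
    h2.eventually ((hf.isOpen_factorPairs hW hWc).mem_nhds (hσV t₀ ht₀))] with t ht hmem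
  have h4 : (k t)⁻¹ = recip f (σ t₀, t) := by
    rw [ht.self_of_nhds, Matrix.nonsing_inv_eq_ringInverse]
    exact Ring.inverse_inverse hmem.2
  have h5 : fderiv ℂ k t =
      (fderiv ℂ (headValue f) (σ t₀, t)).comp (ContinuousLinearMap.inr ℂ 𝔞 𝔞) :=
    (differentiableAt_and_fderiv_of_eventuallyEq_slice ht
      ((hf.differentiableOn_headValue hW).differentiableAt
        ((hf.isOpen_factorPairs hW hWc).mem_nhds hmem))).2
  rw [formOf, headForm, h4]
  exact congrArg (fun L : 𝔞 →L[ℂ] Gl N =>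
    -(((ContinuousLinearMap.mul ℂ (Gl N)).flip (recip f (σ t₀, t))).comp L)) h5

/-- The continuation solves the deformation problem, since near each point it is the restriction
of `headHiggs` and `headForm` to a slice with fixed `s`. -/
theorem isDeformationSolution_formOf {V : Set 𝔞} (hV : IsOpen V) {σ : 𝔞 → 𝔞}
    (hσ : ContinuousOn σ V) {k : 𝔞 → Gl N} (hσV : ∀ t ∈ V, (σ t, t) ∈ factorPairs W f)
    (hk : ∀ t ∈ V, k t = headValue f (σ t, t)) :
    DifferentiableOn ℂ k V ∧
      IsDeformationSolution V (contraction (euler 𝔞) (formOf k)) (formOf k) := by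
  have hkf := fun t₀ ht₀ => (hf.formOf_eventuallyEq hW hWc hb hV hσ hσV hk (t₀ := t₀) ht₀).1
  have hform := fun t₀ ht₀ => (hf.formOf_eventuallyEq hW hWc hb hV hσ hσV hk (t₀ := t₀) ht₀).2
  have hhiggs : ∀ t₀ ∈ V, contraction (euler 𝔞) (formOf k) =ᶠ[𝓝 t₀]
      fun t => headHiggs f (σ t₀, t) := fun t₀ ht₀ => by
    filter_upwards [hform t₀ ht₀] with t ht
    rw [contraction, ht]
    rfl
  have hmem := fun t₀ ht₀ => (hf.isOpen_factorPairs hW hWc).mem_nhds (hσV t₀ ht₀)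
  have hK := fun t₀ ht₀ => differentiableAt_and_fderiv_of_eventuallyEq_slice (hkf t₀ ht₀)
    ((hf.differentiableOn_headValue hW).differentiableAt (hmem t₀ ht₀))
  have hH := fun t₀ ht₀ => differentiableAt_and_fderiv_of_eventuallyEq_slice (hhiggs t₀ ht₀)
    ((hf.differentiableOn_headHiggs hW hWc).differentiableAt (hmem t₀ ht₀))
  have hB := fun t₀ ht₀ => differentiableAt_and_fderiv_of_eventuallyEq_slice (hform t₀ ht₀)
    ((hf.differentiableOn_headForm hW hWc).differentiableAt (hmem t₀ ht₀))
  refine ⟨fun t ht => (hK t ht).1.differentiableWithinAt,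
    fun t ht => (hH t ht).1.differentiableWithinAt,
    fun t ht => (hB t ht).1.differentiableWithinAt,
    fun t ht c => ?_, fun t ht c => ?_, fun _ _ => rfl, fun t ht => ?_⟩
  · have h4 : fderiv ℂ (contraction (euler 𝔞) (formOf k)) t =
        (fderiv ℂ (headHiggs f) (σ t, t)).comp (ContinuousLinearMap.inr ℂ 𝔞 𝔞) := (hH t ht).2
    rw [h4, (hform t ht).self_of_nhds, (hhiggs t ht).self_of_nhds]
    exact hf.headHiggs_deformation hW hWc hb (hσV t ht) c
  · rw [(hform t ht).self_of_nhds, (hhiggs t ht).self_of_nhds]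
    exact hf.headForm_bracket hW hWc hb (hσV t ht) c
  · have h3 : fderiv ℂ (euler 𝔞) t = ContinuousLinearMap.id ℂ 𝔞 := fderiv_id
    have h4 : fderiv ℂ (formOf k) t =
        (fderiv ℂ (headForm f) (σ t, t)).comp (ContinuousLinearMap.inr ℂ 𝔞 𝔞) := (hB t ht).2
    rw [lieDerivative, h3, ContinuousLinearMap.comp_id, h4,
      (hform t ht).self_of_nhds]
    exact hf.headForm_invariant hW hWc hb (hσV t ht)

end Slices

end IsFundamentalSolution

end Isomonodromy

end

theorem proposition1 (N : ℕ) (𝔞 : Submodule ℂ (Isomonodromy.Gl N))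
    (h𝔞 : Isomonodromy.IsAbelianSubalgebra 𝔞)
    (W : Set 𝔞) (hWo : IsOpen W) (hW : SimplyConnectedSpace W)
    (b : 𝔞 → Isomonodromy.Gl N) (β : 𝔞 → (𝔞 →L[ℂ] Isomonodromy.Gl N))
    (hb : Isomonodromy.IsDeformationSolution W b β)
    (f : 𝔞 → ℂ → Isomonodromy.Gl N) (hf : Isomonodromy.IsFundamentalSolution W β f) :
    -- the value of `f₊` at `z = 0` is independent of `s`
    (∀ s s' t : 𝔞, (s, t) ∈ Isomonodromy.mainPairs W →
      s' ∈ connectedComponentIn (Isomonodromy.circleSlice W t) s →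
      ∀ fm fp fm' fp' : ℂ → Isomonodromy.Gl N,
        Isomonodromy.IsBirkhoffFactorization f s t fm fp →
        Isomonodromy.IsBirkhoffFactorization f s' t fm' fp' →
        fp 0 = fp' 0) ∧
    -- it is `f (t, 0)` for `t ∈ W`
    (∀ t ∈ W, ∀ s ∈ connectedComponentIn (Isomonodromy.circleSlice W t) 0,
      ∀ fm fp : ℂ → Isomonodromy.Gl N,
        Isomonodromy.IsBirkhoffFactorization f s t fm fp → fp 0 = f t 0) ∧
    -- it determines a continuation of the solution beyond `W`
    (∀ V : Set 𝔞, IsOpen V → ∀ σ : 𝔞 → 𝔞, ContinuousOn σ V →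
      (∀ t ∈ V, (σ t, t) ∈ Isomonodromy.mainPairs W) →
      ∀ fm fp : 𝔞 → ℂ → Isomonodromy.Gl N,
        (∀ t ∈ V, Isomonodromy.IsBirkhoffFactorization f (σ t) t (fm t) (fp t)) →
        DifferentiableOn ℂ (fun t => fp t 0) V ∧
        Isomonodromy.IsDeformationSolution V
          (Isomonodromy.contraction (Isomonodromy.euler 𝔞)
            (Isomonodromy.formOf (fun t => fp t 0)))
          (Isomonodromy.formOf (fun t => fp t 0)) ∧
        ∀ t ∈ V ∩ W, σ t ∈ connectedComponentIn (Isomonodromy.circleSlice W t) 0 →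
          Isomonodromy.formOf (fun t => fp t 0) t = β t ∧
          Isomonodromy.contraction (Isomonodromy.euler 𝔞)
            (Isomonodromy.formOf (fun t => fp t 0)) t = b t) := by
  have hWc : IsPreconnected W := isPreconnected_iff_preconnectedSpace.2 inferInstance
  have hhead : ∀ {s t : 𝔞} {fm fp : ℂ → Isomonodromy.Gl N}, (s, t) ∈ Isomonodromy.mainPairs W →
      Isomonodromy.IsBirkhoffFactorization f s t fm fp →
      fp 0 = Isomonodromy.headValue f (s, t) := fun hx hfac => by
    rw [Isomonodromy.headValue, (hf.recip_eq hWo hWc hx hfac).2,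
      Matrix.nonsing_inv_eq_ringInverse, Ring.inverse_inverse (hfac.isUnit_inside 0 (by simp))]
  refine ⟨fun s s' t hs hs' fm fp fm' fp' h h' => hf.plus_zero_eq hWo hWc hb hs hs' h h',
    fun t ht s hs fm fp h => hf.plus_zero_eq_apply hWo hWc hb ht hs h,
    fun V hV σ hσ hσM fm fp hfac => ?_⟩
  have hσV : ∀ t ∈ V, (σ t, t) ∈ Isomonodromy.factorPairs W f := fun t ht =>
    hf.mem_factorPairs hWo hWc (hσM t ht) (hfac t ht)
  have hk : ∀ t ∈ V, fp t 0 = Isomonodromy.headValue f (σ t, t) := fun t ht =>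
    hhead (hσM t ht) (hfac t ht)
  obtain ⟨h1, h2⟩ := hf.isDeformationSolution_formOf hWo hWc hb hV hσ hσV hk
  refine ⟨h1, h2, fun t ht hσt => ?_⟩
  have h3 : Isomonodromy.formOf (fun t => fp t 0) t = β t :=
    (hf.formOf_eventuallyEq hWo hWc hb hV hσ hσV hk ht.1).2.self_of_nhds.trans
      (hf.headForm_eq hWo hWc hb ht.2 hσt (hσV t ht.1))
  refine ⟨h3, ?_⟩
  rw [Isomonodromy.contraction, h3, hb.higgs t ht.2]
  rfl
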